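/- Let $A$ be the polynomial ring over $\mathbb{Q}$ in the indeterminates $\theta_l$ ($l\ge 1$), $e_I$ ($I\subset\mathbb{Z}_{>0}$ finite) and $h_{k,l}$ ($k,l\ge 1$), let $\mathfrak a\subset A$ be the ideal generated by all $e_I$, and put $\bar A=A/\mathfrak a^2$. Let $M$ be the free $\bar A$-module on symbols $\zeta_{k,l}$ ($k\ge 0$, $l\ge 1$) and $B_0=\bigwedge_{\bar A}M$ its exterior algebra. Let $\mathcal I\subset B_0$ be the two-sided ideal generated by all $\theta_l,e_I,h_{k,l},\zeta_{k,l}$, and for $n\in\mathbb N$ let $\mathcal J_n$ be the two-sided ideal generated by those $\theta_l,e_I,h_{k,l},\zeta_{k,l}$ with $l\ge n$, $|I|\ge n$, $k+l\ge n$, $k+l\ge n$ respectively. Let $B_1=\varprojlim_n B_0/(\mathcal I^n+\mathcal J_n)$, with the inverse limit topology, and let $B_{\mathrm{HdR}}=B_1[\theta_l^{-1},\,l\ge1]$ be the Higgs–de Rham ring. Infinite sums below are sums convergent in $B_1$, regarded in $B_{\mathrm{HdR}}$. The following operators are defined on $B_0$, are $\mathbb Q[\theta_1,\theta_2,\dots]$-linear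 and continuous, and are extended by continuity to $B_1$ and then linearly to $B_{\mathrm{HdR}}$: * $d$, with $d\theta_l=de_I=d\zeta_{k,l}=0$, $dh_{k,l}=\zeta_{k,l}-\zeta_{k-1,l}$, and $d(xy)=(dx)y+(-1)^n x\,dy$ for $x\in\bigwedge^nM$; * $\Theta$, the derivation ($\Theta(xy)=(\Theta x)y+x\,\Theta y$) with $\Theta\theta_l=\Theta h_{k,l}=\Theta\zeta_{k,l}=0$ and $\Theta e_I=\sum_{k=1}^{m}(-1)^{k-1}\theta_{i_k}e_{I\setminus\{i_k\}}$ for $I=\{i_1<\dots<i_m\}$ (so $\Theta e_\emptyset=0$); * $\mathrm{Shift}_m$ ($m\ge 0$), the ring endomorphism fixing all $\theta_l$ and $e_I$, with $\zeta_{k,l}\mapsto\zeta_{k,l}$ for $k<m$ and $\zeta_{k,l}\mapsto\zeta_{k+1,l}$ for $k\ge m$, and with $h_{k,l}\mapsto h_{k,l}$ for $k<m$, $h_{m,l}\mapsto h_{m,l}+h_{m+1,l}$ (if $m\ge1$), and $h_{k,l}\mapsto h_{k+1,l}$ for $k>m$. Put $\nabla=d+\sum_{l\ge1}\theta_l\zeta_{0,l}$,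 $\delta_0=\exp\bigl(\sum_{l\ge1}\theta_lh_{1,l}\bigr)\mathrm{Shift}_0$ (the sum and the exponential acting by left multiplication) and $\delta_m=\mathrm{Shift}_m$ for $m>0$. For $\varphi:\mathbb Z\times\mathbb Z\to B_{\mathrm{HdR}}$ define $$(D\varphi)(r,s)=\nabla\varphi(r,s-1)+(-1)^s\sum_{k=0}^r(-1)^k\delta_k\varphi(r-1,s)-\Theta\varphi(r,s),$$ where the sum over $k$ is empty if $r<0$. **Theorem.** There is a function $\varphi:\mathbb Z\times\mathbb Z\to B_{\mathrm{HdR}}$ such that $$D\varphi=0;\qquad \varphi(0,s)=\sum_{|I|=s}e_I\zeta_{0,I}\ \ (s\ge0);\qquad \varphi(r,s)=0\ \text{ if } r<0 \text{ or } s<0,$$ where $\zeta_{0,I}=\zeta_{0,i_1}\cdots\zeta_{0,i_s}$ for $I=\{i_1<\dots<i_s\}$ and $\zeta_{0,\emptyset}=1$. Moreover, such a solution is given, for $r,s\ge0$, by the explicit (convergent) formula $$\varphi_\infty(r,s)=\sum_{(j,\underline s,\underline i)\in T(r,s)}\Bigl[\sum_{\overline i\in(\mathbb Z_{>0})^r}a(j,\underline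 s)\,j_{\overline i}\,\theta_{\overline i}^{-1}\,\theta^{j}\,e_{\underline i,\overline i}\Bigr]h^{[j]}\zeta_{\underline s,\underline i}.$$ Here $T(r,s)$ is the set of triples consisting of a finitely supported family $j=(j_{k,l})_{k,l\ge1}$ of non-negative integers with $j_{k,l}=0$ for $k>r$, a sequence $\underline s=(s_0,\dots,s_r)$ of non-negative integers with $\sum_k s_k=s$ (put $s_k=0$ for $k>r$), and positive integers $i_{k,1}<\dots<i_{k,s_k}$ for each $0\le k\le r$, where $\underline i$ is their concatenation $(i_{0,1},\dots,i_{0,s_0},i_{1,1},\dots,i_{r,s_r})$; for $\overline i=(i^1,\dots,i^r)$ one puts $j_{\overline i}=\prod_{k=1}^r j_{k,i^k}$ and $\theta_{\overline i}=\prod_{k=1}^r\theta_{i^k}$; $\theta^j=\prod_{k,l}\theta_l^{j_{k,l}}$; $h^{[j]}=\prod_{k,l}h_{k,l}^{j_{k,l}}/j_{k,l}!$; $\zeta_{\underline s,\underline i}=\zeta_{0,i_{0,1}}\cdots\zeta_{0,i_{0,s_0}}\zeta_{1,i_{1,1}}\cdots\zeta_{r,i_{r,s_r}}$; $e_{\underline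 i,\overline i}$ is $0$ if the sequence $(\underline i,\overline i)$ of length $r+s$ has a repeated entry, and otherwise $\operatorname{sgn}(\sigma)\,e_J$ with $J$ the set of its entries and $\sigma$ the permutation that puts the sequence in increasing order; and $$a(j,\underline s)=\frac{\prod_l s_l!}{\prod_{p\ge1}\prod_{q=0}^{s_{p-1}}\max\{1,\;q+\sum_{k\ge p,\,l}j_{k,l}+\sum_{l\ge p}s_l\}}.$$ -/

import Mathlib

noncomputable section

namespace HdR

/-! ## The algebra `Ā` and the exterior algebra `B₀` -/

/-- The indeterminates of the polynomial algebra `A`. -/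
inductive Gen : Type
  | theta (l : ℕ+) : Gen
  | e (I : Finset ℕ+) : Gen
  | h (k l : ℕ+) : Gen

/-- The size of an indeterminate: `l` for `θ_l`, `|I|` for `e_I`, `k + l` for `h_{k,l}`. -/
def Gen.size : Gen → ℕ
  | .theta l => l
  | .e I => I.card
  | .h k l => k + l

/-- The polynomial algebra over `ℚ` in the `θ_l`, `e_I`, `h_{k,l}`. -/
abbrev APoly : Type := MvPolynomial Gen ℚ

/-- The ideal of `A` generated by the `e_I`. -/
def aIdeal : Ideal APoly := Ideal.span (Set.range fun I => MvPolynomial.X (Gen.e I))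

/-- `Ā = A / 𝔞²`. -/
def Abar : Type := APoly ⧸ aIdeal ^ 2

instance : CommRing Abar := inferInstanceAs (CommRing (APoly ⧸ aIdeal ^ 2))
instance : Algebra ℚ Abar := inferInstanceAs (Algebra ℚ (APoly ⧸ aIdeal ^ 2))

/-- The projection `A → Ā`. -/
def Abar.proj : APoly →ₐ[ℚ] Abar := Ideal.Quotient.mkₐ ℚ (aIdeal ^ 2)

/-- The class of an indeterminate in `Ā`. -/
def Abar.gen (g : Gen) : Abar := Abar.proj (MvPolynomial.X g)

/-- The polynomial ring `ℚ[θ_1, θ_2, …]`. -/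
abbrev ThetaPoly : Type := MvPolynomial ℕ+ ℚ

instance : Algebra ThetaPoly Abar :=
  (MvPolynomial.aeval (R := ℚ) fun l : ℕ+ => Abar.gen (.theta l)).toRingHom.toAlgebra

theorem algebraMap_theta_X (l : ℕ+) :
    algebraMap ThetaPoly Abar (MvPolynomial.X l) = Abar.gen (.theta l) := by
  change MvPolynomial.aeval _ _ = _
  simp

theorem algebraMap_theta_C (c : ℚ) :
    algebraMap ThetaPoly Abar (MvPolynomial.C c) = algebraMap ℚ Abar c := by
  change MvPolynomial.aeval _ _ = _
  simp

theorem Abar.e_mul_e (I J : Finset ℕ+) : Abar.gen (.e I) * Abar.gen (.e J) = 0 := by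
  unfold Abar.gen
  rw [← map_mul]
  refine Ideal.Quotient.eq_zero_iff_mem.2 ?_
  rw [pow_two]
  exact Ideal.mul_mem_mul (Ideal.subset_span ⟨I, rfl⟩) (Ideal.subset_span ⟨J, rfl⟩)

/-- Ring homomorphisms out of `Ā`. -/
def Abar.lift {C : Type*} [CommRing C] [Algebra ℚ C] (v : Gen → C)
    (hv : ∀ I J, v (.e I) * v (.e J) = 0) : Abar →ₐ[ℚ] C :=
  Ideal.Quotient.liftₐ (aIdeal ^ 2) (MvPolynomial.aeval v) (by
    have hle : aIdeal ^ 2 ≤ RingHom.ker (MvPolynomial.aeval (R := ℚ) v) := by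
      rw [pow_two, aIdeal, Ideal.span_mul_span', Ideal.span_le]
      rintro _ ⟨_, ⟨I, rfl⟩, _, ⟨J, rfl⟩, rfl⟩
      simp [RingHom.mem_ker, hv]
    exact fun a ha => hle ha)

theorem Abar.lift_gen {C : Type*} [CommRing C] [Algebra ℚ C] (v : Gen → C)
    (hv : ∀ I J, v (.e I) * v (.e J) = 0) (g : Gen) : Abar.lift v hv (Abar.gen g) = v g := by
  change MvPolynomial.aeval v (MvPolynomial.X g) = v g
  simp

theorem Abar.induction {P : Abar → Prop} (hC : ∀ c : ℚ, P (algebraMap ℚ Abar c))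
    (hg : ∀ g, P (Abar.gen g)) (hadd : ∀ a b, P a → P b → P (a + b))
    (hmul : ∀ a b, P a → P b → P (a * b)) (a : Abar) : P a := by
  obtain ⟨p, rfl⟩ := Ideal.Quotient.mk_surjective a
  change P (Abar.proj p)
  induction p using MvPolynomial.induction_on with
  | C c => exact hC c
  | add p q hp hq => rw [map_add]; exact hadd _ _ hp hq
  | mul_X p g hp => rw [map_mul]; exact hmul _ _ hp (hg g)

section der

variable {N : Type*} [AddCommGroup N] [Module Abar N] [Module ℚ N] [IsScalarTower ℚ Abar N]
  [Module Abarᵐᵒᵖ N] [IsCentralScalar Abar N] [IsScalarTower ℚ Abarᵐᵒᵖ N] (v : Gen → N)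
  (hv : ∀ I J, Abar.gen (.e I) • v (.e J) + Abar.gen (.e J) • v (.e I) = 0)

/-- The homomorphism `a ↦ (a, D a)` to the square-zero extension of `Ā` by `N`. -/
def Abar.derHom : Abar →ₐ[ℚ] TrivSqZeroExt Abar N :=
  Abar.lift (fun g => TrivSqZeroExt.inl (Abar.gen g) + TrivSqZeroExt.inr (v g)) (by
    intro I J
    ext
    · simp [Abar.e_mul_e]
    · simpa using hv I J)

theorem Abar.derHom_gen (g : Gen) : Abar.derHom v hv (Abar.gen g) =
    TrivSqZeroExt.inl (Abar.gen g) + TrivSqZeroExt.inr (v g) := Abar.lift_gen _ _ g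

theorem Abar.fst_derHom (a : Abar) : (Abar.derHom v hv a).fst = a := by
  induction a using Abar.induction with
  | hC c => simp; rfl
  | hg g => simp [Abar.derHom_gen]
  | hadd a b ha hb => simp [ha, hb]
  | hmul a b ha hb => simp [ha, hb]

/-- The derivation of `Ā` with prescribed values on the indeterminates. -/
def Abar.der : Derivation ℚ Abar N :=
  Derivation.mk'
    ((TrivSqZeroExt.sndHom Abar N).restrictScalars ℚ ∘ₗ (Abar.derHom v hv).toLinearMap) (by
      intro a b
      simp [Abar.fst_derHom])

theorem Abar.der_gen (g : Gen) : Abar.der v hv (Abar.gen g) = v g := by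
  change (Abar.derHom v hv (Abar.gen g)).snd = v g
  rw [Abar.derHom_gen]
  simp

end der

/-- The free `Ā`-module on the `ζ_{k,l}`, `k ≥ 0`, `l ≥ 1`. -/
abbrev ZetaModule : Type := (ℕ × ℕ+) →₀ Abar

/-- `B₀`, the exterior algebra over `Ā` of the free module on the `ζ_{k,l}`. -/
abbrev B0 : Type := ExteriorAlgebra Abar ZetaModule

instance : Ring B0 := inferInstance
instance : AddCommGroup B0 := inferInstance
instance : Algebra ThetaPoly B0 := inferInstance
instance : Module ThetaPoly B0 := inferInstance

namespace B0

/-- An element of `Ā`, viewed in `B₀`. -/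
abbrev ofAbar : Abar →+* B0 := algebraMap Abar B0

def theta (l : ℕ+) : B0 := ofAbar (Abar.gen (.theta l))
def e (I : Finset ℕ+) : B0 := ofAbar (Abar.gen (.e I))
def h (k l : ℕ+) : B0 := ofAbar (Abar.gen (.h k l))
def zeta (k : ℕ) (l : ℕ+) : B0 := ExteriorAlgebra.ι Abar (Finsupp.single (k, l) 1)

theorem induction {P : B0 → Prop} (hA : ∀ a, P (ofAbar a)) (hz : ∀ k l, P (zeta k l))
    (hadd : ∀ x y, P x → P y → P (x + y)) (hmul : ∀ x y, P x → P y → P (x * y)) (x : B0) :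
    P x := by
  induction x using ExteriorAlgebra.induction with
  | algebraMap a => exact hA a
  | ι m =>
    induction m using Finsupp.induction_linear with
    | zero => simpa using hA 0
    | add m n hm hn => rw [map_add]; exact hadd _ _ hm hn
    | single i a =>
      have : ExteriorAlgebra.ι Abar (Finsupp.single i a) = ofAbar a * zeta i.1 i.2 := by
        rw [← Algebra.smul_def, zeta, ← map_smul]
        simp
      rw [this]
      exact hmul _ _ (hA a) (hz _ _)
  | mul x y hx hy => exact hmul x y hx hy
  | add x y hx hy => exact hadd x y hx hy

theorem zeta_sq (k : ℕ) (l : ℕ+) : zeta k l * zeta k l = 0 := ExteriorAlgebra.ι_sq_zero _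

theorem zeta_anticomm (k k' : ℕ) (l l' : ℕ+) :
    zeta k l * zeta k' l' = -(zeta k' l' * zeta k l) :=
  eq_neg_of_add_eq_zero_left (ExteriorAlgebra.ι_add_mul_swap _ _)

/-- Ring homomorphisms out of `B₀`: a ring homomorphism on `Ā` with central image and
square-zero, pairwise anticommuting images of the `ζ_{k,l}`. -/
def lift {C : Type*} [Ring C] (f : Abar →+* C) (hf : ∀ a c, f a * c = c * f a)
    (z : ℕ → ℕ+ → C) (hz : ∀ k l, z k l * z k l = 0)
    (hzz : ∀ k l k' l', z k l * z k' l' = -(z k' l' * z k l)) : B0 →+* C :=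
  letI : Algebra Abar C := f.toAlgebra' hf
  (ExteriorAlgebra.lift Abar
    ⟨Finsupp.linearCombination Abar fun i : ℕ × ℕ+ => z i.1 i.2, by
      have anti : ∀ m n : ZetaModule,
          Finsupp.linearCombination Abar (fun i : ℕ × ℕ+ => z i.1 i.2) m *
            Finsupp.linearCombination Abar (fun i : ℕ × ℕ+ => z i.1 i.2) n =
          -(Finsupp.linearCombination Abar (fun i : ℕ × ℕ+ => z i.1 i.2) n *
            Finsupp.linearCombination Abar (fun i : ℕ × ℕ+ => z i.1 i.2) m) := by
        intro m n
        induction m using Finsupp.induction_linear with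
        | zero => simp
        | add a b ha hb => rw [map_add, add_mul, mul_add, ha, hb]; abel
        | single i a =>
          induction n using Finsupp.induction_linear with
          | zero => simp
          | add c d hc hd => rw [map_add, add_mul, mul_add, hc, hd]; abel
          | single j b =>
            simp only [Finsupp.linearCombination_single, smul_mul_smul_comm]
            rw [hzz, mul_comm b a, smul_neg]
      intro m
      induction m using Finsupp.induction_linear with
      | zero => simp
      | add a b ha hb =>
        rw [map_add, add_mul, mul_add, mul_add, ha, hb, anti a b]; abel
      | single i a => simp [hz]⟩).toRingHom

section lift

variable {C : Type*} [Ring C] (f : Abar →+* C) (hf : ∀ a c, f a * c = c * f a)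
  (z : ℕ → ℕ+ → C) (hz : ∀ k l, z k l * z k l = 0)
  (hzz : ∀ k l k' l', z k l * z k' l' = -(z k' l' * z k l))

theorem lift_ofAbar (a : Abar) : lift f hf z hz hzz (ofAbar a) = f a := by
  let _ : Algebra Abar C := f.toAlgebra' hf
  exact AlgHom.commutes (ExteriorAlgebra.lift Abar _) a

theorem lift_zeta (k : ℕ) (l : ℕ+) : lift f hf z hz hzz (zeta k l) = z k l := by
  let _ : Algebra Abar C := f.toAlgebra' hf
  refine (ExteriorAlgebra.lift_ι_apply Abar _ _ _).trans ?_
  simp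

end lift

/-- The grade involution, acting as `(-1)^n` on `⋀ⁿ M`. -/
def sgn : B0 →+* B0 := (CliffordAlgebra.involute (Q := (0 : QuadraticForm Abar ZetaModule))).toRingHom

theorem sgn_ofAbar (a : Abar) : sgn (ofAbar a) = ofAbar a :=
  AlgHom.commutes (CliffordAlgebra.involute (Q := (0 : QuadraticForm Abar ZetaModule))) a

theorem sgn_zeta (k : ℕ) (l : ℕ+) : sgn (zeta k l) = -zeta k l :=
  CliffordAlgebra.involute_ι _

/-! ### Twisted derivations of `B₀` -/

/-- `B₀` as a bimodule over itself whose left action is twisted by the endomorphism `σ`. -/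
def Twist (_ : B0 →+* B0) : Type := B0

section twist

variable (σ : B0 →+* B0)

instance : AddCommGroup (Twist σ) := inferInstanceAs (AddCommGroup B0)
instance : Module B0 (Twist σ) := Module.compHom B0 σ
instance : Module B0ᵐᵒᵖ (Twist σ) := inferInstanceAs (Module B0ᵐᵒᵖ B0)
instance : SMulCommClass B0 B0ᵐᵒᵖ (Twist σ) :=
  ⟨fun a b t => (mul_assoc (G := B0) (σ a) t b.unop).symm⟩

theorem twist_smul (x : B0) (t : Twist σ) : x • t = (σ x * (show B0 from t) : B0) := rfl
theorem twist_op_smul (x : B0) (t : Twist σ) :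
    MulOpposite.op x • t = ((show B0 from t) * x : B0) := rfl

variable (D : Abar →+ B0) (hD : ∀ a b, D (a * b) = ofAbar a * D b + ofAbar b * D a)
  (hσ : ∀ a, σ (ofAbar a) = ofAbar a) (hDσ : ∀ a y, D a * y = σ y * D a)

/-- The ring homomorphism `x ↦ (x, E x)` defining the twisted derivation `E` which extends `D`
and kills the `ζ_{k,l}`. -/
def twistHom : B0 →+* TrivSqZeroExt B0 (Twist σ) :=
  lift
    { toFun := fun a => (ofAbar a, D a)
      map_one' := by
        have h1 : D 1 = 0 := by simpa using hD 1 1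
        ext
        · exact map_one _
        · exact h1
      map_mul' := fun a b => by
        ext
        · exact map_mul _ _ _
        · change D (a * b) = σ (ofAbar a) * D b + D a * ofAbar b
          rw [hD, hσ, Algebra.commutes b (D a)]
      map_zero' := by
        ext
        · exact map_zero _
        · exact map_zero D
      map_add' := fun a b => by
        ext
        · exact map_add _ _ _
        · exact map_add D _ _ }
    (by
      intro a c
      ext
      · exact Algebra.commutes a c.fst
      · change σ (ofAbar a) * (show B0 from c.snd) + D a * c.fst =
          σ c.fst * D a + (show B0 from c.snd) * ofAbar a
        rw [hσ, hDσ, Algebra.commutes a (show B0 from c.snd), add_comm])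
    (fun k l => TrivSqZeroExt.inl (zeta k l))
    (fun k l => by rw [← TrivSqZeroExt.inl_mul, zeta_sq, TrivSqZeroExt.inl_zero])
    (fun k l k' l' => by
      rw [← TrivSqZeroExt.inl_mul, ← TrivSqZeroExt.inl_mul, zeta_anticomm, TrivSqZeroExt.inl_neg])

theorem fst_twistHom (x : B0) : (twistHom σ D hD hσ hDσ x).fst = x := by
  induction x using B0.induction with
  | hA a => rw [twistHom, lift_ofAbar]; rfl
  | hz k l => rw [twistHom, lift_zeta]; rfl
  | hadd x y hx hy => rw [map_add, TrivSqZeroExt.fst_add, hx, hy]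
  | hmul x y hx hy => rw [map_mul, TrivSqZeroExt.fst_mul, hx, hy]

/-- The additive map `E` with `E (x y) = σ(x) E y + (E x) y`, extending `D` and killing the
`ζ_{k,l}`. -/
def twistDer : B0 →+ B0 where
  toFun x := (twistHom σ D hD hσ hDσ x).snd
  map_zero' := by rw [map_zero]; rfl
  map_add' x y := by rw [map_add]; rfl

theorem twistDer_mul (x y : B0) : twistDer σ D hD hσ hDσ (x * y) =
    σ x * twistDer σ D hD hσ hDσ y + twistDer σ D hD hσ hDσ x * y := by
  change (twistHom σ D hD hσ hDσ (x * y)).snd = _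
  rw [map_mul, TrivSqZeroExt.snd_mul, fst_twistHom, fst_twistHom]
  rfl

theorem twistDer_ofAbar (a : Abar) : twistDer σ D hD hσ hDσ (ofAbar a) = D a := by
  change (twistHom σ D hD hσ hDσ (ofAbar a)).snd = _
  rw [twistHom, lift_ofAbar]
  rfl

theorem twistDer_zeta (k : ℕ) (l : ℕ+) : twistDer σ D hD hσ hDσ (zeta k l) = 0 := by
  change (twistHom σ D hD hσ hDσ (zeta k l)).snd = _
  rw [twistHom, lift_zeta]
  rfl

end twist

/-! ### The operators `d`, `Θ` and `Shift_s` on `B₀` -/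

theorem theta_smul_eq (p : ThetaPoly) (x : B0) :
    p • x = ofAbar (algebraMap ThetaPoly Abar p) * x := by
  rw [← Algebra.smul_def, algebraMap_smul]

/-- A derivation of `Ā` killing the `θ_l` kills their polynomials. -/
theorem der_thetaPoly {N : Type*} [AddCommGroup N] [Module Abar N] [Module ℚ N]
    (D : Derivation ℚ Abar N) (hD : ∀ l, D (Abar.gen (.theta l)) = 0) (p : ThetaPoly) :
    D (algebraMap ThetaPoly Abar p) = 0 := by
  induction p using MvPolynomial.induction_on with
  | C c => rw [algebraMap_theta_C, Derivation.map_algebraMap]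
  | add p q hp hq => rw [map_add, map_add, hp, hq, add_zero]
  | mul_X p l hp =>
    rw [map_mul, Derivation.leibniz, algebraMap_theta_X, hD, hp, smul_zero, smul_zero, add_zero]

theorem ι_mul (m : ZetaModule) (y : B0) :
    ExteriorAlgebra.ι Abar m * y = sgn y * ExteriorAlgebra.ι Abar m := by
  induction y using B0.induction with
  | hA a => rw [sgn_ofAbar, Algebra.commutes]
  | hz k l => rw [sgn_zeta, neg_mul]; exact eq_neg_of_add_eq_zero_left (ExteriorAlgebra.ι_add_mul_swap _ _)
  | hadd x y hx hy => rw [map_add, mul_add, add_mul, hx, hy]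
  | hmul x y hx hy => rw [map_mul, ← mul_assoc, hx, mul_assoc, hy, mul_assoc]

/-- The values of `d` on the generators of `Ā`: `dθ_l = de_I = 0`,
`dh_{k,l} = ζ_{k,l} - ζ_{k-1,l}`. -/
def dGen : Gen → ZetaModule
  | .theta _ => 0
  | .e _ => 0
  | .h k l => Finsupp.single ((k : ℕ), l) 1 - Finsupp.single ((k : ℕ) - 1, l) 1

/-- The restriction of `d` to `Ā`. -/
def dAbar : Derivation ℚ Abar ZetaModule := Abar.der dGen (fun I J => by simp [dGen])

theorem dAbar_gen (g : Gen) : dAbar (Abar.gen g) = dGen g :=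
  Abar.der_gen _ _ g

/-- The values of `Θ` on the generators of `Ā`: `Θθ_l = Θh_{k,l} = 0` and
`Θe_I = ∑_k (-1)^(k-1) θ_{i_k} e_{I ∖ {i_k}}` for `I = {i_1 < i_2 < ⋯}`; the position of `i ∈ I`
is one more than the number of smaller elements of `I`. -/
def thetaOpGen : Gen → Abar
  | .theta _ => 0
  | .e I => ∑ i ∈ I, (-1) ^ (I.filter (· < i)).card *
      (Abar.gen (.theta i) * Abar.gen (.e (I.erase i)))
  | .h _ _ => 0

/-- The restriction of `Θ` to `Ā`. -/
def thetaOpAbar : Derivation ℚ Abar Abar := Abar.der thetaOpGen (fun I J => by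
  have key : ∀ I J : Finset ℕ+, Abar.gen (.e I) * thetaOpGen (.e J) = 0 := by
    intro I J
    rw [thetaOpGen, Finset.mul_sum]
    refine Finset.sum_eq_zero fun i _ => ?_
    rw [mul_left_comm, mul_left_comm (Abar.gen _), Abar.e_mul_e, mul_zero, mul_zero]
  rw [smul_eq_mul, smul_eq_mul, key, key, add_zero])

theorem thetaOpAbar_gen (g : Gen) : thetaOpAbar (Abar.gen g) = thetaOpGen g :=
  Abar.der_gen _ _ g

/-- `d` as an additive map. -/
def dAdd : B0 →+ B0 :=
  twistDer sgn ((ExteriorAlgebra.ι Abar).toAddMonoidHom.comp dAbar.toLinearMap.toAddMonoidHom)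
    (fun a b => by
      change ExteriorAlgebra.ι Abar (dAbar (a * b)) = ofAbar a * ExteriorAlgebra.ι Abar (dAbar b) +
        ofAbar b * ExteriorAlgebra.ι Abar (dAbar a)
      rw [Derivation.leibniz, map_add, map_smul, map_smul, Algebra.smul_def, Algebra.smul_def])
    sgn_ofAbar (fun _ y => ι_mul _ y)

theorem dAdd_mul (x y : B0) : dAdd (x * y) = sgn x * dAdd y + dAdd x * y :=
  twistDer_mul _ _ _ _ _ x y

theorem dAdd_ofAbar (a : Abar) : dAdd (ofAbar a) = ExteriorAlgebra.ι Abar (dAbar a) :=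
  twistDer_ofAbar _ _ _ _ _ a

/-- The operator `d` on `B₀`: the `ℚ[θ]`-linear map with `d(xy) = (dx) y + (-1)^n x dy` for
`x ∈ ⋀ⁿ M`, `dθ_l = de_I = dζ_{k,l} = 0` and `dh_{k,l} = ζ_{k,l} - ζ_{k-1,l}`. -/
def d : B0 →ₗ[ThetaPoly] B0 where
  toFun := dAdd
  map_add' := map_add dAdd
  map_smul' p x := by
    have hp : dAbar (algebraMap ThetaPoly Abar p) = 0 :=
      der_thetaPoly dAbar (fun l => by rw [dAbar_gen]; rfl) p
    rw [RingHom.id_apply, theta_smul_eq, theta_smul_eq, dAdd_mul, dAdd_ofAbar, sgn_ofAbar, hp,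
      map_zero, zero_mul, add_zero]

theorem d_mul (x y : B0) : d (x * y) = d x * y + sgn x * d y :=
  (dAdd_mul x y).trans (add_comm _ _)
theorem d_theta (l : ℕ+) : d (theta l) = 0 := by
  refine (dAdd_ofAbar _).trans ?_
  rw [dAbar_gen, dGen, map_zero]
theorem d_e (I : Finset ℕ+) : d (e I) = 0 := by
  refine (dAdd_ofAbar _).trans ?_
  rw [dAbar_gen, dGen, map_zero]
theorem d_h (k l : ℕ+) : d (h k l) = zeta k l - zeta ((k : ℕ) - 1) l := by
  refine (dAdd_ofAbar _).trans ?_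
  rw [dAbar_gen, dGen, map_sub]
  rfl
theorem d_zeta (k : ℕ) (l : ℕ+) : d (zeta k l) = 0 := twistDer_zeta _ _ _ _ _ k l

/-- `Θ` as an additive map. -/
def thetaOpAdd : B0 →+ B0 :=
  twistDer (RingHom.id B0) (ofAbar.toAddMonoidHom.comp thetaOpAbar.toLinearMap.toAddMonoidHom)
    (fun a b => by
      change ofAbar (thetaOpAbar (a * b)) = ofAbar a * ofAbar (thetaOpAbar b) +
        ofAbar b * ofAbar (thetaOpAbar a)
      rw [Derivation.leibniz, smul_eq_mul, smul_eq_mul, map_add, map_mul, map_mul])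
    (fun _ => rfl) (fun a y => Algebra.commutes (thetaOpAbar a) y)

theorem thetaOpAdd_mul (x y : B0) : thetaOpAdd (x * y) = x * thetaOpAdd y + thetaOpAdd x * y :=
  twistDer_mul _ _ _ _ _ x y

theorem thetaOpAdd_ofAbar (a : Abar) : thetaOpAdd (ofAbar a) = ofAbar (thetaOpAbar a) :=
  twistDer_ofAbar _ _ _ _ _ a

/-- The operator `Θ` on `B₀`: the derivation with `Θθ_l = Θh_{k,l} = Θζ_{k,l} = 0` and
`Θe_I = ∑_k (-1)^(k-1) θ_{i_k} e_{I ∖ {i_k}}`. -/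
def thetaOp : B0 →ₗ[ThetaPoly] B0 where
  toFun := thetaOpAdd
  map_add' := map_add thetaOpAdd
  map_smul' p x := by
    have hp : thetaOpAbar (algebraMap ThetaPoly Abar p) = 0 :=
      der_thetaPoly thetaOpAbar (fun l => by rw [thetaOpAbar_gen]; rfl) p
    rw [RingHom.id_apply, theta_smul_eq, theta_smul_eq, thetaOpAdd_mul, thetaOpAdd_ofAbar, hp,
      map_zero, zero_mul, add_zero]

theorem thetaOp_mul (x y : B0) : thetaOp (x * y) = thetaOp x * y + x * thetaOp y :=
  (thetaOpAdd_mul x y).trans (add_comm _ _)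
theorem thetaOp_theta (l : ℕ+) : thetaOp (theta l) = 0 := by
  refine (thetaOpAdd_ofAbar _).trans ?_
  rw [thetaOpAbar_gen, thetaOpGen, map_zero]
theorem thetaOp_h (k l : ℕ+) : thetaOp (h k l) = 0 := by
  refine (thetaOpAdd_ofAbar _).trans ?_
  rw [thetaOpAbar_gen, thetaOpGen, map_zero]
theorem thetaOp_e (I : Finset ℕ+) : thetaOp (e I) =
    ∑ i ∈ I, (-1) ^ (I.filter (· < i)).card * (theta i * e (I.erase i)) := by
  refine (thetaOpAdd_ofAbar _).trans ?_
  rw [thetaOpAbar_gen, thetaOpGen, map_sum]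
  refine Finset.sum_congr rfl fun i _ => ?_
  rw [map_mul, map_mul, map_pow, map_neg, map_one]
  rfl
theorem thetaOp_zeta (k : ℕ) (l : ℕ+) : thetaOp (zeta k l) = 0 := twistDer_zeta _ _ _ _ _ k l

/-- The values of `Shift_s` on the generators of `Ā`. For `s = 0` only the last case of
`h_{k,l}` occurs. -/
def shiftGen (s : ℕ) : Gen → Abar
  | .theta l => Abar.gen (.theta l)
  | .e I => Abar.gen (.e I)
  | .h k l =>
    if (k : ℕ) < s then Abar.gen (.h k l)
    else if (k : ℕ) = s then Abar.gen (.h k l) + Abar.gen (.h (k + 1) l)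
    else Abar.gen (.h (k + 1) l)

/-- The restriction of `Shift_s` to `Ā`. -/
def shiftAbar (s : ℕ) : Abar →ₐ[ℚ] Abar :=
  Abar.lift (shiftGen s) (fun I J => Abar.e_mul_e I J)

/-- `Shift_s` as a ring homomorphism: `θ_l ↦ θ_l`, `e_I ↦ e_I`; `h_{k,l} ↦ h_{k,l}`,
`h_{s,l} + h_{s+1,l}` or `h_{k+1,l}` according to `k < s`, `k = s` or `k > s`; `ζ_{k,l} ↦ ζ_{k,l}`
or `ζ_{k+1,l}` according to `k < s` or `k ≥ s`. -/
def shiftHom (s : ℕ) : B0 →+* B0 :=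
  lift (ofAbar.comp (shiftAbar s).toRingHom) (fun a c => Algebra.commutes (shiftAbar s a) c)
    (fun k l => if k < s then zeta k l else zeta (k + 1) l)
    (fun k l => by split_ifs <;> exact zeta_sq _ _)
    (fun k l k' l' => by split_ifs <;> exact zeta_anticomm _ _ _ _)

theorem shiftHom_gen (s : ℕ) (g : Gen) :
    shiftHom s (ofAbar (Abar.gen g)) = ofAbar (shiftGen s g) := by
  rw [shiftHom, lift_ofAbar]
  exact congrArg ofAbar (Abar.lift_gen _ _ g)

theorem shiftHom_zeta (s k : ℕ) (l : ℕ+) :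
    shiftHom s (zeta k l) = if k < s then zeta k l else zeta (k + 1) l := by
  rw [shiftHom, lift_zeta]

/-- The operator `Shift_s` on `B₀`. -/
def shift (s : ℕ) : B0 →ₗ[ThetaPoly] B0 where
  toFun := shiftHom s
  map_add' := map_add (shiftHom s)
  map_smul' p x := by
    have hp : ∀ p : ThetaPoly, shiftHom s (ofAbar (algebraMap ThetaPoly Abar p)) =
        ofAbar (algebraMap ThetaPoly Abar p) := by
      intro p
      induction p using MvPolynomial.induction_on with
      | C c =>
        rw [algebraMap_theta_C, shiftHom, lift_ofAbar]
        exact congrArg ofAbar ((shiftAbar s).commutes c)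
      | add p q hp hq => rw [map_add, map_add, map_add, hp, hq]
      | mul_X p l hp =>
        rw [map_mul, map_mul, map_mul, hp, algebraMap_theta_X, shiftHom_gen]
        rfl
    rw [RingHom.id_apply, theta_smul_eq, theta_smul_eq, map_mul, hp]

/-! ### The filtration of `B₀` -/

/-- The generators of `B₀` of size at least `n`, where `θ_l`, `e_I`, `h_{k,l}`, `ζ_{k,l}` have size
`l`, `|I|`, `k + l`, `k + l`. -/
def gens (n : ℕ) : Set B0 :=
  {x | ∃ g : Gen, n ≤ g.size ∧ x = ofAbar (Abar.gen g)} ∪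
    {x | ∃ (k : ℕ) (l : ℕ+), n ≤ k + (l : ℕ) ∧ x = zeta k l}

/-- `𝒥_n`, the two-sided ideal generated by the generators of size at least `n`. -/
def idealJ (n : ℕ) : Ideal B0 := (TwoSidedIdeal.span (gens n)).asIdeal

instance (n : ℕ) : (idealJ n).IsTwoSided :=
  inferInstanceAs (TwoSidedIdeal.asIdeal (TwoSidedIdeal.span (gens n))).IsTwoSided

/-- `ℐ`, the two-sided ideal generated by all generators (all of them have size at least `0`). -/
def idealI : Ideal B0 := idealJ 0

instance : idealI.IsTwoSided := inferInstanceAs (idealJ 0).IsTwoSided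

/-- The ideal `ℐ^n + 𝒥_n`. -/
def filt (n : ℕ) : Ideal B0 := idealI ^ n ⊔ idealJ n

instance (n : ℕ) : (filt n).IsTwoSided where
  mul_mem_of_left b ha := by
    obtain ⟨x, hx, y, hy, rfl⟩ := Submodule.mem_sup.1 ha
    rw [add_mul]
    exact Submodule.add_mem_sup (Ideal.mul_mem_right _ _ hx) (Ideal.mul_mem_right _ _ hy)

instance (n : ℕ) : Ring (B0 ⧸ filt n) := inferInstance
instance (n : ℕ) : Algebra ThetaPoly (B0 ⧸ filt n) := inferInstance

theorem gens_subset (n : ℕ) : gens n ⊆ idealJ n := fun _ hx => TwoSidedIdeal.subset_span hx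

theorem idealJ_le {n : ℕ} {K : Ideal B0} [K.IsTwoSided] (hK : gens n ⊆ K) : idealJ n ≤ K := by
  intro x hx
  have : TwoSidedIdeal.span (gens n) ≤ K.toTwoSided :=
    TwoSidedIdeal.span_le.2 (by rwa [Ideal.coe_toTwoSided])
  exact Ideal.mem_toTwoSided.1 (this hx)

theorem gens_anti {m n : ℕ} (hmn : m ≤ n) : gens n ⊆ gens m := by
  rintro x (⟨g, hg, rfl⟩ | ⟨k, l, hk, rfl⟩)
  · exact Or.inl ⟨g, hmn.trans hg, rfl⟩
  · exact Or.inr ⟨k, l, hmn.trans hk, rfl⟩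

theorem idealJ_anti {m n : ℕ} (hmn : m ≤ n) : idealJ n ≤ idealJ m :=
  idealJ_le ((gens_anti hmn).trans (gens_subset m))

theorem filt_anti {m n : ℕ} (hmn : m ≤ n) : filt n ≤ filt m :=
  sup_le_sup (Ideal.pow_le_pow_right hmn) (idealJ_anti hmn)

theorem theta_mem {n : ℕ} {l : ℕ+} (hn : n ≤ l) : theta l ∈ idealJ n :=
  gens_subset n (Or.inl ⟨.theta l, hn, rfl⟩)
theorem e_mem {n : ℕ} {I : Finset ℕ+} (hn : n ≤ I.card) : e I ∈ idealJ n :=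
  gens_subset n (Or.inl ⟨.e I, hn, rfl⟩)
theorem h_mem {n : ℕ} {k l : ℕ+} (hn : n ≤ (k : ℕ) + l) : h k l ∈ idealJ n :=
  gens_subset n (Or.inl ⟨.h k l, hn, rfl⟩)
theorem zeta_mem {n k : ℕ} {l : ℕ+} (hn : n ≤ k + (l : ℕ)) : zeta k l ∈ idealJ n :=
  gens_subset n (Or.inr ⟨k, l, hn, rfl⟩)

/-- A ring endomorphism that does not decrease the size of generators preserves the filtration. -/
theorem ringHom_filt (f : B0 →+* B0) (hf : ∀ n, ∀ x ∈ gens n, f x ∈ idealJ n) {n : ℕ} {x : B0}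
    (hx : x ∈ filt n) : f x ∈ filt n := by
  have hJ : ∀ n, ∀ x ∈ idealJ n, f x ∈ idealJ n := fun n x hx =>
    idealJ_le (K := (idealJ n).comap f) (fun x hx => hf n x hx) hx
  have hI : ∀ n, ∀ x ∈ idealI ^ n, f x ∈ idealI ^ n := by
    intro n
    induction n with
    | zero => intro x _; simp [Submodule.pow_zero, Ideal.one_eq_top]
    | succ n ih =>
      intro x hx
      rw [Ideal.IsTwoSided.pow_succ] at hx ⊢
      refine Submodule.mul_induction_on hx (fun a ha b hb => ?_) (fun a b ha hb => ?_)
      · rw [map_mul]; exact Ideal.mul_mem_mul (hJ 0 a ha) (ih b hb)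
      · rw [map_add]; exact add_mem ha hb
  obtain ⟨a, ha, b, hb, rfl⟩ := Submodule.mem_sup.1 hx
  rw [map_add]
  exact Submodule.add_mem_sup (hI n a ha) (hJ n b hb)

theorem sgn_gens (n : ℕ) (x : B0) (hx : x ∈ gens n) : sgn x ∈ idealJ n := by
  have h1 := gens_subset n hx
  rcases hx with ⟨g, _, rfl⟩ | ⟨k, l, _, rfl⟩
  · rwa [sgn_ofAbar]
  · rw [sgn_zeta]; exact neg_mem h1

/-- A twisted derivation that lowers the size of generators by at most one, lowers the
filtration by at most one. -/
theorem twistDer_filt (σ : B0 →+* B0) (E : B0 →+ B0)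
    (hE : ∀ x y, E (x * y) = E x * y + σ x * E y)
    (hσ : ∀ n, ∀ x ∈ gens n, σ x ∈ idealJ n)
    (hg : ∀ n, ∀ x ∈ gens n, E x ∈ idealJ (n - 1)) {n : ℕ} {x : B0}
    (hx : x ∈ filt (n + 1)) : E x ∈ filt n := by
  have hσJ : ∀ n, ∀ x ∈ idealJ n, σ x ∈ idealJ n := fun n x hx =>
    idealJ_le (K := (idealJ n).comap σ) (fun x hx => hσ n x hx) hx
  have hEJ : ∀ n, ∀ x ∈ idealJ n, E x ∈ idealJ (n - 1) := by
    intro n x hx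
    have hn : idealJ n ≤ idealJ (n - 1) := idealJ_anti (Nat.sub_le n 1)
    refine (TwoSidedIdeal.span_induction (s := gens n)
      (p := fun x _ => x ∈ idealJ n ∧ E x ∈ idealJ (n - 1))
      (fun x hx => ⟨gens_subset n hx, hg n x hx⟩) ⟨zero_mem _, by simp⟩
      (fun x y _ _ hx hy => ⟨add_mem hx.1 hy.1, by rw [map_add]; exact add_mem hx.2 hy.2⟩)
      (fun x _ hx => ⟨neg_mem hx.1, by rw [map_neg]; exact neg_mem hx.2⟩)
      (fun a x _ hx => ⟨Ideal.mul_mem_left _ a hx.1, ?_⟩)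
      (fun a x _ hx => ⟨Ideal.mul_mem_right _ _ hx.1, ?_⟩) hx).2
    · rw [hE]
      exact add_mem (Ideal.mul_mem_left _ _ (hn hx.1)) (Ideal.mul_mem_left _ _ hx.2)
    · rw [hE]
      exact add_mem (Ideal.mul_mem_right _ _ hx.2)
        (Ideal.mul_mem_right _ _ (hn (hσJ n _ hx.1)))
  have hσI : ∀ x ∈ idealI, σ x ∈ idealI := hσJ 0
  have hEI : ∀ x ∈ idealI, E x ∈ idealI := hEJ 0
  have hI : ∀ n, ∀ x ∈ idealI ^ n, E x ∈ idealI ^ n := by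
    intro n
    induction n with
    | zero => intro x _; simp [Submodule.pow_zero, Ideal.one_eq_top]
    | succ n ih =>
      intro x hx
      rw [Ideal.IsTwoSided.pow_succ] at hx ⊢
      refine Submodule.mul_induction_on hx (fun a ha b hb => ?_) (fun a b ha hb => ?_)
      · rw [hE]
        exact add_mem (Ideal.mul_mem_mul (hEI a ha) hb) (Ideal.mul_mem_mul (hσI a ha) (ih b hb))
      · rw [map_add]; exact add_mem ha hb
  obtain ⟨a, ha, b, hb, rfl⟩ := Submodule.mem_sup.1 hx
  rw [map_add]
  exact Submodule.add_mem_sup (Ideal.pow_le_pow_right (Nat.le_succ n) (hI _ a ha))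
    (hEJ (n + 1) b hb)

theorem d_filt {n : ℕ} {x : B0} (hx : x ∈ filt (n + 1)) : d x ∈ filt n := by
  refine twistDer_filt sgn dAdd (fun x y => d_mul x y) sgn_gens ?_ hx
  rintro n x (⟨g, hg, rfl⟩ | ⟨k, l, hk, rfl⟩)
  · cases g with
    | theta l => exact (d_theta l).symm ▸ zero_mem _
    | e I => exact (d_e I).symm ▸ zero_mem _
    | h k l =>
      refine (d_h k l).symm ▸ sub_mem (zeta_mem ?_) (zeta_mem ?_)
      · have : n ≤ (k : ℕ) + l := hg
        omega
      · have : n ≤ (k : ℕ) + l := hg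
        omega
  · exact (d_zeta k l).symm ▸ zero_mem _

theorem thetaOp_filt {n : ℕ} {x : B0} (hx : x ∈ filt (n + 1)) : thetaOp x ∈ filt n := by
  refine twistDer_filt (RingHom.id B0) thetaOpAdd (fun x y => thetaOp_mul x y)
    (fun n x hx => gens_subset n hx) ?_ hx
  rintro n x (⟨g, hg, rfl⟩ | ⟨k, l, hk, rfl⟩)
  · cases g with
    | theta l => exact (thetaOp_theta l).symm ▸ zero_mem _
    | e I =>
      refine (thetaOp_e I).symm ▸ sum_mem fun i hi => ?_
      refine Ideal.mul_mem_left _ _ (Ideal.mul_mem_left _ _ (e_mem ?_))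
      have : n ≤ I.card := hg
      rw [Finset.card_erase_of_mem hi]
      omega
    | h k l => exact (thetaOp_h k l).symm ▸ zero_mem _
  · exact (thetaOp_zeta k l).symm ▸ zero_mem _

theorem shift_filt (s : ℕ) {n : ℕ} {x : B0} (hx : x ∈ filt (n + 1)) : shift s x ∈ filt n := by
  refine filt_anti (Nat.le_succ n) (ringHom_filt (shiftHom s) ?_ hx)
  rintro n x (⟨g, hg, rfl⟩ | ⟨k, l, hk, rfl⟩)
  · rw [shiftHom_gen]
    cases g with
    | theta l => exact theta_mem hg
    | e I => exact e_mem hg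
    | h k l =>
      have h1 : n ≤ (k : ℕ) + l := hg
      have h2 : n ≤ ((k + 1 : ℕ+) : ℕ) + l := by rw [PNat.add_coe]; omega
      rw [shiftGen]
      split_ifs
      · exact h_mem h1
      · rw [map_add]; exact add_mem (h_mem h1) (h_mem h2)
      · exact h_mem h2
  · rw [shiftHom_zeta]
    split_ifs
    · exact zeta_mem hk
    · exact zeta_mem (by omega)

end B0


/-! ## The completion `B₁` -/

/-- The completion `B₁` of `B₀` with respect to the ideals `ℐ^n + 𝒥_n`: the compatible families in
`∏_n B₀ / (ℐ^n + 𝒥_n)`. -/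
def B1 : Subalgebra ThetaPoly (∀ n : ℕ, B0 ⧸ B0.filt n) where
  carrier := {x | ∀ m n (hmn : m ≤ n), Ideal.Quotient.factor (B0.filt_anti hmn) (x n) = x m}
  mul_mem' hx hy m n hmn := by rw [Pi.mul_apply, map_mul, hx m n hmn, hy m n hmn]; rfl
  add_mem' hx hy m n hmn := by rw [Pi.add_apply, map_add, hx m n hmn, hy m n hmn]; rfl
  algebraMap_mem' _ _ _ _ := rfl

namespace B1

instance : Ring B1 := inferInstance
instance : Algebra ThetaPoly B1 := inferInstance
instance : Module ThetaPoly B1 := inferInstance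

/-- The component of an element of `B₁` in `B₀ / (ℐ^n + 𝒥_n)`. -/
def proj (n : ℕ) : B1 →ₐ[ThetaPoly] B0 ⧸ B0.filt n :=
  (Pi.evalAlgHom ThetaPoly (fun n => B0 ⧸ B0.filt n) n).comp B1.val

theorem ext {x y : B1} (hxy : ∀ n, proj n x = proj n y) : x = y := Subtype.ext (funext hxy)

theorem factor_proj {m n : ℕ} (hmn : m ≤ n) (x : B1) :
    Ideal.Quotient.factor (B0.filt_anti hmn) (proj n x) = proj m x := x.2 m n hmn

/-- The canonical map `B₀ → B₁`. -/
def of : B0 →ₐ[ThetaPoly] B1 where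
  toFun x := ⟨fun n => Ideal.Quotient.mk (B0.filt n) x, fun _ _ _ => rfl⟩
  map_one' := rfl
  map_mul' _ _ := rfl
  map_zero' := rfl
  map_add' _ _ := rfl
  commutes' _ := rfl

theorem proj_of (n : ℕ) (x : B0) : proj n (of x) = Ideal.Quotient.mk (B0.filt n) x := rfl

/-- The topology of the completion: the inverse limit of the discrete quotients. -/
instance : TopologicalSpace B1 := ⨅ n, TopologicalSpace.induced (proj n) ⊥

theorem tendsto_iff {ι : Type*} {l : Filter ι} {u : ι → B1} {y : B1} :
    Filter.Tendsto u l (nhds y) ↔ ∀ n, ∀ᶠ i in l, proj n (u i) = proj n y := by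
  rw [nhds_iInf, Filter.tendsto_iInf]
  refine forall_congr' fun n => ?_
  rw [@nhds_induced _ _ ⊥, Filter.tendsto_comap_iff,
    @nhds_discrete _ ⊥ (@DiscreteTopology.mk _ ⊥ rfl)]
  exact Filter.tendsto_pure

instance : T2Space B1 := t2_iff_nhds.2 fun {x y} hxy => by
  refine ext fun n => ?_
  have hx := tendsto_iff.1 (Filter.tendsto_id'.2 (inf_le_left : nhds x ⊓ nhds y ≤ nhds x)) n
  have hy := tendsto_iff.1 (Filter.tendsto_id'.2 (inf_le_right : nhds x ⊓ nhds y ≤ nhds y)) n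
  obtain ⟨z, h1, h2⟩ := (hx.and hy).exists
  exact h1.symm.trans h2

/-- A family in `B₁` all but finitely many of whose members vanish in each `B₀ / (ℐ^n + 𝒥_n)`
is summable. -/
theorem summable_of_finite {ι : Type*} {f : ι → B1} (hf : ∀ n, {i | proj n (f i) ≠ 0}.Finite) :
    Summable f := by
  refine ⟨⟨fun n => ∑ i ∈ (hf n).toFinset, proj n (f i), ?_⟩, ?_⟩
  · intro m n hmn
    have hs : ∀ i, Ideal.Quotient.factor (B0.filt_anti hmn) (proj n (f i)) = proj m (f i) :=
      fun i => factor_proj hmn (f i)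
    rw [map_sum, Finset.sum_congr rfl fun i _ => hs i]
    refine (Finset.sum_subset ?_ ?_).symm
    · intro i hi
      rw [Set.Finite.mem_toFinset] at hi ⊢
      intro h0
      refine hi ?_
      rw [← factor_proj hmn, h0, map_zero]
    · intro i _ hi
      rw [Set.Finite.mem_toFinset] at hi
      exact not_not.1 hi
  · refine tendsto_iff.2 fun n => ?_
    filter_upwards [Filter.eventually_ge_atTop (hf n).toFinset] with s hs
    rw [map_sum]
    refine (Finset.sum_subset hs fun i _ hi => ?_).symm
    rw [Set.Finite.mem_toFinset] at hi
    exact not_not.1 hi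

/-- The map `B₀ / (ℐ^(n+1) + 𝒥_(n+1)) → B₀ / (ℐ^n + 𝒥_n)` induced by an operator on `B₀` that lowers
the filtration by at most one. -/
def quotMap (f : B0 →ₗ[ThetaPoly] B0) (hf : ∀ n x, x ∈ B0.filt (n + 1) → f x ∈ B0.filt n) (n : ℕ) :
    (B0 ⧸ B0.filt (n + 1)) →+ (B0 ⧸ B0.filt n) :=
  QuotientAddGroup.map (B0.filt (n + 1)).toAddSubgroup (B0.filt n).toAddSubgroup
    f.toAddMonoidHom (fun x hx => hf n x hx)

theorem quotMap_mk (f : B0 →ₗ[ThetaPoly] B0)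
    (hf : ∀ n x, x ∈ B0.filt (n + 1) → f x ∈ B0.filt n) (n : ℕ) (x : B0) :
    quotMap f hf n (Ideal.Quotient.mk _ x) = Ideal.Quotient.mk _ (f x) := rfl

/-- The continuous extension to `B₁` of a `ℚ[θ]`-linear operator on `B₀` that is continuous in the
sense that it lowers the filtration by at most one. -/
def extend (f : B0 →ₗ[ThetaPoly] B0) (hf : ∀ n x, x ∈ B0.filt (n + 1) → f x ∈ B0.filt n) :
    B1 →ₗ[ThetaPoly] B1 where
  toFun x := ⟨fun n => quotMap f hf n (proj (n + 1) x), fun m n hmn => by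
    obtain ⟨z, hz⟩ := Ideal.Quotient.mk_surjective (proj (n + 1) x)
    have hz' : Ideal.Quotient.mk (B0.filt (m + 1)) z = proj (m + 1) x := by
      rw [← factor_proj (Nat.succ_le_succ hmn), ← hz, Ideal.Quotient.factor_mk]
    change Ideal.Quotient.factor _ (quotMap f hf n (proj (n + 1) x)) =
      quotMap f hf m (proj (m + 1) x)
    rw [← hz, ← hz', quotMap_mk, quotMap_mk, Ideal.Quotient.factor_mk]⟩
  map_add' x y := ext fun n => by
    change quotMap f hf n (proj (n + 1) (x + y)) =
      quotMap f hf n (proj (n + 1) x) + quotMap f hf n (proj (n + 1) y)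
    rw [map_add, map_add]
  map_smul' p x := ext fun n => by
    have hs : ∀ n (z : B0), p • Ideal.Quotient.mk (B0.filt n) z =
        Ideal.Quotient.mk (B0.filt n) (p • z) := fun _ _ => rfl
    change quotMap f hf n (proj (n + 1) (p • x)) = p • quotMap f hf n (proj (n + 1) x)
    obtain ⟨z, hz⟩ := Ideal.Quotient.mk_surjective (proj (n + 1) x)
    rw [map_smul, ← hz, quotMap_mk, hs, hs, quotMap_mk, map_smul]

theorem proj_extend (f : B0 →ₗ[ThetaPoly] B0)
    (hf : ∀ n x, x ∈ B0.filt (n + 1) → f x ∈ B0.filt n) (n : ℕ) (x : B1) :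
    proj n (extend f hf x) = quotMap f hf n (proj (n + 1) x) := rfl

theorem extend_of (f : B0 →ₗ[ThetaPoly] B0)
    (hf : ∀ n x, x ∈ B0.filt (n + 1) → f x ∈ B0.filt n) (x : B0) :
    extend f hf (of x) = of (f x) :=
  ext fun _ => rfl

theorem continuous_extend (f : B0 →ₗ[ThetaPoly] B0)
    (hf : ∀ n x, x ∈ B0.filt (n + 1) → f x ∈ B0.filt n) : Continuous (extend f hf) := by
  refine continuous_iff_continuousAt.2 fun x => tendsto_iff.2 fun n => ?_
  filter_upwards [tendsto_iff.1 (Filter.tendsto_id (x := nhds x)) (n + 1)] with y hy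
  exact congrArg (quotMap f hf n) hy

/-- `∑_l θ_l ζ_{0,l}`. -/
def thetaZeta : B1 := ∑' l : ℕ+, of (B0.theta l * B0.zeta 0 l)

/-- `∑_l θ_l h_{1,l}`. -/
def thetaH : B1 := ∑' l : ℕ+, of (B0.theta l * B0.h 1 l)

theorem finite_theta (f : ℕ+ → B0) (n : ℕ) : {l | proj n (of (B0.theta l * f l)) ≠ 0}.Finite := by
  refine (Set.finite_Iio (⟨n + 1, n.succ_pos⟩ : ℕ+)).subset fun l hl => ?_
  by_contra hlt
  refine hl (Ideal.Quotient.eq_zero_iff_mem.2 (Submodule.mem_sup_right ?_))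
  have hn : n + 1 ≤ (l : ℕ) := not_lt.1 hlt
  exact Ideal.mul_mem_right _ _ (B0.theta_mem (Nat.le_of_succ_le hn))

theorem hasSum_thetaZeta : HasSum (fun l : ℕ+ => of (B0.theta l * B0.zeta 0 l)) thetaZeta :=
  (summable_of_finite (finite_theta _)).hasSum

theorem hasSum_thetaH : HasSum (fun l : ℕ+ => of (B0.theta l * B0.h 1 l)) thetaH :=
  (summable_of_finite (finite_theta _)).hasSum

/-- `exp(∑_l θ_l h_{1,l})`. -/
def expThetaH : B1 :=
  ∑' n : ℕ, (MvPolynomial.C ((n.factorial : ℚ)⁻¹) : ThetaPoly) • thetaH ^ n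

theorem hasSum_expThetaH : HasSum
    (fun n : ℕ => (MvPolynomial.C ((n.factorial : ℚ)⁻¹) : ThetaPoly) • thetaH ^ n) expThetaH := by
  refine (summable_of_finite fun n => (Set.finite_Iio n).subset fun m hm => ?_).hasSum
  by_contra hmn
  refine hm ?_
  obtain ⟨s, hs⟩ := (tendsto_iff.1 hasSum_thetaH n).exists
  rw [map_smul, map_pow, ← hs, ← map_sum, proj_of, ← map_pow]
  refine smul_eq_zero_of_right _ (Ideal.Quotient.eq_zero_iff_mem.2 ?_)
  have hI : ∑ i ∈ s, B0.theta i * B0.h 1 i ∈ B0.idealI :=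
    sum_mem fun i _ => Ideal.mul_mem_right _ _ (B0.theta_mem (Nat.zero_le _))
  exact Submodule.mem_sup_left (Ideal.pow_le_pow_right (not_lt.1 hmn) (Ideal.pow_mem_pow hI m))

/-- `∇ = d + ∑_l θ_l ζ_{0,l}` on `B₁`. -/
def nabla : B1 →ₗ[ThetaPoly] B1 :=
  extend B0.d (fun _ _ => B0.d_filt) + LinearMap.mulLeft ThetaPoly thetaZeta

/-- `Θ` on `B₁`. -/
def thetaOp : B1 →ₗ[ThetaPoly] B1 := extend B0.thetaOp (fun _ _ => B0.thetaOp_filt)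

/-- `Shift_s` on `B₁`. -/
def shift (s : ℕ) : B1 →ₗ[ThetaPoly] B1 := extend (B0.shift s) (fun _ _ => B0.shift_filt s)

end B1

/-! ## The Higgs–de Rham ring -/

/-- The multiplicative subset of `ℚ[θ]` generated by the `θ_l`. -/
def thetaMonoid : Submonoid ThetaPoly := Submonoid.closure (Set.range MvPolynomial.X)

/-- The Higgs–de Rham ring `B_HdR = B₁[θ_l⁻¹, l ≥ 1]`. -/
abbrev BHdR : Type := LocalizedModule thetaMonoid B1

namespace BHdR

instance : Ring BHdR := inferInstance
instance : AddCommGroup BHdR := inferInstance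
instance : Zero BHdR := inferInstance
instance : Module ThetaPoly BHdR := inferInstance

/-- The ring homomorphism `B₁ → B_HdR`. -/
def of : B1 →+* BHdR := LocalizedModule.numeratorRingHom

/-- The extension to `B_HdR` of a `ℚ[θ]`-linear operator on `B₁`. -/
def extend (f : B1 →ₗ[ThetaPoly] B1) : BHdR →ₗ[ThetaPoly] BHdR :=
  IsLocalizedModule.map thetaMonoid (LocalizedModule.mkLinearMap thetaMonoid B1)
    (LocalizedModule.mkLinearMap thetaMonoid B1) f

def nabla : BHdR →ₗ[ThetaPoly] BHdR := extend B1.nabla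
def thetaOp : BHdR →ₗ[ThetaPoly] BHdR := extend B1.thetaOp
def shift (s : ℕ) : BHdR →ₗ[ThetaPoly] BHdR := extend (B1.shift s)

/-- `δ_0 = exp(∑_l θ_l h_{1,l}) Shift_0` and `δ_s = Shift_s` for `s > 0`. -/
def delta : ℕ → BHdR → BHdR
  | 0, x => of B1.expThetaH * shift 0 x
  | s + 1, x => shift (s + 1) x

/-- The operator `D` on functions `ℤ × ℤ → B_HdR`:
`(Dφ)(r,s) = ∇φ(r,s-1) + (-1)^s ∑_{k=0}^r (-1)^k δ_k φ(r-1,s) - Θφ(r,s)`; the sum is empty if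
`r < 0`. -/
def D (φ : ℤ × ℤ → BHdR) : ℤ × ℤ → BHdR := fun x =>
  nabla (φ (x.1, x.2 - 1)) +
    x.2.negOnePow • ∑ k ∈ Finset.range (x.1 + 1).toNat, (-1 : ℤ) ^ k • delta k (φ (x.1 - 1, x.2)) -
    thetaOp (φ x)

/-- `b` is the sum of the (possibly infinite) family `f` of elements of the image of `B₁` in
`B_HdR`, the convergence being that of `B₁`. -/
def SumsTo {ι : Type*} (f : ι → BHdR) (b : BHdR) : Prop :=
  ∃ (g : ι → B1) (y : B1), (∀ i, of (g i) = f i) ∧ HasSum g y ∧ of y = b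

/-- `e_I ζ_{0,I}`, where `ζ_{0,I} = ζ_{0,i_1} ⋯ ζ_{0,i_s}` for `I = {i_1 < ⋯ < i_s}`. -/
def initialTerm (I : Finset ℕ+) : BHdR :=
  of (B1.of (B0.e I * (I.sort.map (B0.zeta 0)).prod))

/-- The initial value problem: `Dφ = 0`, `φ(0,s) = ∑_{|I| = s} e_I ζ_{0,I}` for `s ≥ 0`, and
`φ(r,s) = 0` if `r < 0` or `s < 0`. -/
def IsSolution (φ : ℤ × ℤ → BHdR) : Prop :=
  D φ = 0 ∧
  (∀ s : ℕ, SumsTo (fun I : {I : Finset ℕ+ // I.card = s} => initialTerm I) (φ (0, s))) ∧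
  ∀ r s : ℤ, r < 0 ∨ s < 0 → φ (r, s) = 0

/-! ### The explicit formula -/

/-- The index set `T(r,s)`. An element is a triple `(j, s, i)`: a finitely supported family
`j = (j_{k,l})` with `j_{k,l} = 0` for `k > r`, a sequence `s = (s_k)` with `s_k = 0` for
`k > r` and `∑ s_k = s`, and integers `0 < i_{k,1} < ⋯ < i_{k,s_k}` for each `k`. The last two
are recorded by the sets `block k = {i_{k,1}, …, i_{k,s_k}}`, so that `s_k = |block k|`. -/
structure T (r s : ℕ) : Type where
  j : (ℕ+ × ℕ+) →₀ ℕ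
  block : ℕ → Finset ℕ+
  j_eq_zero : ∀ k l : ℕ+, r < k → j (k, l) = 0
  block_eq_empty : ∀ k, r < k → block k = ∅
  sum_card : ∑ k ∈ Finset.range (r + 1), (block k).card = s

namespace T

variable {r s : ℕ} (x : T r s)

/-- The pairs `(k, i_{k,q})` in lexicographic order. -/
def pairs : List (ℕ × ℕ+) :=
  (List.range (r + 1)).flatMap fun k => (x.block k).sort.map fun i => (k, i)

/-- `ζ_{s,i}`, the product of the `ζ_{k,i_{k,q}}` in lexicographic order. -/
def zetaProd : B0 := (x.pairs.map fun p => B0.zeta p.1 p.2).prod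

/-- `h^{[j]} = ∏_{k,l} h_{k,l}^{j_{k,l}} / j_{k,l}!`. -/
def hDiv : B0 := B0.ofAbar
  (x.j.prod fun p n => ((n.factorial : ℚ)⁻¹) • Abar.gen (.h p.1 p.2) ^ n)

/-- `θ^j = ∏_{k,l} θ_l^{j_{k,l}}`. -/
def thetaPow : ThetaPoly := x.j.prod fun p n => MvPolynomial.X p.2 ^ n

/-- `a(j,s) = ∏_l s_l! / ∏_{p ≥ 1} ∏_{q=0}^{s_{p-1}} max {1, q + ∑_{k ≥ p, l} j_{k,l} + ∑_{l ≥ p} s_l}`.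
The factors with `p > r + 1` are all equal to `1`. -/
def coeff : ℚ :=
  (∏ l ∈ Finset.range (r + 1), ((x.block l).card.factorial : ℚ)) /
    ∏ p ∈ Finset.Icc 1 (r + 1), ∏ q ∈ Finset.range ((x.block (p - 1)).card + 1),
      ((max 1 (q + (x.j.sum fun kl n => if p ≤ (kl.1 : ℕ) then n else 0) +
        ∑ l ∈ Finset.Icc p r, (x.block l).card) : ℕ) : ℚ)

end T

/-- `e_L` for a finite sequence `L` of positive integers: `0` if `L` has a repetition, and
otherwise `sgn(σ) e_I`, where `I` is the set of entries of `L` and `σ` is the permutation that sorts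
`L` increasingly. -/
def eList (L : List ℕ+) : B0 :=
  if L.Nodup then (Equiv.Perm.sign (Tuple.sort L.get) : ℤ) • B0.e L.toFinset else 0

theorem prod_X_mem {r : ℕ} (i : Fin r → ℕ+) :
    ∏ k, (MvPolynomial.X (i k) : ThetaPoly) ∈ thetaMonoid :=
  prod_mem fun k _ => Submonoid.subset_closure ⟨i k, rfl⟩

/-- `θ_{i} = ∏_k θ_{i^k}` as an element of the multiplicative set of denominators. -/
def thetaProd {r : ℕ} (i : Fin r → ℕ+) : thetaMonoid := ⟨∏ k, MvPolynomial.X (i k), prod_X_mem i⟩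

/-- `a(j,s) j_{i'} θ_{i'}⁻¹ θ^j e_{i,i'}` for `(j, s, i) ∈ T(r,s)` and a sequence
`i' = (i'^1, …, i'^r)` of positive integers, where `j_{i'} = ∏_k j_{k,i'^k}`. -/
def phiCoeff {r s : ℕ} (x : T r s) (i : Fin r → ℕ+) : BHdR :=
  (Localization.mk
    (MvPolynomial.C (x.coeff * ∏ k : Fin r, (x.j (k.1.succPNat, i k) : ℚ)) * x.thetaPow)
    (thetaProd i) : Localization thetaMonoid) •
    of (B1.of (eList (x.pairs.map Prod.snd ++ List.ofFn i)))

theorem finite_support_phiCoeff {r s : ℕ} (x : T r s) : (Function.support (phiCoeff x)).Finite := by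
  refine (Set.Finite.pi' (t := fun k : Fin r => {l | x.j (k.1.succPNat, l) ≠ 0})
    fun k => ?_).subset fun i hi k hk => hi ?_
  · refine (x.j.support.finite_toSet.image Prod.snd).subset fun l hl => ?_
    exact ⟨(k.1.succPNat, l), Finsupp.mem_support_iff.2 hl, rfl⟩
  · have h0 : ∏ k : Fin r, (x.j (k.1.succPNat, i k) : ℚ) = 0 :=
      Finset.prod_eq_zero (Finset.mem_univ k) (by rw [hk, Nat.cast_zero])
    rw [phiCoeff, h0, mul_zero, map_zero, zero_mul, Localization.mk_zero, zero_smul]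

/-- The summand `[∑_{i'} a(j,s) j_{i'} θ_{i'}⁻¹ θ^j e_{i,i'}] h^{[j]} ζ_{s,i}` of `φ_∞(r,s)`
with index `(j, s, i) ∈ T(r,s)`. -/
def phiTerm (r s : ℕ) (x : T r s) : BHdR :=
  (∑ᶠ i : Fin r → ℕ+, phiCoeff x i) * of (B1.of x.hDiv) * of (B1.of x.zetaProd)

end BHdR

end HdR

end

/-!
# The explicit solution of the Higgs-de Rham equations

The solution is determined by a differential equation in an auxiliary direction. Let `𝓔` be the Euler
derivation of `B₁` for which the `h_{k,l}` and `ζ_{k,l}` have weight one and the `θ_l` and `e_I` weight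
zero, and let `π` be the projection to weight zero. An element `u` is determined by `𝓔 u` and `π u`,
and more generally `𝓔 u = v u`, `π u = 0` imply `u = 0` if `v` raises the filtration
(`B1.eq_zero_of_eul_eq`). On elements that are linear in the `e_I` put
`X_k u = ∑_l ζ_{k,l} (e_l ∧ u)` and `Y_k u = ∑_l h_{k,l} (e_l ∧ u)`, where `e_l ∧ e_I` is `± e_{I ∪ {l}}`
or zero. The solution `Φ` satisfies the recursion
`𝓔 Φ(r,s) = X_0 Φ(r,s-1) + (-1)^s Y_1 δ_0 Φ(r-1,s)`.

The recursion implies the differential equation (`B1.defect_eq_zero`). The operators satisfy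
`𝓔 ∇ = ∇ 𝓔 + ∑_l θ_l ζ_{0,l}`, `∇ X_k = -X_k ∇`, `∇ Y_1 = Y_1 ∇ + X_1 - X_0`, `∇ δ_k = δ_k ∇`,
`δ_{k+1} δ_0 = δ_0 δ_k`, and, on terms linear in the `e_I`, `Θ X_0 = ∑_l θ_l ζ_{0,l} - X_0 Θ` and
`Θ Y_1 = ∑_l θ_l h_{1,l} - Y_1 Θ`. It follows that the defect `Ψ = D Φ` satisfies
`𝓔 Ψ(r,s) = -X_0 Ψ(r,s-1) - (-1)^s Y_1 δ_0 Ψ(r-1,s)` and `π Ψ = 0`, so that `Ψ = 0` by induction and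
uniqueness. The same uniqueness gives the functional equation of `exp(∑_l θ_l h_{1,l})` and its
expansion into divided powers.

The explicit formula satisfies the recursion (`B1.eul_sol`). Its summand with index `x = (j, s, i)` is
`a(x)` times the result of applying to `e_∅` the commuting operators `ζ_{k,l} (e_l ∧ ·)`, one for each
entry of `i`, and one operator `∑_i h_{k,i} (θ h)^{[j_k - δ_i]} (e_i ∧ ·)` for each row `j_k` of `j`;
here the denominators `θ_i` have been cancelled. The weight of the summand is `N = |j| + s`. If the
block `0` of `x` is nonempty, then `N a(x)` is the sum of the coefficients of the indices that arise by
removing one element of this block; these terms make up `X_0 Φ(r,s-1)`. If the block is empty, then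
`N a(x)` is the coefficient of the index that arises by removing the first row of `j`; these terms make
up `Y_1 exp(∑_l θ_l h_{1,l}) Shift_0 Φ(r-1,s)`. The rearrangements of the sums are justified because
all families involved tend to zero in `B₁`.
-/

noncomputable section

namespace HdR

namespace B0

/-! ### Derivations of `B₀` -/

/-- Induction on the generators of `B₀` as a `ℚ`-algebra. -/
theorem gen_induction {P : B0 → Prop} (hC : ∀ c : ℚ, P (ofAbar (algebraMap ℚ Abar c)))
    (hg : ∀ g, P (ofAbar (Abar.gen g))) (hz : ∀ k l, P (zeta k l))
    (hadd : ∀ x y, P x → P y → P (x + y)) (hmul : ∀ x y, P x → P y → P (x * y)) (x : B0) :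
    P x := by
  refine B0.induction (fun a => ?_) hz hadd hmul x
  induction a using Abar.induction with
  | hC c => exact hC c
  | hg g => exact hg g
  | hadd a b ha hb => rw [map_add]; exact hadd _ _ ha hb
  | hmul a b ha hb => rw [map_mul]; exact hmul _ _ ha hb

theorem ofAbar_rat (c : ℚ) :
    ofAbar (algebraMap ℚ Abar c) = (MvPolynomial.C c : ThetaPoly) • (1 : B0) := by
  rw [theta_smul_eq, algebraMap_theta_C, mul_one]

theorem theta_mul_eq (l : ℕ+) (x : B0) :
    theta l * x = (MvPolynomial.X l : ThetaPoly) • x := by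
  rw [theta_smul_eq, algebraMap_theta_X]; rfl

theorem ofAbar_comm (a : Abar) (x : B0) : ofAbar a * x = x * ofAbar a := Algebra.commutes a x

theorem ofAbar_left_comm (a : Abar) (x y : B0) : x * (ofAbar a * y) = ofAbar a * (x * y) := by
  rw [← mul_assoc, ← ofAbar_comm, mul_assoc]

/-- Two `ℚ[θ]`-linear maps obeying the same twisted Leibniz rule coincide if they agree on the
generators. -/
theorem ext_of_twisted_leibniz {f g : B0 →ₗ[ThetaPoly] B0} (σ τ : B0 → B0) (hσ : σ 1 = 1)
    (hτ : τ 1 = 1) (hf : ∀ x y, f (x * y) = f x * τ y + σ x * f y)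
    (hg : ∀ x y, g (x * y) = g x * τ y + σ x * g y)
    (hgen : ∀ a, f (ofAbar (Abar.gen a)) = g (ofAbar (Abar.gen a)))
    (hz : ∀ k l, f (zeta k l) = g (zeta k l)) : f = g := by
  have h1 : ∀ F : B0 →ₗ[ThetaPoly] B0, (∀ x y, F (x * y) = F x * τ y + σ x * F y) → F 1 = 0 := by
    intro F hF
    simpa [hσ, hτ] using hF 1 1
  ext x
  induction x using gen_induction with
  | hC c => rw [ofAbar_rat, map_smul, map_smul, h1 f hf, h1 g hg]
  | hg a => exact hgen a
  | hz k l => exact hz k l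
  | hadd x y hx hy => rw [map_add, map_add, hx, hy]
  | hmul x y hx hy => rw [hf, hg, hx, hy]

/-- The Leibniz rule for a `ℚ[θ]`-linear operator on `B₀`. -/
def IsDer (E : B0 →ₗ[ThetaPoly] B0) : Prop := ∀ x y, E (x * y) = E x * y + x * E y

theorem IsDer.eq_zero {E : B0 →ₗ[ThetaPoly] B0} (hE : IsDer E)
    (hgen : ∀ a, E (ofAbar (Abar.gen a)) = 0) (hz : ∀ k l, E (zeta k l) = 0) : E = 0 :=
  ext_of_twisted_leibniz id id rfl rfl hE (by simp) (by simpa using hgen) (by simpa using hz)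

theorem IsDer.map_one {E : B0 →ₗ[ThetaPoly] B0} (hE : IsDer E) : E 1 = 0 := by
  simpa using hE 1 1

theorem IsDer.comm {E F : B0 →ₗ[ThetaPoly] B0} (hE : IsDer E) (hF : IsDer F)
    (hgen : ∀ a, E (F (ofAbar (Abar.gen a))) = F (E (ofAbar (Abar.gen a))))
    (hz : ∀ k l, E (F (zeta k l)) = F (E (zeta k l))) (x : B0) : E (F x) = F (E x) := by
  -- the commutator of two derivations is a derivation
  have h : E ∘ₗ F - F ∘ₗ E = 0 := by
    refine IsDer.eq_zero (fun x y => ?_) (fun a => sub_eq_zero.2 (hgen a))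
      (fun k l => sub_eq_zero.2 (hz k l))
    simp only [LinearMap.sub_apply, LinearMap.comp_apply, hE _ _, hF _ _, map_add]
    noncomm_ring
  exact sub_eq_zero.1 (congrArg (fun f => f x) h)

theorem IsDer.idealJ_mem {E : B0 →ₗ[ThetaPoly] B0} (hE : IsDer E) {n : ℕ}
    (hg : ∀ x ∈ gens n, E x ∈ idealJ n) {x : B0} (hx : x ∈ idealJ n) : E x ∈ idealJ n := by
  refine (TwoSidedIdeal.span_induction (s := gens n)
    (p := fun x _ => x ∈ idealJ n ∧ E x ∈ idealJ n)
    (fun x hx => ⟨gens_subset n hx, hg x hx⟩) ⟨zero_mem _, by simp⟩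
    (fun x y _ _ hx hy => ⟨add_mem hx.1 hy.1, by rw [map_add]; exact add_mem hx.2 hy.2⟩)
    (fun x _ hx => ⟨neg_mem hx.1, by rw [map_neg]; exact neg_mem hx.2⟩)
    (fun a x _ hx => ⟨Ideal.mul_mem_left _ a hx.1, ?_⟩)
    (fun a x _ hx => ⟨Ideal.mul_mem_right _ _ hx.1, ?_⟩) hx).2
  · rw [hE]
    exact add_mem (Ideal.mul_mem_left _ _ hx.1) (Ideal.mul_mem_left _ _ hx.2)
  · rw [hE]
    exact add_mem (Ideal.mul_mem_right _ _ hx.2) (Ideal.mul_mem_right _ _ hx.1)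

theorem IsDer.idealI_pow_mem {E : B0 →ₗ[ThetaPoly] B0} (hE : IsDer E)
    (hg : ∀ x ∈ gens 0, E x ∈ idealJ 0) (m : ℕ) {x : B0} (hx : x ∈ idealI ^ m) :
    E x ∈ idealI ^ m := by
  induction m generalizing x with
  | zero => simp [Submodule.pow_zero, Ideal.one_eq_top]
  | succ n ih =>
    rw [Ideal.IsTwoSided.pow_succ] at hx ⊢
    refine Submodule.mul_induction_on hx (fun a ha b hb => ?_) (fun a b ha hb => ?_)
    · rw [hE]
      exact add_mem (Ideal.mul_mem_mul (hE.idealJ_mem hg ha) hb) (Ideal.mul_mem_mul ha (ih hb))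
    · rw [map_add]; exact add_mem ha hb

theorem IsDer.filt_mem {E : B0 →ₗ[ThetaPoly] B0} (hE : IsDer E)
    (hg : ∀ n, ∀ x ∈ gens n, E x ∈ idealJ n) {n : ℕ} {x : B0} (hx : x ∈ filt n) :
    E x ∈ filt n := by
  obtain ⟨a, ha, b, hb, rfl⟩ := Submodule.mem_sup.1 hx
  rw [map_add]
  exact Submodule.add_mem_sup (hE.idealI_pow_mem (hg 0) n ha) (hE.idealJ_mem (hg n) hb)

/-- The element `(x, y)` of the square-zero extension of `B₀` by itself. -/
def sqZero (x y : B0) : TrivSqZeroExt B0 B0 := (x, y)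

/-- The ring homomorphism `x ↦ (x, E x)` defining the derivation `E` which extends `D` and
multiplies the `ζ_{k,l}` by `c`. -/
def derHom (D : Derivation ℚ Abar Abar) (c : ℕ) : B0 →+* TrivSqZeroExt B0 B0 :=
  lift
    { toFun := fun a => sqZero (ofAbar a) (ofAbar (D a))
      map_one' := by
        ext
        · exact map_one _
        · change ofAbar (D 1) = 0
          rw [Derivation.map_one_eq_zero, map_zero]
      map_mul' := fun a b => by
        ext
        · exact map_mul _ _ _
        · change ofAbar (D (a * b)) = ofAbar a * ofAbar (D b) + ofAbar (D a) * ofAbar b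
          rw [Derivation.leibniz, smul_eq_mul, smul_eq_mul, map_add, map_mul, map_mul,
            ofAbar_comm b]
      map_zero' := by
        ext
        · exact map_zero _
        · change ofAbar (D 0) = 0
          rw [map_zero, map_zero]
      map_add' := fun a b => by
        ext
        · exact map_add _ _ _
        · change ofAbar (D (a + b)) = ofAbar (D a) + ofAbar (D b)
          rw [map_add, map_add] }
    (by
      intro a x
      ext
      · exact ofAbar_comm a x.fst
      · change ofAbar a * x.snd + ofAbar (D a) * x.fst = x.fst * ofAbar (D a) + x.snd * ofAbar a
        rw [ofAbar_comm, ofAbar_comm, add_comm])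
    (fun k l => sqZero (zeta k l) (c • zeta k l))
    (fun k l => by
      ext
      · exact zeta_sq k l
      · change zeta k l * (c • zeta k l) + (c • zeta k l) * zeta k l = 0
        rw [mul_smul_comm, smul_mul_assoc, zeta_sq, smul_zero, add_zero])
    (fun k l k' l' => by
      ext
      · exact zeta_anticomm _ _ _ _
      · change zeta k l * (c • zeta k' l') + (c • zeta k l) * zeta k' l' =
          -(zeta k' l' * (c • zeta k l) + (c • zeta k' l') * zeta k l)
        simp only [mul_smul_comm, smul_mul_assoc]
        rw [zeta_anticomm k k', smul_neg, neg_add])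

theorem fst_derHom (D : Derivation ℚ Abar Abar) (c : ℕ) (x : B0) : (derHom D c x).fst = x := by
  induction x using B0.induction with
  | hA a => rw [derHom, lift_ofAbar]; rfl
  | hz k l => rw [derHom, lift_zeta]; rfl
  | hadd x y hx hy => rw [map_add, TrivSqZeroExt.fst_add, hx, hy]
  | hmul x y hx hy => rw [map_mul, TrivSqZeroExt.fst_mul, hx, hy]

theorem derHom_mul (D : Derivation ℚ Abar Abar) (c : ℕ) (x y : B0) : (derHom D c (x * y)).snd =
    (derHom D c x).snd * y + x * (derHom D c y).snd := by
  rw [map_mul, TrivSqZeroExt.snd_mul, fst_derHom, fst_derHom, add_comm]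
  rfl

theorem derHom_ofAbar (D : Derivation ℚ Abar Abar) (c : ℕ) (a : Abar) :
    (derHom D c (ofAbar a)).snd = ofAbar (D a) := by
  rw [derHom, lift_ofAbar]; rfl

theorem derHom_zeta (D : Derivation ℚ Abar Abar) (c : ℕ) (k : ℕ) (l : ℕ+) :
    (derHom D c (zeta k l)).snd = c • zeta k l := by
  rw [derHom, lift_zeta]; rfl

/-- The derivation of `B₀` that extends the derivation `D` of `Ā` and multiplies the `ζ_{k,l}`
by `c`. -/
def der (D : Derivation ℚ Abar Abar) (hD : ∀ l, D (Abar.gen (.theta l)) = 0) (c : ℕ) :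
    B0 →ₗ[ThetaPoly] B0 where
  toFun x := (derHom D c x).snd
  map_add' x y := by rw [map_add]; rfl
  map_smul' p x := by
    rw [RingHom.id_apply, theta_smul_eq, theta_smul_eq, derHom_mul, derHom_ofAbar,
      der_thetaPoly D hD, map_zero, zero_mul, zero_add]

theorem isDer_der (D : Derivation ℚ Abar Abar) (hD : ∀ l, D (Abar.gen (.theta l)) = 0) (c : ℕ) :
    IsDer (der D hD c) := derHom_mul D c

theorem der_ofAbar (D : Derivation ℚ Abar Abar) (hD : ∀ l, D (Abar.gen (.theta l)) = 0) (c : ℕ)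
    (a : Abar) : der D hD c (ofAbar a) = ofAbar (D a) := derHom_ofAbar D c a

theorem der_zeta (D : Derivation ℚ Abar Abar) (hD : ∀ l, D (Abar.gen (.theta l)) = 0) (c : ℕ)
    (k : ℕ) (l : ℕ+) : der D hD c (zeta k l) = c • zeta k l := derHom_zeta D c k l

/-! ### Exterior multiplication, `e`-degree and Euler operator -/

/-- The values on the generators of exterior multiplication by `e_l`. -/
def epsGen (l : ℕ+) : Gen → Abar
  | .theta _ => 0
  | .e I => if l ∈ I then 0 else (-1) ^ (I.filter (· < l)).card * Abar.gen (.e (insert l I))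
  | .h _ _ => 0

/-- The values on the generators of the `e`-degree operator. -/
def kapGen : Gen → Abar
  | .theta _ => 0
  | .e I => Abar.gen (.e I)
  | .h _ _ => 0

/-- The values on the generators of `Ā` of the Euler operator. -/
def eulGen : Gen → Abar
  | .theta _ => 0
  | .e _ => 0
  | .h k l => Abar.gen (.h k l)

/-- Exterior multiplication by `e_l` on the part of `B₀` linear in the `e_I`, that is
`e_I ↦ e_l ∧ e_I`, as a derivation of `B₀` that kills the `θ`, `h` and `ζ`. -/
def eps (l : ℕ+) : B0 →ₗ[ThetaPoly] B0 :=
  der (Abar.der (epsGen l) (fun I J => by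
    simp only [epsGen, smul_eq_mul]
    split_ifs <;> simp [mul_left_comm _ ((-1 : Abar) ^ _), Abar.e_mul_e]))
    (fun _ => by rw [Abar.der_gen, epsGen]) 0

/-- The derivation of `B₀` with `e_I ↦ e_I` that kills the `θ`, `h` and `ζ`. -/
def kap : B0 →ₗ[ThetaPoly] B0 :=
  der (Abar.der kapGen (fun I J => by simp [kapGen, Abar.e_mul_e]))
    (fun _ => by rw [Abar.der_gen, kapGen]) 0

/-- The Euler operator: the derivation of `B₀` for which the `h` and `ζ` have weight `1` and the
`θ` and `e` have weight `0`. -/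
def eul : B0 →ₗ[ThetaPoly] B0 :=
  der (Abar.der eulGen (fun I J => by simp [eulGen]))
    (fun _ => by rw [Abar.der_gen, eulGen]) 1

theorem isDer_eps (l : ℕ+) : IsDer (eps l) := isDer_der _ _ _
theorem isDer_kap : IsDer kap := isDer_der _ _ _
theorem isDer_eul : IsDer eul := isDer_der _ _ _
theorem isDer_thetaOp : IsDer thetaOp := thetaOp_mul

theorem eps_gen (l : ℕ+) (g : Gen) : eps l (ofAbar (Abar.gen g)) = ofAbar (epsGen l g) := by
  rw [eps, der_ofAbar, Abar.der_gen]
theorem kap_gen (g : Gen) : kap (ofAbar (Abar.gen g)) = ofAbar (kapGen g) := by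
  rw [kap, der_ofAbar, Abar.der_gen]
theorem eul_gen (g : Gen) : eul (ofAbar (Abar.gen g)) = ofAbar (eulGen g) := by
  rw [eul, der_ofAbar, Abar.der_gen]
theorem thetaOp_gen (g : Gen) : thetaOp (ofAbar (Abar.gen g)) = ofAbar (thetaOpGen g) := by
  refine (thetaOpAdd_ofAbar _).trans ?_
  rw [thetaOpAbar_gen]

theorem eps_zeta (l : ℕ+) (k : ℕ) (i : ℕ+) : eps l (zeta k i) = 0 := by
  rw [eps, der_zeta, zero_smul]
theorem kap_zeta (k : ℕ) (i : ℕ+) : kap (zeta k i) = 0 := by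
  rw [kap, der_zeta, zero_smul]
theorem eul_zeta (k : ℕ) (i : ℕ+) : eul (zeta k i) = zeta k i := by
  rw [eul, der_zeta, one_smul]

theorem eps_h (l k i : ℕ+) : eps l (h k i) = 0 := by
  rw [h, eps_gen, epsGen, map_zero]
theorem kap_h (k i : ℕ+) : kap (h k i) = 0 := by
  rw [h, kap_gen, kapGen, map_zero]
theorem eul_h (k i : ℕ+) : eul (h k i) = h k i := by
  rw [h, eul_gen, eulGen]
theorem kap_e (I : Finset ℕ+) : kap (e I) = e I := by
  rw [e, kap_gen, kapGen]
theorem eul_e (I : Finset ℕ+) : eul (e I) = 0 := by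
  rw [e, eul_gen, eulGen, map_zero]
theorem eps_e (l : ℕ+) (I : Finset ℕ+) : eps l (e I) =
    if l ∈ I then 0 else (-1) ^ (I.filter (· < l)).card * e (insert l I) := by
  rw [e, eps_gen, epsGen]
  split_ifs
  · exact map_zero _
  · rw [map_mul, map_pow, map_neg, map_one]; rfl

/-- The grade involution as a `ℚ[θ]`-linear map. -/
def sgnLin : B0 →ₗ[ThetaPoly] B0 where
  toFun := sgn
  map_add' := map_add sgn
  map_smul' p x := by
    rw [RingHom.id_apply, theta_smul_eq, theta_smul_eq, map_mul, sgn_ofAbar]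

/-- A derivation that preserves `Ā` and multiplies the `ζ_{k,l}` by a constant commutes with the
grade involution. -/
theorem sgn_der (D : Derivation ℚ Abar Abar) (hD : ∀ l, D (Abar.gen (.theta l)) = 0) (c : ℕ)
    (x : B0) : sgn (der D hD c x) = der D hD c (sgn x) := by
  have : sgnLin ∘ₗ der D hD c = der D hD c ∘ₗ sgnLin := by
    refine ext_of_twisted_leibniz sgn sgn (map_one _) (map_one _) (fun x y => ?_) (fun x y => ?_)
      (fun a => ?_) (fun k l => ?_)
    · change sgn (der D hD c (x * y)) = _
      rw [isDer_der, map_add, map_mul, map_mul]; rfl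
    · change der D hD c (sgn (x * y)) = _
      rw [map_mul, isDer_der]; rfl
    · change sgn (der D hD c (ofAbar _)) = der D hD c (sgn (ofAbar _))
      rw [sgn_ofAbar, der_ofAbar, sgn_ofAbar]
    · change sgn (der D hD c (zeta k l)) = der D hD c (sgn (zeta k l))
      rw [sgn_zeta, map_neg, der_zeta, map_nsmul, sgn_zeta, smul_neg]
  exact congrArg (fun f => f x) this

/-- A derivation commuting with the grade involution commutes with `d` if it does so on the
generators. -/
theorem d_comm {E : B0 →ₗ[ThetaPoly] B0} (hE : IsDer E) (hs : ∀ x, sgn (E x) = E (sgn x))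
    (hgen : ∀ a, d (E (ofAbar (Abar.gen a))) = E (d (ofAbar (Abar.gen a))))
    (hz : ∀ k l, d (E (zeta k l)) = E (d (zeta k l))) (x : B0) : d (E x) = E (d x) := by
  have h : d ∘ₗ E - E ∘ₗ d = 0 := by
    refine ext_of_twisted_leibniz sgn id (map_one _) rfl (fun x y => ?_) (by simp)
      (fun a => sub_eq_zero.2 (hgen a)) (fun k l => sub_eq_zero.2 (hz k l))
    simp only [LinearMap.sub_apply, LinearMap.comp_apply, hE _ _, d_mul, map_add, hs, id_eq]
    noncomm_ring
  exact sub_eq_zero.1 (congrArg (fun f => f x) h)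

theorem d_gen (g : Gen) : d (ofAbar (Abar.gen g)) = ExteriorAlgebra.ι Abar (dGen g) := by
  refine (dAdd_ofAbar _).trans ?_
  rw [dAbar_gen]

theorem d_eps (l : ℕ+) (x : B0) : d (eps l x) = eps l (d x) := by
  refine d_comm (isDer_eps l) (sgn_der _ _ _) (fun a => ?_) (fun k i => ?_) x
  · cases a with
    | theta i => rw [eps_gen, epsGen, d_gen, dGen, map_zero, map_zero, map_zero, map_zero]
    | e I =>
      change d (eps l (e I)) = eps l (d (e I))
      rw [eps_e, d_e, map_zero]
      split_ifs
      · exact map_zero _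
      · rcases neg_one_pow_eq_or B0 (I.filter (· < l)).card with h | h <;> rw [h] <;> simp [d_e]
    | h k i =>
      change d (eps l (h k i)) = eps l (d (h k i))
      rw [eps_h, d_h, map_sub, eps_zeta, eps_zeta, map_zero, sub_zero]
  · rw [eps_zeta, d_zeta, map_zero, map_zero]

theorem d_eul (x : B0) : d (eul x) = eul (d x) := by
  refine d_comm isDer_eul (sgn_der _ _ _) (fun a => ?_) (fun k i => ?_) x
  · cases a with
    | theta i => rw [eul_gen, eulGen, d_gen, dGen, map_zero, map_zero, map_zero, map_zero]
    | e I =>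
      change d (eul (e I)) = eul (d (e I))
      rw [eul_e, d_e, map_zero, map_zero]
    | h k i =>
      change d (eul (h k i)) = eul (d (h k i))
      rw [eul_h, d_h, map_sub, eul_zeta, eul_zeta]
  · rw [eul_zeta, d_zeta, map_zero]

theorem eul_eps (l : ℕ+) (x : B0) : eul (eps l x) = eps l (eul x) := by
  refine isDer_eul.comm (isDer_eps l) (fun a => ?_) (fun k i => ?_) x
  · cases a with
    | theta i => simp only [eps_gen, eul_gen, epsGen, eulGen, map_zero]
    | e I =>
      change eul (eps l (e I)) = eps l (eul (e I))
      rw [eps_e, eul_e, map_zero]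
      split_ifs
      · exact map_zero _
      · rcases neg_one_pow_eq_or B0 (I.filter (· < l)).card with h | h <;> rw [h] <;> simp [eul_e]
    | h k i =>
      change eul (eps l (h k i)) = eps l (eul (h k i))
      rw [eul_h, eps_h, map_zero]
  · rw [eul_zeta, eps_zeta, map_zero]

theorem kap_eps (l : ℕ+) (x : B0) : kap (eps l x) = eps l (kap x) := by
  refine isDer_kap.comm (isDer_eps l) (fun a => ?_) (fun k i => ?_) x
  · cases a with
    | theta i => simp only [eps_gen, kap_gen, epsGen, kapGen, map_zero]
    | e I =>
      change kap (eps l (e I)) = eps l (kap (e I))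
      rw [kap_e, eps_e]
      split_ifs
      · exact map_zero _
      · rcases neg_one_pow_eq_or B0 (I.filter (· < l)).card with h | h <;> rw [h] <;> simp [kap_e]
    | h k i =>
      change kap (eps l (h k i)) = eps l (kap (h k i))
      rw [kap_h, eps_h, map_zero, map_zero]
  · rw [kap_zeta, eps_zeta, map_zero, map_zero]

theorem eul_thetaOp (x : B0) : eul (thetaOp x) = thetaOp (eul x) := by
  refine isDer_eul.comm isDer_thetaOp (fun a => ?_) (fun k i => ?_) x
  · cases a with
    | theta i => simp only [thetaOp_gen, eul_gen, thetaOpGen, eulGen, map_zero]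
    | e I =>
      change eul (thetaOp (e I)) = thetaOp (eul (e I))
      rw [thetaOp_e, eul_e, map_zero, map_sum]
      refine Finset.sum_eq_zero fun i _ => ?_
      rcases neg_one_pow_eq_or B0 (I.filter (· < i)).card with h | h <;> rw [h] <;>
        simp [eul_e, theta_mul_eq]
    | h k i =>
      change eul (thetaOp (h k i)) = thetaOp (eul (h k i))
      rw [eul_h, thetaOp_h, map_zero]
  · rw [eul_zeta, thetaOp_zeta, map_zero]

/-! ### Products of `e`-linear terms -/

theorem e_mul_e (I J : Finset ℕ+) : e I * e J = 0 := by
  rw [e, e, ← map_mul, Abar.e_mul_e, map_zero]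

/-- If two derivations take values in the ideal generated by the `e_I`, then products of their
values vanish. -/
theorem IsDer.mul_eq_zero {E F : B0 →ₗ[ThetaPoly] B0} (hE : IsDer E) (hF : IsDer F)
    (hEg : ∀ g w, (∀ I, e I * w = 0) → E (ofAbar (Abar.gen g)) * w = 0)
    (hEz : ∀ k l, E (zeta k l) = 0)
    (hFg : ∀ g I, e I * F (ofAbar (Abar.gen g)) = 0)
    (hFz : ∀ k l, F (zeta k l) = 0) (x y : B0) : E x * F y = 0 := by
  have h1 : ∀ I z, e I * (z * F y) = 0 := by
    intro I z
    rw [e, ← ofAbar_left_comm]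
    suffices e I * F y = 0 by rw [e] at this; rw [this, mul_zero]
    induction y using gen_induction with
    | hC c => rw [ofAbar_rat, map_smul, hF.map_one, smul_zero, mul_zero]
    | hg g => exact hFg g I
    | hz k l => rw [hFz, mul_zero]
    | hadd x y hx hy => rw [map_add, mul_add, hx, hy, add_zero]
    | hmul x y hx hy =>
      rw [hF, mul_add, ← mul_assoc, hx, zero_mul, zero_add, e, ← ofAbar_left_comm]
      rw [e] at hy
      rw [hy, mul_zero]
  suffices ∀ z, E x * (z * F y) = 0 by simpa using this 1
  induction x using gen_induction with
  | hC c => intro z; rw [ofAbar_rat, map_smul, hE.map_one, smul_zero, zero_mul]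
  | hg g => intro z; exact hEg g _ fun I => h1 I z
  | hz k l => intro z; rw [hEz, zero_mul]
  | hadd x y hx hy => intro z; rw [map_add, add_mul, hx, hy, add_zero]
  | hmul x y hx hy =>
    intro z
    rw [hE, add_mul, mul_assoc, ← mul_assoc y, hx, mul_assoc, hy, mul_zero, add_zero]

theorem eps_gen_mul (l : ℕ+) (g : Gen) (w : B0) (hw : ∀ I, e I * w = 0) :
    eps l (ofAbar (Abar.gen g)) * w = 0 := by
  cases g with
  | theta i => rw [eps_gen, epsGen, map_zero, zero_mul]
  | e I =>
    change eps l (e I) * w = 0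
    rw [eps_e]
    split_ifs
    · exact zero_mul _
    · rw [mul_assoc, hw, mul_zero]
  | h k i => rw [eps_gen, epsGen, map_zero, zero_mul]

theorem thetaOp_gen_mul (g : Gen) (w : B0) (hw : ∀ I, e I * w = 0) :
    thetaOp (ofAbar (Abar.gen g)) * w = 0 := by
  cases g with
  | theta i => rw [thetaOp_gen, thetaOpGen, map_zero, zero_mul]
  | e I =>
    change thetaOp (e I) * w = 0
    rw [thetaOp_e, Finset.sum_mul]
    refine Finset.sum_eq_zero fun i _ => ?_
    rw [mul_assoc, mul_assoc, hw, mul_zero, mul_zero]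
  | h k i => rw [thetaOp_gen, thetaOpGen, map_zero, zero_mul]

theorem e_mul_of_comm {E : B0 →ₗ[ThetaPoly] B0} {v : Gen → Abar}
    (hv : ∀ g, E (ofAbar (Abar.gen g)) = ofAbar (v g))
    (hE : ∀ g w, (∀ I, e I * w = 0) → E (ofAbar (Abar.gen g)) * w = 0) (g : Gen)
    (I : Finset ℕ+) : e I * E (ofAbar (Abar.gen g)) = 0 := by
  rw [hv, ← ofAbar_comm, ← hv]
  exact hE g _ fun J => e_mul_e J I

/-- Products of values of the operators on `e`-linear terms vanish because `e_I e_J = 0` in `Ā`. This is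
why compositions of two such operators again obey a Leibniz rule without cross terms. -/
theorem eps_mul_eps (a b : ℕ+) (x y : B0) : eps a x * eps b y = 0 :=
  (isDer_eps a).mul_eq_zero (isDer_eps b) (eps_gen_mul a) (eps_zeta a)
    (e_mul_of_comm (eps_gen b) (eps_gen_mul b)) (eps_zeta b) x y

theorem eps_mul_thetaOp (a : ℕ+) (x y : B0) : eps a x * thetaOp y = 0 :=
  (isDer_eps a).mul_eq_zero isDer_thetaOp (eps_gen_mul a) (eps_zeta a)
    (e_mul_of_comm thetaOp_gen thetaOp_gen_mul) thetaOp_zeta x y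

theorem thetaOp_mul_eps (a : ℕ+) (x y : B0) : thetaOp x * eps a y = 0 :=
  isDer_thetaOp.mul_eq_zero (isDer_eps a) thetaOp_gen_mul thetaOp_zeta
    (e_mul_of_comm (eps_gen a) (eps_gen_mul a)) (eps_zeta a) x y

/-! ### Anticommutation relations -/

/-- The homotopy formula: `Θ` is contraction with `(θ_l)`, which anticommutes with `e_l ∧ ·` up to
multiplication by `θ_l`. -/
theorem thetaOp_eps (l : ℕ+) (x : B0) :
    thetaOp (eps l x) = theta l * kap x - eps l (thetaOp x) := by
  -- the cross terms in the Leibniz rule vanish, so it suffices to compare the values on generators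
  have h : thetaOp ∘ₗ eps l + eps l ∘ₗ thetaOp -
      (MvPolynomial.X l : ThetaPoly) • kap = 0 := by
    refine IsDer.eq_zero (fun x y => ?_) (fun a => ?_) (fun k i => ?_)
    · simp only [LinearMap.sub_apply, LinearMap.add_apply, LinearMap.comp_apply,
        LinearMap.smul_apply, isDer_eps l _ _, isDer_thetaOp _ _, isDer_kap _ _, map_add,
        eps_mul_thetaOp, thetaOp_mul_eps, smul_add, sub_mul, mul_sub, add_mul, mul_add,
        smul_mul_assoc, mul_smul_comm]
      abel
    · simp only [LinearMap.sub_apply, LinearMap.add_apply, LinearMap.comp_apply,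
        LinearMap.smul_apply]
      cases a with
      | theta i => simp only [eps_gen, thetaOp_gen, kap_gen, epsGen, thetaOpGen, kapGen, map_zero,
          smul_zero, add_zero, sub_zero]
      | h k i => simp only [eps_gen, thetaOp_gen, kap_gen, epsGen, thetaOpGen, kapGen, map_zero,
          smul_zero, add_zero, sub_zero]
      | e I =>
        change thetaOp (eps l (e I)) + eps l (thetaOp (e I)) - _ • kap (e I) = 0
        have hs : ∀ (m : ℕ) (x : B0), (-1 : B0) ^ m * x = (-1 : ℤ) ^ m • x := by
          intro m x
          rcases Nat.even_or_odd m with hm | hm <;> simp [hm.neg_one_pow]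
        rw [kap_e, eps_e, thetaOp_e, map_sum]
        simp only [hs, map_zsmul, theta_mul_eq, map_smul, eps_e]
        by_cases hl : l ∈ I
          -- only the summand `i = l` of `Θ e_I` survives
        · rw [if_pos hl, map_zero, zero_add, sub_eq_zero, Finset.sum_eq_single_of_mem l hl]
          · rw [if_neg (Finset.notMem_erase l I), Finset.insert_erase hl, Finset.filter_erase,
              Finset.erase_eq_of_notMem (by simp),
              smul_comm (MvPolynomial.X l : ThetaPoly), smul_smul, ← pow_add,
              Even.neg_one_pow ⟨_, rfl⟩, one_smul]
          · intro i hi hil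
            rw [if_pos (Finset.mem_erase.2 ⟨hil.symm, hl⟩), smul_zero, smul_zero]
          -- the summand `i = l` of `Θ e_{l, I}` gives `θ_l e_I`, the others cancel in pairs
        · rw [if_neg hl, map_zsmul, thetaOp_e, Finset.sum_insert hl]
          simp only [hs, theta_mul_eq]
          rw [Finset.erase_insert hl, Finset.filter_insert, if_neg (lt_irrefl l), smul_add,
            smul_smul, ← pow_add, Even.neg_one_pow ⟨_, rfl⟩, one_smul, add_assoc, add_sub_assoc,
            add_comm, sub_add_cancel, Finset.smul_sum, ← Finset.sum_add_distrib]
          refine Finset.sum_eq_zero fun i hi => ?_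
          have hil : i ≠ l := fun h => hl (h ▸ hi)
          have hl' : l ∉ I.erase i := fun h => hl (Finset.mem_of_mem_erase h)
          rw [if_neg hl', Finset.erase_insert_of_ne hil.symm, Finset.filter_insert,
            Finset.filter_erase]
          have hl'' : l ∉ I.filter (· < i) := fun h => hl (Finset.mem_filter.1 h).1
          rw [smul_comm (MvPolynomial.X i : ThetaPoly), smul_smul, smul_smul, ← add_smul]
          rcases lt_or_gt_of_ne hil with h | h
          · have hi' : i ∈ I.filter (· < l) := Finset.mem_filter.2 ⟨hi, h⟩
            rw [if_neg (not_lt.2 h.le)]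
            have h3 := Finset.card_erase_add_one hi'
            rw [← h3]
            convert zero_smul ℤ _ using 2
            ring
          · rw [if_pos h, Finset.card_insert_of_notMem hl'',
              Finset.erase_eq_of_notMem (s := I.filter (· < l)) (by simp [h.le])]
            convert zero_smul ℤ _ using 2
            ring
    · simp only [LinearMap.sub_apply, LinearMap.add_apply, LinearMap.comp_apply,
        LinearMap.smul_apply, eps_zeta, kap_zeta, thetaOp_zeta, map_zero, smul_zero, add_zero,
        sub_zero]
  have h2 := congrArg (fun f => f x) h
  simp only [LinearMap.sub_apply, LinearMap.add_apply, LinearMap.comp_apply,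
    LinearMap.smul_apply, LinearMap.zero_apply] at h2
  rw [theta_mul_eq, eq_sub_iff_add_eq]
  exact sub_eq_zero.1 h2

theorem eps_anticomm (a b : ℕ+) (x : B0) : eps a (eps b x) = -eps b (eps a x) := by
  have h : eps a ∘ₗ eps b + eps b ∘ₗ eps a = 0 := by
    refine IsDer.eq_zero (fun x y => ?_) (fun g => ?_) (fun k i => ?_)
    · simp only [LinearMap.add_apply, LinearMap.comp_apply, isDer_eps _ _ _, map_add,
        eps_mul_eps, add_mul, mul_add]
      abel
    · simp only [LinearMap.add_apply, LinearMap.comp_apply]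
      cases g with
      | theta i => simp only [eps_gen, epsGen, map_zero, add_zero]
      | h k i => simp only [eps_gen, epsGen, map_zero, add_zero]
      | e I =>
        change eps a (eps b (e I)) + eps b (eps a (e I)) = 0
        have hs : ∀ (m : ℕ) (x : B0), (-1 : B0) ^ m * x = (-1 : ℤ) ^ m • x := by
          intro m x
          rcases Nat.even_or_odd m with hm | hm <;> simp [hm.neg_one_pow]
        rw [eps_e, eps_e]
        by_cases ha : a ∈ I
        · by_cases hb : b ∈ I
          · simp [ha, hb]
          · rw [if_pos ha, if_neg hb, map_zero, add_zero, hs, map_zsmul, eps_e,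
              if_pos (Finset.mem_insert_of_mem ha), smul_zero]
        · by_cases hb : b ∈ I
          · rw [if_pos hb, if_neg ha, map_zero, zero_add, hs, map_zsmul, eps_e,
              if_pos (Finset.mem_insert_of_mem hb), smul_zero]
          · rw [if_neg ha, if_neg hb, hs, hs, map_zsmul, map_zsmul, eps_e, eps_e]
            by_cases hab : a = b
            · subst hab; simp
            · rw [if_neg (by simp [ha, hab]), if_neg (by simp [hb, Ne.symm hab]), hs, hs,
                smul_smul, smul_smul, ← pow_add, ← pow_add, Finset.insert_comm, ← add_smul,
                Finset.filter_insert, Finset.filter_insert]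
              have ha' : ∀ p : ℕ+ → Prop, ∀ [DecidablePred p], a ∉ I.filter p :=
                fun p _ h => ha (Finset.mem_filter.1 h).1
              have hb' : ∀ p : ℕ+ → Prop, ∀ [DecidablePred p], b ∉ I.filter p :=
                fun p _ h => hb (Finset.mem_filter.1 h).1
              rcases lt_or_gt_of_ne hab with h | h
              · rw [if_pos h, if_neg (not_lt.2 h.le), Finset.card_insert_of_notMem (ha' _)]
                convert zero_smul ℤ _ using 2
                ring
              · rw [if_pos h, if_neg (not_lt.2 h.le), Finset.card_insert_of_notMem (hb' _)]
                convert zero_smul ℤ _ using 2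
                ring
    · simp only [LinearMap.add_apply, LinearMap.comp_apply, eps_zeta, map_zero, add_zero]
  exact eq_neg_of_add_eq_zero_left (congrArg (fun f => f x) h)

theorem eps_eps_self (a : ℕ+) (x : B0) : eps a (eps a x) = 0 := by
  have h := eps_anticomm a a x
  have h2 : (MvPolynomial.C (2 : ℚ) : ThetaPoly) • eps a (eps a x) = 0 := by
    rw [map_ofNat, two_smul]
    nth_rewrite 1 [h]
    exact neg_add_cancel _
  have h3 := congrArg (fun y => (MvPolynomial.C (2⁻¹ : ℚ) : ThetaPoly) • y) h2
  simpa [smul_smul, ← map_mul] using h3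

/-! ### The shift operators -/

theorem shift_mul (s : ℕ) (x y : B0) : shift s (x * y) = shift s x * shift s y :=
  map_mul (shiftHom s) x y
theorem shift_one (s : ℕ) : shift s 1 = 1 := map_one (shiftHom s)
theorem shift_gen (s : ℕ) (g : Gen) : shift s (ofAbar (Abar.gen g)) = ofAbar (shiftGen s g) :=
  shiftHom_gen s g
theorem shift_theta (s : ℕ) (l : ℕ+) : shift s (theta l) = theta l := shiftHom_gen s _
theorem shift_e (s : ℕ) (I : Finset ℕ+) : shift s (e I) = e I := shiftHom_gen s _
theorem shift_h (s : ℕ) (k l : ℕ+) : shift s (h k l) =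
    if (k : ℕ) < s then h k l else if (k : ℕ) = s then h k l + h (k + 1) l else h (k + 1) l := by
  refine (shiftHom_gen s _).trans ?_
  rw [shiftGen]
  split_ifs
  · rfl
  · exact map_add _ _ _
  · rfl
theorem shift_zeta (s k : ℕ) (l : ℕ+) :
    shift s (zeta k l) = if k < s then zeta k l else zeta (k + 1) l := shiftHom_zeta s k l

/-- A derivation commutes with a multiplicative map if it does so on the generators. -/
theorem IsDer.comm_hom {E φ : B0 →ₗ[ThetaPoly] B0} (hE : IsDer E)
    (hφ : ∀ x y, φ (x * y) = φ x * φ y) (h1 : φ 1 = 1)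
    (hgen : ∀ a, φ (E (ofAbar (Abar.gen a))) = E (φ (ofAbar (Abar.gen a))))
    (hz : ∀ k l, φ (E (zeta k l)) = E (φ (zeta k l))) (x : B0) : φ (E x) = E (φ x) := by
  have h : φ ∘ₗ E = E ∘ₗ φ := by
    refine ext_of_twisted_leibniz φ φ h1 h1 (fun x y => ?_) (fun x y => ?_) hgen hz
    · simp only [LinearMap.comp_apply, hE _ _, hφ, map_add]
    · simp only [LinearMap.comp_apply, hE _ _, hφ]
  exact congrArg (fun f => f x) h

theorem shift_eps (s : ℕ) (l : ℕ+) (x : B0) : shift s (eps l x) = eps l (shift s x) := by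
  refine (isDer_eps l).comm_hom (shift_mul s) (shift_one s) (fun a => ?_) (fun k i => ?_) x
  · cases a with
    | theta i => change shift s _ = eps l (shift s (theta i)); rw [shift_theta, theta, eps_gen,
        epsGen, map_zero, map_zero]
    | e I =>
      change shift s (eps l (e I)) = eps l (shift s (e I))
      rw [shift_e, eps_e]
      split_ifs
      · exact map_zero _
      · rcases neg_one_pow_eq_or B0 (I.filter (· < l)).card with h | h <;> rw [h] <;>
          simp [shift_e]
    | h k i =>
      change shift s (eps l (h k i)) = eps l (shift s (h k i))
      rw [eps_h, shift_h, map_zero]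
      split_ifs <;> simp [eps_h]
  · rw [eps_zeta, shift_zeta, map_zero]
    split_ifs <;> rw [eps_zeta]

theorem shift_kap (s : ℕ) (x : B0) : shift s (kap x) = kap (shift s x) := by
  refine isDer_kap.comm_hom (shift_mul s) (shift_one s) (fun a => ?_) (fun k i => ?_) x
  · cases a with
    | theta i => change shift s _ = kap (shift s (theta i)); rw [shift_theta, theta, kap_gen,
        kapGen, map_zero, map_zero]
    | e I =>
      change shift s (kap (e I)) = kap (shift s (e I))
      rw [shift_e, kap_e, shift_e]
    | h k i =>
      change shift s (kap (h k i)) = kap (shift s (h k i))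
      rw [kap_h, shift_h, map_zero]
      split_ifs <;> simp [kap_h]
  · rw [kap_zeta, shift_zeta, map_zero]
    split_ifs <;> rw [kap_zeta]

theorem shift_eul (s : ℕ) (x : B0) : shift s (eul x) = eul (shift s x) := by
  refine isDer_eul.comm_hom (shift_mul s) (shift_one s) (fun a => ?_) (fun k i => ?_) x
  · cases a with
    | theta i => change shift s _ = eul (shift s (theta i)); rw [shift_theta, theta, eul_gen,
        eulGen, map_zero, map_zero]
    | e I =>
      change shift s (eul (e I)) = eul (shift s (e I))
      rw [shift_e, eul_e, map_zero]
    | h k i =>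
      change shift s (eul (h k i)) = eul (shift s (h k i))
      rw [eul_h, shift_h]
      split_ifs <;> simp [eul_h]
  · rw [eul_zeta, shift_zeta]
    split_ifs <;> rw [eul_zeta]

theorem shift_thetaOp (s : ℕ) (x : B0) : shift s (thetaOp x) = thetaOp (shift s x) := by
  refine isDer_thetaOp.comm_hom (shift_mul s) (shift_one s) (fun a => ?_) (fun k i => ?_) x
  · cases a with
    | theta i => change shift s (thetaOp (theta i)) = thetaOp (shift s (theta i)); rw [shift_theta,
        thetaOp_theta, map_zero]
    | e I =>
      change shift s (thetaOp (e I)) = thetaOp (shift s (e I))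
      rw [shift_e, thetaOp_e, map_sum]
      refine Finset.sum_congr rfl fun i _ => ?_
      rcases neg_one_pow_eq_or B0 (I.filter (· < i)).card with h | h <;> rw [h] <;>
          simp [shift_mul, shift_e, shift_theta]
    | h k i =>
      change shift s (thetaOp (h k i)) = thetaOp (shift s (h k i))
      rw [thetaOp_h, shift_h, map_zero]
      split_ifs <;> simp [thetaOp_h]
  · rw [thetaOp_zeta, shift_zeta, map_zero]
    split_ifs <;> rw [thetaOp_zeta]

/-- Multiplicative maps that agree on the generators are equal. -/
theorem hom_ext {φ ψ : B0 →ₗ[ThetaPoly] B0} (hφ : ∀ x y, φ (x * y) = φ x * φ y) (hφ1 : φ 1 = 1)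
    (hψ : ∀ x y, ψ (x * y) = ψ x * ψ y) (hψ1 : ψ 1 = 1)
    (hgen : ∀ a, φ (ofAbar (Abar.gen a)) = ψ (ofAbar (Abar.gen a)))
    (hz : ∀ k l, φ (zeta k l) = ψ (zeta k l)) (x : B0) : φ x = ψ x := by
  induction x using gen_induction with
  | hC c => rw [ofAbar_rat, map_smul, map_smul, hφ1, hψ1]
  | hg a => exact hgen a
  | hz k l => exact hz k l
  | hadd x y hx hy => rw [map_add, map_add, hx, hy]
  | hmul x y hx hy => rw [hφ, hψ, hx, hy]

theorem shift_succ_shift_zero (s : ℕ) (x : B0) :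
    shift (s + 1) (shift 0 x) = shift 0 (shift s x) := by
  refine hom_ext (φ := shift (s + 1) ∘ₗ shift 0) (ψ := shift 0 ∘ₗ shift s)
    (fun x y => by simp [shift_mul]) (by simp [shift_one])
    (fun x y => by simp [shift_mul]) (by simp [shift_one]) (fun a => ?_) (fun k l => ?_) x
  · cases a with
    | theta i =>
      change shift (s + 1) (shift 0 (theta i)) = shift 0 (shift s (theta i))
      simp only [shift_theta]
    | e I =>
      change shift (s + 1) (shift 0 (e I)) = shift 0 (shift s (e I))
      simp only [shift_e]
    | h k i =>
      change shift (s + 1) (shift 0 (h k i)) = shift 0 (shift s (h k i))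
      have hk : ∀ k : ℕ+, shift 0 (h k i) = h (k + 1) i := fun k => by
        rw [shift_h, if_neg (Nat.not_lt_zero _), if_neg k.ne_zero]
      rw [hk, shift_h, shift_h, PNat.add_coe, PNat.one_coe]
      simp only [add_lt_add_iff_right, add_left_inj]
      split_ifs <;> simp [hk]
  · change shift (s + 1) (shift 0 (zeta k l)) = shift 0 (shift s (zeta k l))
    have hk : ∀ k : ℕ, shift 0 (zeta k l) = zeta (k + 1) l := fun k => by
      rw [shift_zeta, if_neg (Nat.not_lt_zero _)]
    rw [hk, shift_zeta, shift_zeta]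
    simp only [add_lt_add_iff_right]
    split_ifs <;> simp [hk]

theorem sgn_shift (s : ℕ) (x : B0) : sgn (shift s x) = shift s (sgn x) := by
  refine hom_ext (φ := sgnLin ∘ₗ shift s) (ψ := shift s ∘ₗ sgnLin)
    (fun x y => ?_) ?_ (fun x y => ?_) ?_ (fun a => ?_) (fun k l => ?_) x
  · change sgn (shift s (x * y)) = sgn (shift s x) * sgn (shift s y)
    rw [shift_mul, map_mul]
  · change sgn (shift s 1) = 1
    rw [shift_one, map_one]
  · change shift s (sgn (x * y)) = shift s (sgn x) * shift s (sgn y)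
    rw [map_mul, shift_mul]
  · change shift s (sgn 1) = 1
    rw [map_one, shift_one]
  · change sgn (shift s (ofAbar _)) = shift s (sgn (ofAbar _))
    rw [shift_gen, sgn_ofAbar, sgn_ofAbar, shift_gen]
  · change sgn (shift s (zeta k l)) = shift s (sgn (zeta k l))
    rw [sgn_zeta, map_neg, shift_zeta]
    split_ifs <;> rw [sgn_zeta]

theorem d_shift (s : ℕ) (x : B0) : d (shift s x) = shift s (d x) := by
  have h : d ∘ₗ shift s = shift s ∘ₗ d := by
    refine ext_of_twisted_leibniz (fun x => sgn (shift s x)) (shift s)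
      (by simp only [shift_one, map_one]) (shift_one s) (fun x y => ?_) (fun x y => ?_)
      (fun a => ?_) (fun k l => ?_)
    · simp only [LinearMap.comp_apply, shift_mul, d_mul]
    · simp only [LinearMap.comp_apply, d_mul, map_add, shift_mul, sgn_shift]
    · cases a with
      | theta i =>
        change d (shift s (theta i)) = shift s (d (theta i))
        rw [shift_theta, d_theta, map_zero]
      | e I =>
        change d (shift s (e I)) = shift s (d (e I))
        rw [shift_e, d_e, map_zero]
      | h k i =>
        change d (shift s (h k i)) = shift s (d (h k i))
        have hk := k.pos
        have hk1 : (k : ℕ) - 1 + 1 = k := Nat.sub_add_cancel hk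
        rw [shift_h, d_h, map_sub, shift_zeta, shift_zeta]
        split_ifs <;> first
          | omega
          | simp only [map_add, d_h, PNat.add_coe, PNat.one_coe, add_tsub_cancel_right, hk1]
        all_goals abel
    · simp only [LinearMap.comp_apply, d_zeta, map_zero, shift_zeta]
      split_ifs <;> rw [d_zeta]
  exact congrArg (fun f => f x) h

/-! ### The weight grading -/

/-- The images of the generators under the projection to weight zero. -/
def pi0Gen : Gen → Abar
  | .theta l => Abar.gen (.theta l)
  | .e I => Abar.gen (.e I)
  | .h _ _ => 0

/-- The projection to weight zero as a ring homomorphism: it fixes the `θ` and `e` and kills the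
`h` and `ζ`. -/
def pi0Hom : B0 →+* B0 :=
  lift (ofAbar.comp (Abar.lift pi0Gen (fun I J => Abar.e_mul_e I J)).toRingHom)
    (fun a c => Algebra.commutes (Abar.lift pi0Gen _ a) c) (fun _ _ => 0)
    (fun _ _ => zero_mul 0) (fun _ _ _ _ => by simp)

theorem pi0Hom_gen (g : Gen) : pi0Hom (ofAbar (Abar.gen g)) = ofAbar (pi0Gen g) := by
  rw [pi0Hom, lift_ofAbar]
  exact congrArg ofAbar (Abar.lift_gen _ _ g)

/-- The projection of `B₀` to its part of weight zero. -/
def pi0 : B0 →ₗ[ThetaPoly] B0 where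
  toFun := pi0Hom
  map_add' := map_add pi0Hom
  map_smul' p x := by
    have hp : ∀ p : ThetaPoly, pi0Hom (ofAbar (algebraMap ThetaPoly Abar p)) =
        ofAbar (algebraMap ThetaPoly Abar p) := by
      intro p
      induction p using MvPolynomial.induction_on with
      | C c =>
        rw [algebraMap_theta_C, pi0Hom, lift_ofAbar]
        exact congrArg ofAbar ((Abar.lift pi0Gen _).commutes c)
      | add p q hp hq => rw [map_add, map_add, map_add, hp, hq]
      | mul_X p l hp =>
        rw [map_mul, map_mul, map_mul, hp, algebraMap_theta_X, pi0Hom_gen]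
        rfl
    rw [RingHom.id_apply, theta_smul_eq, theta_smul_eq, map_mul, hp]

theorem pi0_mul (x y : B0) : pi0 (x * y) = pi0 x * pi0 y := map_mul pi0Hom x y
theorem pi0_one : pi0 1 = 1 := map_one pi0Hom
theorem pi0_theta (l : ℕ+) : pi0 (theta l) = theta l := pi0Hom_gen _
theorem pi0_e (I : Finset ℕ+) : pi0 (e I) = e I := pi0Hom_gen _
theorem pi0_h (k l : ℕ+) : pi0 (h k l) = 0 := (pi0Hom_gen _).trans (map_zero _)
theorem pi0_zeta (k : ℕ) (l : ℕ+) : pi0 (zeta k l) = 0 := by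
  exact (lift_zeta _ _ _ _ _ k l : pi0Hom (zeta k l) = 0)

/-- The values of `d` have positive weight. -/
theorem pi0_d (x : B0) : pi0 (d x) = 0 := by
  induction x using gen_induction with
  | hC c => rw [ofAbar_rat, map_smul, show d 1 = 0 by simpa using d_mul 1 1, smul_zero, map_zero]
  | hg g =>
    cases g with
    | theta l => change pi0 (d (theta l)) = 0; rw [d_theta, map_zero]
    | e I => change pi0 (d (e I)) = 0; rw [d_e, map_zero]
    | h k l => change pi0 (d (h k l)) = 0; rw [d_h, map_sub, pi0_zeta, pi0_zeta, sub_zero]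
  | hz k l => rw [d_zeta, map_zero]
  | hadd x y hx hy => rw [map_add, map_add, hx, hy, add_zero]
  | hmul x y hx hy => rw [d_mul, map_add, pi0_mul, pi0_mul, hx, hy, zero_mul, mul_zero, add_zero]

theorem pi0_shift (s : ℕ) (x : B0) : pi0 (shift s x) = pi0 x := by
  refine hom_ext (φ := pi0 ∘ₗ shift s) (fun x y => by simp [shift_mul, pi0_mul])
    (by simp [shift_one, pi0_one]) pi0_mul pi0_one (fun a => ?_) (fun k l => ?_) x
  · cases a with
    | theta i => change pi0 (shift s (theta i)) = pi0 (theta i); rw [shift_theta]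
    | e I => change pi0 (shift s (e I)) = pi0 (e I); rw [shift_e]
    | h k i =>
      change pi0 (shift s (h k i)) = pi0 (h k i)
      rw [shift_h]
      split_ifs <;> simp [pi0_h]
  · change pi0 (shift s (zeta k l)) = pi0 (zeta k l)
    rw [shift_zeta]
    split_ifs <;> simp [pi0_zeta]

theorem pi0_thetaOp (x : B0) : pi0 (thetaOp x) = thetaOp (pi0 x) := by
  refine isDer_thetaOp.comm_hom pi0_mul pi0_one (fun a => ?_) (fun k i => ?_) x
  · cases a with
    | theta i =>
      change pi0 (thetaOp (theta i)) = thetaOp (pi0 (theta i))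
      rw [pi0_theta, thetaOp_theta, map_zero]
    | e I =>
      change pi0 (thetaOp (e I)) = thetaOp (pi0 (e I))
      rw [pi0_e, thetaOp_e, map_sum]
      refine Finset.sum_congr rfl fun i _ => ?_
      rcases neg_one_pow_eq_or B0 (I.filter (· < i)).card with h | h <;> rw [h] <;>
          simp [pi0_mul, pi0_e, pi0_theta]
    | h k i =>
      change pi0 (thetaOp (h k i)) = thetaOp (pi0 (h k i))
      rw [thetaOp_h, pi0_h, map_zero, map_zero]
  · rw [thetaOp_zeta, pi0_zeta, map_zero, map_zero]

/-- `x` is homogeneous of weight `w` for the Euler operator. That such an `x` lies in `ℐ^w` and is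
fixed or killed by the projection to weight zero is a consequence which is convenient to carry
along. -/
structure IsHom (w : ℕ) (x : B0) : Prop where
  eul_eq : eul x = w • x
  mem : x ∈ idealI ^ w
  pi0_eq : pi0 x = if w = 0 then x else 0

theorem IsHom.mul {v w : ℕ} {x y : B0} (hx : IsHom v x) (hy : IsHom w y) :
    IsHom (v + w) (x * y) where
  eul_eq := by
    rw [isDer_eul, hx.eul_eq, hy.eul_eq, smul_mul_assoc, mul_smul_comm, add_smul]
  mem := by
    rw [Ideal.IsTwoSided.pow_add]
    exact Ideal.mul_mem_mul hx.mem hy.mem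
  pi0_eq := by
    rw [pi0_mul, hx.pi0_eq, hy.pi0_eq]
    by_cases hv : v = 0 <;> by_cases hw : w = 0 <;> simp [hv, hw]

theorem IsHom.add {w : ℕ} {x y : B0} (hx : IsHom w x) (hy : IsHom w y) : IsHom w (x + y) where
  eul_eq := by rw [map_add, hx.eul_eq, hy.eul_eq, smul_add]
  mem := add_mem hx.mem hy.mem
  pi0_eq := by rw [map_add, hx.pi0_eq, hy.pi0_eq]; split_ifs <;> simp

theorem IsHom.zero (w : ℕ) : IsHom w 0 where
  eul_eq := by simp
  mem := zero_mem _
  pi0_eq := by simp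

theorem IsHom.sum {ι : Type*} {w : ℕ} (s : Finset ι) {f : ι → B0} (hf : ∀ i ∈ s, IsHom w (f i)) :
    IsHom w (∑ i ∈ s, f i) :=
  Finset.sum_induction f (IsHom w) (fun _ _ => IsHom.add) (IsHom.zero w) hf

theorem IsHom.smul {w : ℕ} {x : B0} (hx : IsHom w x) (p : ThetaPoly) : IsHom w (p • x) where
  eul_eq := by rw [map_smul, hx.eul_eq, smul_comm]
  mem := by rw [theta_smul_eq]; exact Ideal.mul_mem_left _ _ hx.mem
  pi0_eq := by rw [map_smul, hx.pi0_eq]; split_ifs <;> simp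

theorem mem_idealI_pow_one {x : B0} (hx : x ∈ gens 0) : x ∈ idealI ^ 1 := by
  rw [Submodule.pow_one]; exact gens_subset 0 hx

theorem IsHom.one : IsHom 0 1 where
  eul_eq := by rw [isDer_eul.map_one, zero_smul]
  mem := by simp [Submodule.pow_zero, Ideal.one_eq_top]
  pi0_eq := by rw [pi0_one, if_pos rfl]

theorem isHom_theta (l : ℕ+) : IsHom 0 (theta l) := by
  have := IsHom.one.smul (MvPolynomial.X l)
  rwa [← theta_mul_eq, mul_one] at this

theorem isHom_e (I : Finset ℕ+) : IsHom 0 (e I) where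
  eul_eq := by rw [eul_e, zero_smul]
  mem := by simp [Submodule.pow_zero, Ideal.one_eq_top]
  pi0_eq := by rw [pi0_e, if_pos rfl]

theorem isHom_h (k l : ℕ+) : IsHom 1 (h k l) where
  eul_eq := by rw [eul_h, one_smul]
  mem := mem_idealI_pow_one (Or.inl ⟨.h k l, Nat.zero_le _, rfl⟩)
  pi0_eq := by rw [pi0_h, if_neg one_ne_zero]

theorem isHom_zeta (k : ℕ) (l : ℕ+) : IsHom 1 (zeta k l) where
  eul_eq := by rw [eul_zeta, one_smul]
  mem := mem_idealI_pow_one (Or.inr ⟨k, l, Nat.zero_le _, rfl⟩)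
  pi0_eq := by rw [pi0_zeta, if_neg one_ne_zero]

/-- `B₀` is spanned by homogeneous elements. -/
theorem mem_closure_isHom (x : B0) : x ∈ AddSubgroup.closure {y | ∃ w, IsHom w y} := by
  induction x using gen_induction with
  | hC c =>
    rw [ofAbar_rat]
    exact AddSubgroup.subset_closure ⟨0, IsHom.one.smul _⟩
  | hg g =>
    cases g with
    | theta l => exact AddSubgroup.subset_closure ⟨0, isHom_theta l⟩
    | e I => exact AddSubgroup.subset_closure ⟨0, isHom_e I⟩
    | h k l => exact AddSubgroup.subset_closure ⟨1, isHom_h k l⟩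
  | hz k l => exact AddSubgroup.subset_closure ⟨1, isHom_zeta k l⟩
  | hadd x y hx hy => exact add_mem hx hy
  | hmul x y hx hy =>
    induction hx using AddSubgroup.closure_induction with
    | zero => rw [zero_mul]; exact zero_mem _
    | add a b _ _ ha hb => rw [add_mul]; exact add_mem ha hb
    | neg a _ ha => rw [neg_mul]; exact neg_mem ha
    | mem a ha =>
      obtain ⟨v, ha⟩ := ha
      induction hy using AddSubgroup.closure_induction with
      | zero => rw [mul_zero]; exact zero_mem _
      | add b c _ _ hb hc => rw [mul_add]; exact add_mem hb hc
      | neg b _ hb => rw [mul_neg]; exact neg_mem hb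
      | mem b hb =>
        obtain ⟨w, hb⟩ := hb
        exact AddSubgroup.subset_closure ⟨v + w, ha.mul hb⟩

/-- The polynomial `(𝓔 - 1) ⋯ (𝓔 - n)` in the Euler operator `𝓔`; it kills weights `1, …, n`. -/
def eulProd : ℕ → B0 →ₗ[ThetaPoly] B0
  | 0 => LinearMap.id
  | n + 1 => (eul - ((n + 1 : ℕ) : B0 →ₗ[ThetaPoly] B0)) ∘ₗ eulProd n

theorem eulProd_succ (n : ℕ) (x : B0) :
    eulProd (n + 1) x = eul (eulProd n x) - (n + 1) • eulProd n x := by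
  rw [eulProd, LinearMap.comp_apply, LinearMap.sub_apply, Module.End.natCast_apply]

theorem IsHom.eulProd_eq {w : ℕ} {x : B0} (hx : IsHom w x) (n : ℕ) :
    eulProd n x = (∏ i ∈ Finset.range n, ((w : ℤ) - (i + 1))) • x := by
  induction n with
  | zero => simp [eulProd]
  | succ n ih =>
    rw [eulProd_succ, ih, map_zsmul, hx.eul_eq, Finset.prod_range_succ, mul_smul, sub_smul,
      smul_sub]
    congr 1
    rw [show ((n : ℤ) + 1) • x = (n + 1) • x by norm_cast, smul_comm]

/-- An ideal-like submodule stable under the Euler operator contains every `x` for which it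
contains the image under the Euler operator and the weight-zero part, as soon as it contains
`ℐ^n` for some `n`. -/
theorem mem_of_eul_mem {K : Submodule ThetaPoly B0} (hE : ∀ x ∈ K, eul x ∈ K) {n : ℕ}
    (hK : ∀ x ∈ idealI ^ n, x ∈ K) {x : B0} (hx : eul x ∈ K) (h0 : pi0 x ∈ K) : x ∈ K := by
  -- the part of positive weight is killed in weights up to `n` and lies in `ℐ^n` beyond
  have h1 : eulProd n (x - pi0 x) ∈ K := by
    refine hK _ ?_
    clear hx h0
    induction mem_closure_isHom x using AddSubgroup.closure_induction with
    | zero => simp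
    | add a b _ _ ha hb =>
      rw [map_add, add_sub_add_comm, map_add]; exact add_mem ha hb
    | neg a _ ha => rw [map_neg, ← neg_sub', map_neg]; exact neg_mem ha
    | mem a ha =>
      obtain ⟨w, ha⟩ := ha
      rw [ha.pi0_eq]
      split_ifs with hw
      · simp
      · rw [sub_zero, ha.eulProd_eq]
        by_cases hwn : w ≤ n
        · rw [Finset.prod_eq_zero (i := w - 1) (Finset.mem_range.2 (by omega)) (by
            push_cast [Nat.one_le_iff_ne_zero.2 hw]; ring), zero_smul]
          exact zero_mem _
        · exact zsmul_mem (Ideal.pow_le_pow_right (by omega) ha.mem) _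
  have hP : ∀ n, ∀ y ∈ K, eulProd n y ∈ K := by
    intro n y hy
    induction n with
    | zero => exact hy
    | succ n ih => rw [eulProd_succ]; exact sub_mem (hE _ ih) (nsmul_mem ih _)
  have h2 : eulProd n x ∈ K := by
    rw [map_sub] at h1
    have := add_mem h1 (hP n _ h0)
    rwa [sub_add_cancel] at this
  -- modulo `K` the Euler operator acts on `x` as zero, so `eulProd n` acts as its constant term
  have h3 : ∀ n, eulProd n x - (∏ i ∈ Finset.range n, (-((i : ℤ) + 1))) • x ∈ K := by
    intro n
    induction n with
    | zero => simp [eulProd]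
    | succ n ih =>
      have e1 : eulProd (n + 1) x - (∏ i ∈ Finset.range (n + 1), (-((i : ℤ) + 1))) • x =
          eul (eulProd n x - (∏ i ∈ Finset.range n, (-((i : ℤ) + 1))) • x) +
          (∏ i ∈ Finset.range n, (-((i : ℤ) + 1))) • eul x -
          (n + 1) • (eulProd n x - (∏ i ∈ Finset.range n, (-((i : ℤ) + 1))) • x) := by
        rw [eulProd_succ, Finset.prod_range_succ, map_sub, map_zsmul, smul_sub, mul_comm, mul_smul,
          neg_smul]
        have : ((n : ℤ) + 1) • (∏ i ∈ Finset.range n, (-((i : ℤ) + 1))) • x =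
            (n + 1) • (∏ i ∈ Finset.range n, (-((i : ℤ) + 1))) • x := by
          norm_cast
        rw [this]
        abel
      rw [e1]
      exact sub_mem (add_mem (hE _ ih) (zsmul_mem hx _)) (nsmul_mem ih _)
  have h4 : (∏ i ∈ Finset.range n, (-((i : ℤ) + 1))) • x ∈ K := by
    have := sub_mem h2 (h3 n)
    rwa [sub_sub_cancel] at this
  have hne : ((∏ i ∈ Finset.range n, (-((i : ℤ) + 1)) : ℤ) : ℚ) ≠ 0 := by
    rw [Int.cast_ne_zero, Finset.prod_ne_zero_iff]
    intro i _
    omega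
  have h5 := K.smul_mem
    (MvPolynomial.C (((∏ i ∈ Finset.range n, (-((i : ℤ) + 1)) : ℤ) : ℚ)⁻¹)) h4
  rw [← Int.cast_smul_eq_zsmul ThetaPoly, smul_smul, ← map_intCast (MvPolynomial.C (σ := ℕ+) (R := ℚ)),
    ← map_mul, inv_mul_cancel₀ hne, map_one, one_smul] at h5
  exact h5

/-! ### Compatibility with the filtration -/

theorem eps_gens (l : ℕ+) (n : ℕ) (x : B0) (hx : x ∈ gens n) : eps l x ∈ idealJ n := by
  rcases hx with ⟨g, hg, rfl⟩ | ⟨k, i, _, rfl⟩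
  · cases g with
    | theta i => rw [eps_gen, epsGen, map_zero]; exact zero_mem _
    | e I =>
      change eps l (e I) ∈ idealJ n
      rw [eps_e]
      split_ifs with h
      · exact zero_mem _
      · refine Ideal.mul_mem_left _ _ (e_mem ?_)
        have hn : n ≤ I.card := hg
        rw [Finset.card_insert_of_notMem h]
        omega
    | h k i => rw [eps_gen, epsGen, map_zero]; exact zero_mem _
  · rw [eps_zeta]; exact zero_mem _

theorem kap_gens (n : ℕ) (x : B0) (hx : x ∈ gens n) : kap x ∈ idealJ n := by
  rcases hx with ⟨g, hg, rfl⟩ | ⟨k, i, _, rfl⟩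
  · cases g with
    | theta i => rw [kap_gen, kapGen, map_zero]; exact zero_mem _
    | e I => change kap (e I) ∈ idealJ n; rw [kap_e]; exact e_mem hg
    | h k i => rw [kap_gen, kapGen, map_zero]; exact zero_mem _
  · rw [kap_zeta]; exact zero_mem _

theorem eul_gens (n : ℕ) (x : B0) (hx : x ∈ gens n) : eul x ∈ idealJ n := by
  rcases hx with ⟨g, hg, rfl⟩ | ⟨k, i, hk, rfl⟩
  · cases g with
    | theta i => rw [eul_gen, eulGen, map_zero]; exact zero_mem _
    | e I => rw [eul_gen, eulGen, map_zero]; exact zero_mem _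
    | h k i => change eul (h k i) ∈ idealJ n; rw [eul_h]; exact h_mem hg
  · rw [eul_zeta]; exact zeta_mem hk

theorem pi0_gens (n : ℕ) (x : B0) (hx : x ∈ gens n) : pi0 x ∈ idealJ n := by
  rcases hx with ⟨g, hg, rfl⟩ | ⟨k, i, _, rfl⟩
  · cases g with
    | theta i => change pi0 (theta i) ∈ idealJ n; rw [pi0_theta]; exact theta_mem hg
    | e I => change pi0 (e I) ∈ idealJ n; rw [pi0_e]; exact e_mem hg
    | h k i => change pi0 (h k i) ∈ idealJ n; rw [pi0_h]; exact zero_mem _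
  · rw [pi0_zeta]; exact zero_mem _

theorem eps_filt (l : ℕ+) {n : ℕ} {x : B0} (hx : x ∈ filt n) : eps l x ∈ filt n :=
  (isDer_eps l).filt_mem (eps_gens l) hx
theorem kap_filt {n : ℕ} {x : B0} (hx : x ∈ filt n) : kap x ∈ filt n :=
  isDer_kap.filt_mem kap_gens hx
theorem eul_filt {n : ℕ} {x : B0} (hx : x ∈ filt n) : eul x ∈ filt n :=
  isDer_eul.filt_mem eul_gens hx
theorem pi0_filt {n : ℕ} {x : B0} (hx : x ∈ filt n) : pi0 x ∈ filt n :=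
  ringHom_filt pi0Hom pi0_gens hx

end B0

namespace B1

/-! ### The topological ring `B₁` -/

theorem eventually_proj_eq (x : B1) (n : ℕ) : ∀ᶠ y in nhds x, proj n y = proj n x :=
  tendsto_iff.1 (Filter.tendsto_id (x := nhds x)) n

instance : IsTopologicalRing B1 where
  continuous_add := continuous_iff_continuousAt.2 fun p => tendsto_iff.2 fun n => by
    rw [nhds_prod_eq]
    filter_upwards [(eventually_proj_eq p.1 n).prod_mk (eventually_proj_eq p.2 n)] with q hq
    rw [map_add, map_add, hq.1, hq.2]
  continuous_mul := continuous_iff_continuousAt.2 fun p => tendsto_iff.2 fun n => by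
    rw [nhds_prod_eq]
    filter_upwards [(eventually_proj_eq p.1 n).prod_mk (eventually_proj_eq p.2 n)] with q hq
    rw [map_mul, map_mul, hq.1, hq.2]
  continuous_neg := continuous_iff_continuousAt.2 fun p => tendsto_iff.2 fun n => by
    filter_upwards [eventually_proj_eq p n] with q hq
    rw [map_neg, map_neg, hq]

theorem exists_proj_eq (n : ℕ) (u : B1) : ∃ z : B0, proj n (of z) = proj n u :=
  Ideal.Quotient.mk_surjective (proj n u)

theorem proj_eq_of_le {m n : ℕ} (hmn : m ≤ n) {u v : B1} (h : proj n u = proj n v) :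
    proj m u = proj m v := by
  rw [← factor_proj hmn u, h, factor_proj hmn]

/-- The image of `B₀` in `B₁` is dense. -/
theorem denseRange_of : DenseRange of := by
  intro u
  choose z hz using fun n => exists_proj_eq n u
  refine mem_closure_of_tendsto (f := fun n => of (z n)) (b := Filter.atTop) ?_
    (Filter.Eventually.of_forall fun n => ⟨z n, rfl⟩)
  refine tendsto_iff.2 fun m => ?_
  filter_upwards [Filter.eventually_ge_atTop m] with n hn
  exact proj_eq_of_le hn (hz n)

/-- Continuous maps out of `B₁` are determined by their restriction to `B₀`. -/
theorem eq_of_eq_of {f g : B1 → B1} (hf : Continuous f) (hg : Continuous g)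
    (h : ∀ x, f (of x) = g (of x)) (u : B1) : f u = g u :=
  congrFun (denseRange_of.equalizer hf hg (funext h)) u

/-- The extension to `B₁` of a multiplicative operator is multiplicative. -/
theorem extend_mul (f : B0 →ₗ[ThetaPoly] B0)
    (hf : ∀ n x, x ∈ B0.filt (n + 1) → f x ∈ B0.filt n) (hm : ∀ x y, f (x * y) = f x * f y)
    (u v : B1) : extend f hf (u * v) = extend f hf u * extend f hf v := by
  refine eq_of_eq_of (f := fun u => extend f hf (u * v))
    (g := fun u => extend f hf u * extend f hf v)
    ((continuous_extend f hf).comp (continuous_id.mul continuous_const))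
    ((continuous_extend f hf).mul continuous_const) (fun x => ?_) u
  refine eq_of_eq_of (f := fun v => extend f hf (of x * v))
    (g := fun v => extend f hf (of x) * extend f hf v)
    ((continuous_extend f hf).comp (continuous_const.mul continuous_id))
    (continuous_const.mul (continuous_extend f hf)) (fun y => ?_) v
  simp only [← map_mul, extend_of, hm]

theorem of_comm_of_ofAbar (a : Abar) (u : B1) :
    of (B0.ofAbar a) * u = u * of (B0.ofAbar a) := by
  refine eq_of_eq_of (f := fun u => of (B0.ofAbar a) * u) (g := fun u => u * of (B0.ofAbar a))
    (by fun_prop) (by fun_prop) (fun x => ?_) u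
  simp only [← map_mul, B0.ofAbar_comm]

/-! ### The operators on `B₁` -/

/-- `d` on `B₁`. -/
def d : B1 →ₗ[ThetaPoly] B1 := extend B0.d (fun _ _ => B0.d_filt)

/-- Exterior multiplication by `e_l` on `B₁`. -/
def eps (l : ℕ+) : B1 →ₗ[ThetaPoly] B1 :=
  extend (B0.eps l) (fun _ _ hx => B0.filt_anti (Nat.le_succ _) (B0.eps_filt l hx))

/-- The `e`-degree on `B₁`. -/
def kap : B1 →ₗ[ThetaPoly] B1 :=
  extend B0.kap (fun _ _ hx => B0.filt_anti (Nat.le_succ _) (B0.kap_filt hx))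

/-- The Euler operator on `B₁`. -/
def eul : B1 →ₗ[ThetaPoly] B1 :=
  extend B0.eul (fun _ _ hx => B0.filt_anti (Nat.le_succ _) (B0.eul_filt hx))

/-- The projection of `B₁` to weight zero. -/
def pi0 : B1 →ₗ[ThetaPoly] B1 :=
  extend B0.pi0 (fun _ _ hx => B0.filt_anti (Nat.le_succ _) (B0.pi0_filt hx))

@[fun_prop] theorem continuous_d : Continuous (fun u => d u) := continuous_extend _ _
@[fun_prop] theorem continuous_eps (l : ℕ+) : Continuous (fun u => eps l u) :=
  continuous_extend _ _
@[fun_prop] theorem continuous_kap : Continuous (fun u => kap u) := continuous_extend _ _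
@[fun_prop] theorem continuous_eul : Continuous (fun u => eul u) := continuous_extend _ _
@[fun_prop] theorem continuous_pi0 : Continuous (fun u => pi0 u) := continuous_extend _ _
@[fun_prop] theorem continuous_thetaOp : Continuous (fun u => thetaOp u) := continuous_extend _ _
@[fun_prop] theorem continuous_shift (s : ℕ) : Continuous (fun u => shift s u) :=
  continuous_extend _ _

theorem d_of (x : B0) : d (of x) = of (B0.d x) := extend_of _ _ x
theorem eps_of (l : ℕ+) (x : B0) : eps l (of x) = of (B0.eps l x) := extend_of _ _ x
theorem kap_of (x : B0) : kap (of x) = of (B0.kap x) := extend_of _ _ x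
theorem eul_of (x : B0) : eul (of x) = of (B0.eul x) := extend_of _ _ x
theorem pi0_of (x : B0) : pi0 (of x) = of (B0.pi0 x) := extend_of _ _ x
theorem thetaOp_of (x : B0) : thetaOp (of x) = of (B0.thetaOp x) := extend_of _ _ x
theorem shift_of (s : ℕ) (x : B0) : shift s (of x) = of (B0.shift s x) := extend_of _ _ x

theorem nabla_eq (u : B1) : nabla u = d u + thetaZeta * u := rfl

theorem shift_mul (s : ℕ) (u v : B1) : shift s (u * v) = shift s u * shift s v :=
  extend_mul _ _ (B0.shift_mul s) u v
theorem pi0_mul (u v : B1) : pi0 (u * v) = pi0 u * pi0 v := extend_mul _ _ B0.pi0_mul u v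
theorem shift_one (s : ℕ) : shift s 1 = 1 := by
  rw [← map_one of, shift_of, B0.shift_one]
theorem pi0_one : pi0 1 = 1 := by rw [← map_one of, pi0_of, B0.pi0_one]
theorem eul_one : eul 1 = 0 := by rw [← map_one of, eul_of, B0.isDer_eul.map_one, map_zero]

theorem d_eps (l : ℕ+) (u : B1) : d (eps l u) = eps l (d u) :=
  eq_of_eq_of (f := fun u => d (eps l u)) (g := fun u => eps l (d u)) (by fun_prop) (by fun_prop)
    (fun x => by simp only [d_of, eps_of, B0.d_eps]) u
theorem d_eul (u : B1) : d (eul u) = eul (d u) :=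
  eq_of_eq_of (f := fun u => d (eul u)) (g := fun u => eul (d u)) (by fun_prop) (by fun_prop)
    (fun x => by simp only [d_of, eul_of, B0.d_eul]) u
theorem d_shift (s : ℕ) (u : B1) : d (shift s u) = shift s (d u) :=
  eq_of_eq_of (f := fun u => d (shift s u)) (g := fun u => shift s (d u)) (by fun_prop)
    (by fun_prop) (fun x => by simp only [d_of, shift_of, B0.d_shift]) u
theorem eul_thetaOp (u : B1) : eul (thetaOp u) = thetaOp (eul u) :=
  eq_of_eq_of (f := fun u => eul (thetaOp u)) (g := fun u => thetaOp (eul u)) (by fun_prop)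
    (by fun_prop) (fun x => by simp only [eul_of, thetaOp_of, B0.eul_thetaOp]) u
theorem thetaOp_eps (l : ℕ+) (u : B1) :
    thetaOp (eps l u) = of (B0.theta l) * kap u - eps l (thetaOp u) :=
  eq_of_eq_of (f := fun u => thetaOp (eps l u))
    (g := fun u => of (B0.theta l) * kap u - eps l (thetaOp u)) (by fun_prop)
    (by fun_prop)
    (fun x => by simp only [eps_of, thetaOp_of, kap_of, B0.thetaOp_eps, map_sub, map_mul]) u
theorem shift_eps (s : ℕ) (l : ℕ+) (u : B1) : shift s (eps l u) = eps l (shift s u) :=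
  eq_of_eq_of (f := fun u => shift s (eps l u)) (g := fun u => eps l (shift s u)) (by fun_prop)
    (by fun_prop) (fun x => by simp only [shift_of, eps_of, B0.shift_eps]) u
theorem shift_kap (s : ℕ) (u : B1) : shift s (kap u) = kap (shift s u) :=
  eq_of_eq_of (f := fun u => shift s (kap u)) (g := fun u => kap (shift s u)) (by fun_prop)
    (by fun_prop) (fun x => by simp only [shift_of, kap_of, B0.shift_kap]) u
theorem shift_eul (s : ℕ) (u : B1) : shift s (eul u) = eul (shift s u) :=
  eq_of_eq_of (f := fun u => shift s (eul u)) (g := fun u => eul (shift s u)) (by fun_prop)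
    (by fun_prop) (fun x => by simp only [shift_of, eul_of, B0.shift_eul]) u
theorem shift_thetaOp (s : ℕ) (u : B1) : shift s (thetaOp u) = thetaOp (shift s u) :=
  eq_of_eq_of (f := fun u => shift s (thetaOp u)) (g := fun u => thetaOp (shift s u))
    (by fun_prop) (by fun_prop) (fun x => by simp only [shift_of, thetaOp_of, B0.shift_thetaOp]) u
theorem shift_succ_shift_zero (s : ℕ) (u : B1) :
    shift (s + 1) (shift 0 u) = shift 0 (shift s u) :=
  eq_of_eq_of (f := fun u => shift (s + 1) (shift 0 u)) (g := fun u => shift 0 (shift s u))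
    (by fun_prop) (by fun_prop)
    (fun x => by simp only [shift_of, B0.shift_succ_shift_zero]) u
theorem pi0_d (u : B1) : pi0 (d u) = 0 :=
  eq_of_eq_of (f := fun u => pi0 (d u)) (g := fun _ => 0) (by fun_prop)
    (by fun_prop) (fun x => by simp only [d_of, pi0_of, B0.pi0_d, map_zero]) u
theorem pi0_shift (s : ℕ) (u : B1) : pi0 (shift s u) = pi0 u :=
  eq_of_eq_of (f := fun u => pi0 (shift s u)) (g := fun u => pi0 u) (by fun_prop)
    (by fun_prop) (fun x => by simp only [shift_of, pi0_of, B0.pi0_shift]) u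
theorem pi0_thetaOp (u : B1) : pi0 (thetaOp u) = thetaOp (pi0 u) :=
  eq_of_eq_of (f := fun u => pi0 (thetaOp u)) (g := fun u => thetaOp (pi0 u)) (by fun_prop)
    (by fun_prop) (fun x => by simp only [thetaOp_of, pi0_of, B0.pi0_thetaOp]) u

theorem d_of_mul (x : B0) (u : B1) :
    d (of x * u) = of (B0.d x) * u + of (B0.sgn x) * d u :=
  eq_of_eq_of (f := fun u => d (of x * u))
    (g := fun u => of (B0.d x) * u + of (B0.sgn x) * d u) (by fun_prop) (by fun_prop)
    (fun y => by simp only [← map_mul, d_of, B0.d_mul, map_add]) u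
theorem eps_of_mul (l : ℕ+) (x : B0) (u : B1) :
    eps l (of x * u) = of (B0.eps l x) * u + of x * eps l u :=
  eq_of_eq_of (f := fun u => eps l (of x * u))
    (g := fun u => of (B0.eps l x) * u + of x * eps l u) (by fun_prop) (by fun_prop)
    (fun y => by simp only [← map_mul, eps_of, B0.isDer_eps l _ _, map_add]) u
theorem kap_of_mul (x : B0) (u : B1) :
    kap (of x * u) = of (B0.kap x) * u + of x * kap u :=
  eq_of_eq_of (f := fun u => kap (of x * u))
    (g := fun u => of (B0.kap x) * u + of x * kap u) (by fun_prop) (by fun_prop)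
    (fun y => by simp only [← map_mul, kap_of, B0.isDer_kap _ _, map_add]) u
theorem eul_of_mul (x : B0) (u : B1) :
    eul (of x * u) = of (B0.eul x) * u + of x * eul u :=
  eq_of_eq_of (f := fun u => eul (of x * u))
    (g := fun u => of (B0.eul x) * u + of x * eul u) (by fun_prop) (by fun_prop)
    (fun y => by simp only [← map_mul, eul_of, B0.isDer_eul _ _, map_add]) u
theorem thetaOp_of_mul (x : B0) (u : B1) :
    thetaOp (of x * u) = of (B0.thetaOp x) * u + of x * thetaOp u :=
  eq_of_eq_of (f := fun u => thetaOp (of x * u))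
    (g := fun u => of (B0.thetaOp x) * u + of x * thetaOp u) (by fun_prop) (by fun_prop)
    (fun y => by simp only [← map_mul, thetaOp_of, B0.thetaOp_mul, map_add]) u

/-- A solution of `𝓔 w = v w` with vanishing weight-zero part vanishes, if `v` lies in the closure
of `ℐ`. -/
theorem eq_zero_of_eul_eq {v w : B1} (hv : ∀ n, ∃ z ∈ B0.idealI, proj n (of z) = proj n v)
    (hw : eul w = v * w) (h0 : pi0 w = 0) : w = 0 := by
  refine ext fun n => ?_
  obtain ⟨x, hx⟩ := exists_proj_eq (n + 1) w
  obtain ⟨z, hz, hzv⟩ := hv n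
  have hx' := proj_eq_of_le (Nat.le_succ n) hx
  have h1 : B0.eul x - z * x ∈ B0.filt n := by
    refine (Ideal.Quotient.eq).1 ?_
    change proj n (of (B0.eul x)) = proj n (of (z * x))
    rw [map_mul, map_mul, hzv, hx', ← map_mul, ← hw, ← eul_of, eul, proj_extend, proj_extend, hx]
  have h2 : B0.pi0 x ∈ B0.filt n := by
    refine Ideal.Quotient.eq_zero_iff_mem.1 ?_
    change proj n (of (B0.pi0 x)) = 0
    rw [← pi0_of, pi0, proj_extend, hx, ← proj_extend]
    exact (congrArg (proj n) h0).trans (map_zero _)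
  -- if a representative of `w` lies in `ℐ^m`, then its image under the Euler operator, being a
  -- representative of `v w`, lies in `ℐ^(m+1)`, hence so does the representative
  have key : ∀ m, x ∈ B0.idealI ^ m ⊔ B0.filt n := by
    intro m
    induction m with
    | zero => simp [Submodule.pow_zero, Ideal.one_eq_top]
    | succ m ih =>
      refine B0.mem_of_eul_mem
        (K := (B0.idealI ^ (m + 1) ⊔ B0.filt n).restrictScalars ThetaPoly) ?_ (n := n) ?_ ?_ ?_
      · intro y hy
        obtain ⟨a, ha, b, hb, rfl⟩ := Submodule.mem_sup.1 hy
        rw [map_add]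
        exact Submodule.add_mem_sup (B0.isDer_eul.idealI_pow_mem (B0.eul_gens 0) _ ha)
          (B0.eul_filt hb)
      · intro y hy
        exact Submodule.mem_sup_right (Submodule.mem_sup_left hy)
      · rw [← sub_add_cancel (B0.eul x) (z * x)]
        refine add_mem (Submodule.mem_sup_right h1) ?_
        obtain ⟨a, ha, b, hb, rfl⟩ := Submodule.mem_sup.1 ih
        rw [mul_add]
        refine Submodule.add_mem_sup ?_ (Ideal.mul_mem_left _ _ hb)
        rw [Ideal.IsTwoSided.pow_succ]
        exact Ideal.mul_mem_mul hz ha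
      · exact Submodule.mem_sup_right h2
  have hmem : x ∈ B0.filt n := sup_le (le_sup_left : B0.idealI ^ n ≤ B0.filt n) le_rfl (key n)
  rw [← hx', map_zero]
  exact Ideal.Quotient.eq_zero_iff_mem.2 hmem

/-! ### Infinite sums of operators -/

theorem hasSum_of_eq {ι : Type*} {f g : ι → B1} {y : B1} (h : ∀ i, f i = g i) (hg : HasSum g y) :
    HasSum f y := (funext h : f = g) ▸ hg

/-- `∑_l θ_l z_l` for a family `z` in `B₀`. -/
def thetaSum (z : ℕ+ → B0) : B1 := ∑' l : ℕ+, of (B0.theta l * z l)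

theorem hasSum_thetaSum (z : ℕ+ → B0) :
    HasSum (fun l : ℕ+ => of (B0.theta l * z l)) (thetaSum z) :=
  (summable_of_finite (finite_theta _)).hasSum

theorem thetaSum_zeta : thetaSum (B0.zeta 0) = thetaZeta := rfl
theorem thetaSum_h : thetaSum (B0.h 1) = thetaH := rfl

/-- How an operator acts on products with the infinite sum `∑_l θ_l z_l`, given its action on
products with the terms. -/
theorem map_thetaSum_mul {F : B1 →ₗ[ThetaPoly] B1} (hF : Continuous (fun u => F u))
    {z z' : ℕ+ → B0} {u v w : B1}
    (h : ∀ l, F (of (B0.theta l * z l) * u) =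
      of (B0.theta l * z' l) * v + of (B0.theta l * z l) * w) :
    F (thetaSum z * u) = thetaSum z' * v + thetaSum z * w := by
  have h1 := ((hasSum_thetaSum z).mul_right u).map F hF
  have h2 := ((hasSum_thetaSum z').mul_right v).add ((hasSum_thetaSum z).mul_right w)
  exact h1.unique (hasSum_of_eq h h2)

theorem thetaSum_add (z z' : ℕ+ → B0) :
    thetaSum (fun l => z l + z' l) = thetaSum z + thetaSum z' := by
  refine (hasSum_thetaSum _).unique ?_
  simp only [mul_add, map_add]
  exact (hasSum_thetaSum z).add (hasSum_thetaSum z')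

theorem thetaSum_sub (z z' : ℕ+ → B0) :
    thetaSum (fun l => z l - z' l) = thetaSum z - thetaSum z' := by
  refine (hasSum_thetaSum _).unique ?_
  simp only [mul_sub, map_sub]
  exact (hasSum_thetaSum z).sub (hasSum_thetaSum z')

theorem thetaSum_zero : thetaSum (fun _ => 0) = 0 := by
  rw [thetaSum]; simp

/-- `∑_l θ_l z_l` is congruent to an element of `ℐ` modulo every `ℐ^n + 𝒥_n`. -/
theorem thetaSum_mem (z : ℕ+ → B0) (n : ℕ) :
    ∃ x ∈ B0.idealI, proj n (of x) = proj n (thetaSum z) := by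
  obtain ⟨s, hs⟩ := (tendsto_iff.1 (hasSum_thetaSum z) n).exists
  refine ⟨∑ l ∈ s, B0.theta l * z l, sum_mem fun i _ =>
    Ideal.mul_mem_right _ _ (B0.theta_mem (Nat.zero_le _)), ?_⟩
  rw [map_sum, ← hs]

theorem thetaH_comm (u : B1) : thetaH * u = u * thetaH := by
  refine ((hasSum_thetaSum (B0.h 1)).mul_right u).unique
    (hasSum_of_eq (fun l => ?_) ((hasSum_thetaSum (B0.h 1)).mul_left u))
  rw [B0.theta, B0.h, ← map_mul B0.ofAbar, of_comm_of_ofAbar]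

/-- The terms of the operator `∑_l z_l (e_l ∧ ·)` tend to zero. -/
theorem summable_wedge {z : ℕ+ → B0} (hz : ∀ l : ℕ+, z l ∈ B0.idealJ l) (f : ℕ+ → B1) :
    Summable (fun l => of (z l) * f l) := by
  refine summable_of_finite fun n => (Set.finite_Iio (⟨n + 1, n.succ_pos⟩ : ℕ+)).subset ?_
  intro l hl
  by_contra hlt
  refine hl ?_
  have hn : n + 1 ≤ (l : ℕ) := not_lt.1 hlt
  rw [map_mul, show proj n (of (z l)) = 0 from Ideal.Quotient.eq_zero_iff_mem.2
    (Submodule.mem_sup_right (B0.idealJ_anti (Nat.le_of_succ_le hn) (hz l))), zero_mul]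

/-- The operator `u ↦ ∑_l z_l (e_l ∧ u)` on `B₁`, for a family `z` in `B₀` tending to zero. -/
def wedge (z : ℕ+ → B0) (u : B1) : B1 := ∑' l, of (z l) * eps l u

theorem zeta_mem_idealJ (k : ℕ) (l : ℕ+) : B0.zeta k l ∈ B0.idealJ l :=
  B0.zeta_mem (Nat.le_add_left _ _)
theorem h_mem_idealJ (k l : ℕ+) : B0.h k l ∈ B0.idealJ l := B0.h_mem (Nat.le_add_left _ _)

theorem hasSum_wedge {z : ℕ+ → B0} (hz : ∀ l : ℕ+, z l ∈ B0.idealJ l) (u : B1) :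
    HasSum (fun l => of (z l) * eps l u) (wedge z u) := (summable_wedge hz _).hasSum

theorem map_wedge {F : B1 →ₗ[ThetaPoly] B1} (hF : Continuous (fun u => F u)) {z : ℕ+ → B0}
    (hz : ∀ l : ℕ+, z l ∈ B0.idealJ l) {u y : B1} {g : ℕ+ → B1}
    (h : ∀ l, F (of (z l) * eps l u) = g l) (hg : HasSum g y) : F (wedge z u) = y := by
  refine ((hasSum_wedge hz u).map F hF).unique ?_
  convert hg using 1
  exact funext h

theorem wedge_add {z : ℕ+ → B0} (hz : ∀ l : ℕ+, z l ∈ B0.idealJ l) (u v : B1) :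
    wedge z (u + v) = wedge z u + wedge z v := by
  refine (hasSum_wedge hz _).unique ?_
  simp only [map_add, mul_add]
  exact (hasSum_wedge hz u).add (hasSum_wedge hz v)

theorem wedge_zero (z : ℕ+ → B0) : wedge z 0 = 0 := by
  rw [wedge]; simp

/-- `∑_l z_l (e_l ∧ ·)` as an additive map. -/
def wedgeHom (z : ℕ+ → B0) (hz : ∀ l : ℕ+, z l ∈ B0.idealJ l) : B1 →+ B1 where
  toFun := wedge z
  map_zero' := wedge_zero z
  map_add' := wedge_add hz

/-- `X_k = ∑_l ζ_{k,l} (e_l ∧ ·)`. -/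
def X (k : ℕ) : B1 →+ B1 := wedgeHom (B0.zeta k) (zeta_mem_idealJ k)

/-- `Y_k = ∑_l h_{k,l} (e_l ∧ ·)`. -/
def Y (k : ℕ+) : B1 →+ B1 := wedgeHom (B0.h k) (h_mem_idealJ k)

theorem hasSum_X (k : ℕ) (u : B1) : HasSum (fun l => of (B0.zeta k l) * eps l u) (X k u) :=
  hasSum_wedge (zeta_mem_idealJ k) u
theorem hasSum_Y (k : ℕ+) (u : B1) : HasSum (fun l => of (B0.h k l) * eps l u) (Y k u) :=
  hasSum_wedge (h_mem_idealJ k) u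

theorem map_X {F : B1 →ₗ[ThetaPoly] B1} (hF : Continuous (fun u => F u)) {k : ℕ}
    {u y : B1} {g : ℕ+ → B1}
    (h : ∀ l, F (of (B0.zeta k l) * eps l u) = g l) (hg : HasSum g y) : F (X k u) = y :=
  map_wedge hF (zeta_mem_idealJ k) h hg

theorem map_Y {F : B1 →ₗ[ThetaPoly] B1} (hF : Continuous (fun u => F u)) {k : ℕ+}
    {u y : B1} {g : ℕ+ → B1}
    (h : ∀ l, F (of (B0.h k l) * eps l u) = g l) (hg : HasSum g y) : F (Y k u) = y :=
  map_wedge hF (h_mem_idealJ k) h hg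

/-! ### The exponential -/

theorem map_thetaH_pow_mul {F : B1 →ₗ[ThetaPoly] B1} {v : B1}
    (h : ∀ u, F (thetaH * u) = v * u + thetaH * F u) (n : ℕ) (u : B1) :
    F (thetaH ^ n * u) = n • (thetaH ^ (n - 1) * (v * u)) + thetaH ^ n * F u := by
  induction n with
  | zero => simp
  | succ n ih =>
    rw [pow_succ', mul_assoc, h, ih, mul_add, mul_smul_comm, ← mul_assoc thetaH, ← mul_assoc thetaH,
      ← pow_succ', ← add_assoc, Nat.add_sub_cancel, succ_nsmul, ← mul_assoc v,
      ← mul_assoc _ v u, ← mul_assoc _ v u, (Commute.pow_left (thetaH_comm v) n).eq]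
    congr 1
    rcases n with _ | n
    · simp
    · rw [Nat.add_sub_cancel, add_comm, (Commute.pow_left (thetaH_comm v) _).eq]

/-- An operator with `F(ηu) = vu + ηF(u)` for `η = ∑_l θ_l h_{1,l}` satisfies
`F(exp(η)u) = exp(η)vu + exp(η)F(u)`. -/
theorem map_expThetaH_mul {F : B1 →ₗ[ThetaPoly] B1} (hF : Continuous (fun u => F u)) {v : B1}
    (h : ∀ u, F (thetaH * u) = v * u + thetaH * F u) (u : B1) :
    F (expThetaH * u) = expThetaH * (v * u) + expThetaH * F u := by
  have h1 := (hasSum_expThetaH.mul_right u).map F hF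
  have h2 := hasSum_expThetaH.mul_right (F u)
  have h3 : HasSum (fun n : ℕ => (MvPolynomial.C ((n.factorial : ℚ)⁻¹) : ThetaPoly) •
      (n • (thetaH ^ (n - 1) * (v * u)))) (expThetaH * (v * u)) := by
    refine (hasSum_nat_add_iff' 1).1 ?_
    rw [Finset.sum_range_one, zero_smul, smul_zero, sub_zero]
    refine hasSum_of_eq (fun n => ?_) (hasSum_expThetaH.mul_right (v * u))
    rw [Nat.add_sub_cancel, ← Nat.cast_smul_eq_nsmul ThetaPoly, smul_smul, smul_mul_assoc,
      ← map_natCast (MvPolynomial.C (σ := ℕ+) (R := ℚ)), ← map_mul, Nat.factorial_succ]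
    congr 2
    push_cast
    field_simp
  refine h1.unique (hasSum_of_eq (fun n => ?_) (h3.add h2))
  simp only [Function.comp_apply, smul_mul_assoc, map_smul]
  rw [map_thetaH_pow_mul h, smul_add]

theorem expThetaH_comm (u : B1) : expThetaH * u = u * expThetaH := by
  refine (hasSum_expThetaH.mul_right u).unique ?_
  convert hasSum_expThetaH.mul_left u using 1
  refine funext fun n => ?_
  rw [smul_mul_assoc, mul_smul_comm, (Commute.pow_left (thetaH_comm u) n).eq]

theorem of_theta_mul_eq_smul (l : ℕ+) (x : B0) : of (B0.theta l * x) =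
    (MvPolynomial.X l : ThetaPoly) • of x := by
  rw [B0.theta_mul_eq, map_smul]

theorem of_theta_mul_mul (l : ℕ+) (x : B0) (u : B1) : of (B0.theta l * x) * u =
    (MvPolynomial.X l : ThetaPoly) • (of x * u) := by
  rw [of_theta_mul_eq_smul, smul_mul_assoc]

theorem eps_thetaH_mul (l : ℕ+) (u : B1) : eps l (thetaH * u) = thetaH * eps l u := by
  have := map_thetaSum_mul (F := eps l) (by fun_prop) (z := B0.h 1) (z' := fun _ => 0)
    (u := u) (v := u) (w := eps l u) (fun i => by
      rw [of_theta_mul_mul, of_theta_mul_mul, of_theta_mul_mul, map_smul, eps_of_mul, B0.eps_h, map_zero,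
        zero_mul, smul_zero, zero_add, zero_add])
  rwa [thetaSum_zero, zero_mul, zero_add] at this

theorem kap_thetaH_mul (u : B1) : kap (thetaH * u) = thetaH * kap u := by
  have := map_thetaSum_mul (F := kap) (by fun_prop) (z := B0.h 1) (z' := fun _ => 0)
    (u := u) (v := u) (w := kap u) (fun i => by
      rw [of_theta_mul_mul, of_theta_mul_mul, of_theta_mul_mul, map_smul, kap_of_mul, B0.kap_h, map_zero,
        zero_mul, smul_zero, zero_add, zero_add])
  rwa [thetaSum_zero, zero_mul, zero_add] at this

theorem thetaOp_thetaH_mul (u : B1) : thetaOp (thetaH * u) = thetaH * thetaOp u := by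
  have := map_thetaSum_mul (F := thetaOp) (by fun_prop) (z := B0.h 1) (z' := fun _ => 0)
    (u := u) (v := u) (w := thetaOp u) (fun i => by
      rw [of_theta_mul_mul, of_theta_mul_mul, of_theta_mul_mul, map_smul, thetaOp_of_mul, B0.thetaOp_h,
        map_zero, zero_mul, smul_zero, zero_add, zero_add])
  rwa [thetaSum_zero, zero_mul, zero_add] at this

theorem eul_thetaH_mul (u : B1) : eul (thetaH * u) = thetaH * u + thetaH * eul u :=
  map_thetaSum_mul (F := eul) (by fun_prop) (z := B0.h 1) (z' := B0.h 1) (fun i => by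
      rw [of_theta_mul_mul, of_theta_mul_mul, map_smul, eul_of_mul, B0.eul_h, smul_add])

theorem d_thetaH_mul (u : B1) :
    d (thetaH * u) = (thetaSum (B0.zeta 1) - thetaZeta) * u + thetaH * d u := by
  rw [← thetaSum_zeta, ← thetaSum_sub]
  refine map_thetaSum_mul (F := d) (by fun_prop) (z := B0.h 1)
    (z' := fun l => B0.zeta 1 l - B0.zeta 0 l) (fun i => ?_)
  rw [of_theta_mul_mul, of_theta_mul_mul, of_theta_mul_mul, map_smul, d_of_mul, B0.d_h, smul_add, B0.h,
    B0.sgn_ofAbar]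
  rfl

theorem eps_exp_mul (l : ℕ+) (u : B1) : eps l (expThetaH * u) = expThetaH * eps l u := by
  have := map_expThetaH_mul (F := eps l) (by fun_prop) (v := 0)
    (fun u => by rw [eps_thetaH_mul, zero_mul, zero_add]) u
  rwa [zero_mul, mul_zero, zero_add] at this

theorem kap_exp_mul (u : B1) : kap (expThetaH * u) = expThetaH * kap u := by
  have := map_expThetaH_mul (F := kap) (by fun_prop) (v := 0)
    (fun u => by rw [kap_thetaH_mul, zero_mul, zero_add]) u
  rwa [zero_mul, mul_zero, zero_add] at this

theorem thetaOp_exp_mul (u : B1) : thetaOp (expThetaH * u) = expThetaH * thetaOp u := by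
  have := map_expThetaH_mul (F := thetaOp) (by fun_prop) (v := 0)
    (fun u => by rw [thetaOp_thetaH_mul, zero_mul, zero_add]) u
  rwa [zero_mul, mul_zero, zero_add] at this

theorem eul_exp_mul (u : B1) :
    eul (expThetaH * u) = thetaH * (expThetaH * u) + expThetaH * eul u := by
  rw [map_expThetaH_mul (F := eul) (by fun_prop) (fun u => by rw [eul_thetaH_mul]) u,
    ← mul_assoc, expThetaH_comm, mul_assoc]

theorem d_exp_mul (u : B1) : d (expThetaH * u) =
    expThetaH * ((thetaSum (B0.zeta 1) - thetaZeta) * u) + expThetaH * d u :=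
  map_expThetaH_mul (F := d) (by fun_prop) d_thetaH_mul u

theorem eul_exp : eul expThetaH = thetaH * expThetaH := by
  have := eul_exp_mul 1
  rwa [eul_one, mul_zero, add_zero, mul_one] at this

theorem shift_thetaSum (s : ℕ) (z : ℕ+ → B0) :
    shift s (thetaSum z) = thetaSum (fun l => B0.shift s (z l)) := by
  have := map_thetaSum_mul (F := shift s) (by fun_prop) (z := z)
    (z' := fun l => B0.shift s (z l)) (u := 1) (v := 1) (w := 0) (fun i => by
      rw [mul_one, mul_one, mul_zero, add_zero, shift_of, B0.shift_mul, B0.shift_theta])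
  rwa [mul_one, mul_one, mul_zero, add_zero] at this

theorem shift_thetaH_zero : shift 0 thetaH = thetaSum (B0.h 2) := by
  rw [← thetaSum_h, shift_thetaSum]
  congr 1
  refine funext fun l => ?_
  rw [B0.shift_h, if_neg (Nat.not_lt_zero _), if_neg (by decide)]
  rfl

theorem shift_thetaH_one : shift 1 thetaH = thetaH + thetaSum (B0.h 2) := by
  rw [← thetaSum_h, shift_thetaSum, ← thetaSum_add]
  congr 1
  refine funext fun l => ?_
  rw [B0.shift_h, if_neg (by decide), if_pos (by decide)]
  rfl

theorem shift_thetaH_add_two (s : ℕ) : shift (s + 2) thetaH = thetaH := by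
  rw [← thetaSum_h, shift_thetaSum]
  congr 1
  refine funext fun l => ?_
  rw [B0.shift_h, if_pos]
  rw [PNat.one_coe]
  omega

theorem pi0_thetaH : pi0 thetaH = 0 := by
  rw [← thetaSum_h]
  refine ((hasSum_thetaSum (B0.h 1)).map pi0 continuous_pi0).unique ?_
  convert hasSum_zero using 1
  refine funext fun l => ?_
  rw [Function.comp_apply, pi0_of, B0.pi0_mul, B0.pi0_h, mul_zero, map_zero]

theorem pi0_exp : pi0 expThetaH = 1 := by
  refine (hasSum_expThetaH.map pi0 continuous_pi0).unique ?_
  have hp : ∀ n : ℕ, pi0 (thetaH ^ n) = (0 : B1) ^ n := by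
    intro n
    induction n with
    | zero => rw [pow_zero, pow_zero, pi0_one]
    | succ n ih => rw [pow_succ, pi0_mul, pi0_thetaH, mul_zero, pow_succ, mul_zero]
  convert hasSum_single 0 (fun n hn => ?_) using 1
  · simp [pi0_one]
  · rw [Function.comp_apply, map_smul, hp, zero_pow hn, smul_zero]

theorem shift_exp_add_two (s : ℕ) : shift (s + 2) expThetaH = expThetaH := by
  refine (hasSum_expThetaH.map (shift (s + 2)) (continuous_shift _)).unique ?_
  convert hasSum_expThetaH using 1
  refine funext fun n => ?_
  rw [Function.comp_apply, map_smul]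
  congr 1
  induction n with
  | zero => rw [pow_zero, shift_one]
  | succ n ih => rw [pow_succ, shift_mul, ih, shift_thetaH_add_two]

/-- `exp(∑_l θ_l (h_{1,l} + h_{2,l})) = exp(∑_l θ_l h_{1,l}) exp(∑_l θ_l h_{2,l})`. Both sides
solve the same Euler equation. -/
theorem shift_exp_one : shift 1 expThetaH = expThetaH * shift 0 expThetaH := by
  rw [← sub_eq_zero]
  refine eq_zero_of_eul_eq (v := thetaSum fun l => B0.h 1 l + B0.h 2 l) (thetaSum_mem _) ?_ ?_
  · rw [map_sub, ← shift_eul, eul_exp, shift_mul, eul_exp_mul, ← shift_eul, eul_exp, shift_mul,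
      shift_thetaH_zero, shift_thetaH_one, thetaSum_add, ← thetaSum_h, mul_sub, add_mul, add_mul]
    rw [← mul_assoc expThetaH, expThetaH_comm (thetaSum _), mul_assoc]
  · rw [map_sub, pi0_mul, pi0_shift, pi0_shift, pi0_exp, mul_one, sub_self]

/-! ### The operators `δ_k` and the commutation relations -/

/-- `δ_0 = exp(∑_l θ_l h_{1,l}) Shift_0` and `δ_k = Shift_k` for `k > 0`, on `B₁`. -/
def delta : ℕ → B1 →ₗ[ThetaPoly] B1
  | 0 => LinearMap.mulLeft ThetaPoly expThetaH ∘ₗ shift 0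
  | k + 1 => shift (k + 1)

theorem delta_zero (u : B1) : delta 0 u = expThetaH * shift 0 u := rfl
theorem delta_succ (k : ℕ) (u : B1) : delta (k + 1) u = shift (k + 1) u := rfl

@[fun_prop] theorem continuous_delta (k : ℕ) : Continuous (fun u => delta k u) := by
  cases k with
  | zero => simp only [delta_zero]; fun_prop
  | succ k => simp only [delta_succ]; fun_prop

/-- The simplicial identity `δ_{k+1} δ_0 = δ_0 δ_k`; the case `k = 0` needs the functional equation of
the exponential. -/
theorem delta_succ_delta_zero (k : ℕ) (u : B1) : delta (k + 1) (delta 0 u) = delta 0 (delta k u) := by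
  rw [delta_succ, delta_zero, shift_mul, shift_succ_shift_zero, delta_zero]
  rcases k with _ | k
  · rw [shift_exp_one, delta_zero, shift_mul, mul_assoc]
  · rw [shift_exp_add_two, delta_succ]

theorem delta_thetaOp (k : ℕ) (u : B1) : delta k (thetaOp u) = thetaOp (delta k u) := by
  cases k with
  | zero => rw [delta_zero, delta_zero, thetaOp_exp_mul, shift_thetaOp]
  | succ k => exact shift_thetaOp _ u

theorem kap_delta (k : ℕ) (u : B1) : kap (delta k u) = delta k (kap u) := by
  cases k with
  | zero => rw [delta_zero, delta_zero, kap_exp_mul, shift_kap]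
  | succ k => exact (shift_kap _ u).symm

theorem eps_delta (k : ℕ) (l : ℕ+) (u : B1) : eps l (delta k u) = delta k (eps l u) := by
  cases k with
  | zero => rw [delta_zero, delta_zero, eps_exp_mul, shift_eps]
  | succ k => exact (shift_eps _ _ u).symm

theorem pi0_delta (k : ℕ) (u : B1) : pi0 (delta k u) = pi0 u := by
  cases k with
  | zero => rw [delta_zero, pi0_mul, pi0_exp, one_mul, pi0_shift]
  | succ k => exact pi0_shift _ u

theorem eul_delta_zero (u : B1) : eul (delta 0 u) = thetaH * delta 0 u + delta 0 (eul u) := by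
  rw [delta_zero, delta_zero, eul_exp_mul, shift_eul]

theorem eul_delta_succ (k : ℕ) (u : B1) : eul (delta (k + 1) u) = delta (k + 1) (eul u) :=
  (shift_eul _ u).symm

theorem delta_of_mul_zero (x : B0) (u : B1) : delta 0 (of x * u) = of (B0.shift 0 x) * delta 0 u := by
  rw [delta_zero, delta_zero, shift_mul, shift_of, ← mul_assoc, expThetaH_comm, mul_assoc]

theorem delta_of_mul_succ (k : ℕ) (x : B0) (u : B1) :
    delta (k + 1) (of x * u) = of (B0.shift (k + 1) x) * delta (k + 1) u := by
  rw [delta_succ, delta_succ, shift_mul, shift_of]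

theorem delta_zero_X (k : ℕ) (u : B1) : delta 0 (X k u) = X (k + 1) (delta 0 u) := by
  refine map_X (continuous_delta 0) (fun l => ?_) (hasSum_X (k + 1) _)
  rw [delta_of_mul_zero, eps_delta, B0.shift_zeta, if_neg (Nat.not_lt_zero _)]

theorem delta_succ_X (k : ℕ) (u : B1) : delta (k + 1) (X 0 u) = X 0 (delta (k + 1) u) := by
  refine map_X (continuous_delta _) (fun l => ?_) (hasSum_X 0 _)
  rw [delta_of_mul_succ, eps_delta, B0.shift_zeta, if_pos (Nat.succ_pos _)]

theorem delta_zero_Y (u : B1) : delta 0 (Y 1 u) = Y 2 (delta 0 u) := by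
  refine map_Y (continuous_delta 0) (fun l => ?_) (hasSum_Y 2 _)
  rw [delta_of_mul_zero, eps_delta, B0.shift_h, if_neg (Nat.not_lt_zero _), if_neg (by decide)]
  rfl

theorem delta_one_Y (u : B1) : delta 1 (Y 1 u) = Y 1 (delta 1 u) + Y 2 (delta 1 u) := by
  refine map_Y (continuous_delta 1) (fun l => ?_) ((hasSum_Y 1 _).add (hasSum_Y 2 _))
  rw [delta_of_mul_succ, eps_delta, B0.shift_h, if_neg (by decide), if_pos (by decide), map_add,
    add_mul]
  rfl

theorem delta_add_two_Y (k : ℕ) (u : B1) : delta (k + 2) (Y 1 u) = Y 1 (delta (k + 2) u) := by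
  refine map_Y (continuous_delta _) (fun l => ?_) (hasSum_Y 1 _)
  rw [delta_of_mul_succ, eps_delta, B0.shift_h, if_pos (by rw [PNat.one_coe]; omega)]

theorem shift_thetaZeta_zero : shift 0 thetaZeta = thetaSum (B0.zeta 1) := by
  rw [← thetaSum_zeta, shift_thetaSum]
  congr 1
  refine funext fun l => ?_
  rw [B0.shift_zeta, if_neg (Nat.not_lt_zero _)]

theorem shift_thetaZeta_succ (k : ℕ) : shift (k + 1) thetaZeta = thetaZeta := by
  rw [← thetaSum_zeta, shift_thetaSum]
  congr 1
  refine funext fun l => ?_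
  rw [B0.shift_zeta, if_pos (Nat.succ_pos k)]

/-- The operators `δ_k` are horizontal. For `k = 0` the derivative of the exponential accounts for the
difference between `∑ θ_l ζ_{1,l}` and `∑ θ_l ζ_{0,l}`. -/
theorem nabla_delta (k : ℕ) (u : B1) : nabla (delta k u) = delta k (nabla u) := by
  cases k with
  | zero =>
    rw [nabla_eq, nabla_eq, map_add, delta_zero, delta_zero, delta_zero, d_exp_mul, d_shift,
      shift_mul, shift_thetaZeta_zero, ← mul_assoc thetaZeta, ← expThetaH_comm thetaZeta, mul_assoc,
      sub_mul, mul_sub]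
    abel
  | succ k =>
    rw [nabla_eq, nabla_eq, map_add, delta_succ, delta_succ, delta_succ, d_shift, shift_mul,
      shift_thetaZeta_succ]

theorem eul_thetaZeta_mul (u : B1) : eul (thetaZeta * u) = thetaZeta * u + thetaZeta * eul u :=
  map_thetaSum_mul (F := eul) (by fun_prop) (z := B0.zeta 0) (z' := B0.zeta 0) (fun i => by
      rw [of_theta_mul_mul, of_theta_mul_mul, map_smul, eul_of_mul, B0.eul_zeta, smul_add])

theorem eps_thetaZeta_mul (l : ℕ+) (u : B1) : eps l (thetaZeta * u) = thetaZeta * eps l u := by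
  have := map_thetaSum_mul (F := eps l) (by fun_prop) (z := B0.zeta 0) (z' := fun _ => 0)
    (u := u) (v := u) (w := eps l u) (fun i => by
      rw [of_theta_mul_mul, of_theta_mul_mul, of_theta_mul_mul, map_smul, eps_of_mul, B0.eps_zeta, map_zero,
        zero_mul, smul_zero, zero_add, zero_add])
  rwa [thetaSum_zero, zero_mul, zero_add] at this

theorem eul_nabla (u : B1) : eul (nabla u) = nabla (eul u) + thetaZeta * u := by
  rw [nabla_eq, nabla_eq, map_add, eul_thetaZeta_mul, d_eul]
  abel

theorem nabla_eps (l : ℕ+) (u : B1) : nabla (eps l u) = eps l (nabla u) := by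
  rw [nabla_eq, nabla_eq, map_add, d_eps, eps_thetaZeta_mul]

theorem thetaZeta_mul_of (x : B0) (u : B1) :
    thetaZeta * (of x * u) = of (B0.sgn x) * (thetaZeta * u) := by
  refine ((hasSum_thetaSum (B0.zeta 0)).mul_right (of x * u)).unique (hasSum_of_eq (fun l => ?_)
    (((hasSum_thetaSum (B0.zeta 0)).mul_right u).mul_left (of (B0.sgn x))))
  rw [of_theta_mul_mul, of_theta_mul_mul, mul_smul_comm, ← mul_assoc, ← mul_assoc, ← map_mul, ← map_mul,
    B0.zeta, B0.ι_mul]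

theorem nabla_of_mul (x : B0) (u : B1) :
    nabla (of x * u) = of (B0.d x) * u + of (B0.sgn x) * nabla u := by
  rw [nabla_eq, nabla_eq, d_of_mul, thetaZeta_mul_of, mul_add, add_assoc]

@[fun_prop] theorem continuous_nabla : Continuous (fun u => nabla u) := by
  simp only [nabla_eq]
  fun_prop

theorem nabla_X (k : ℕ) (u : B1) : nabla (X k u) = -X k (nabla u) := by
  refine map_X continuous_nabla (fun l => ?_) (hasSum_X k (nabla u)).neg
  rw [nabla_of_mul, B0.d_zeta, B0.sgn_zeta, map_zero, zero_mul, zero_add, nabla_eps, map_neg,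
    neg_mul]

theorem nabla_Y (u : B1) : nabla (Y 1 u) = X 1 u - X 0 u + Y 1 (nabla u) := by
  refine map_Y continuous_nabla (fun l => ?_)
    (((hasSum_X 1 u).sub (hasSum_X 0 u)).add (hasSum_Y 1 (nabla u)))
  rw [nabla_of_mul, B0.d_h, B0.h, B0.sgn_ofAbar, nabla_eps, map_sub, sub_mul]
  rfl

theorem of_theta_mul (l : ℕ+) (x : B0) (u : B1) :
    of x * (of (B0.theta l) * u) = of (B0.theta l * x) * u := by
  rw [← mul_assoc, ← map_mul, B0.theta, ← B0.ofAbar_comm]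

theorem thetaOp_X (u : B1) : thetaOp (X 0 u) = thetaZeta * kap u - X 0 (thetaOp u) := by
  refine map_X continuous_thetaOp (fun l => ?_)
    (((hasSum_thetaSum (B0.zeta 0)).mul_right (kap u)).sub (hasSum_X 0 (thetaOp u)))
  rw [thetaOp_of_mul, B0.thetaOp_zeta, map_zero, zero_mul, zero_add, thetaOp_eps, mul_sub,
    of_theta_mul]

theorem thetaOp_Y (u : B1) : thetaOp (Y 1 u) = thetaH * kap u - Y 1 (thetaOp u) := by
  refine map_Y continuous_thetaOp (fun l => ?_)
    (((hasSum_thetaSum (B0.h 1)).mul_right (kap u)).sub (hasSum_Y 1 (thetaOp u)))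
  rw [thetaOp_of_mul, B0.thetaOp_h, map_zero, zero_mul, zero_add, thetaOp_eps, mul_sub,
    of_theta_mul]

theorem pi0_thetaZeta_mul (u : B1) : pi0 (thetaZeta * u) = 0 := by
  have := map_thetaSum_mul (F := pi0) (by fun_prop) (z := B0.zeta 0)
    (z' := fun _ => 0) (u := u) (v := 1) (w := 0) (fun i => by
      rw [pi0_mul, pi0_of, B0.pi0_mul, B0.pi0_zeta, mul_zero, mul_zero, map_zero, zero_mul,
        zero_mul, mul_zero, add_zero])
  rwa [thetaSum_zero, zero_mul, mul_zero, add_zero] at this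

theorem pi0_nabla (u : B1) : pi0 (nabla u) = 0 := by
  rw [nabla_eq, map_add, pi0_d, pi0_thetaZeta_mul, add_zero]

/-! ### From the Euler recursion to the differential equation -/

/-- `∑_{k=0}^n (-1)^k δ_k`. -/
def altDelta (n : ℕ) (u : B1) : B1 := ∑ k ∈ Finset.range (n + 1), (-1 : ℤ) ^ k • delta k u

theorem altDelta_zero (n : ℕ) : altDelta n 0 = 0 := by simp [altDelta]

theorem altDelta_add (n : ℕ) (u v : B1) : altDelta n (u + v) = altDelta n u + altDelta n v := by
  simp only [altDelta, map_add, smul_add, Finset.sum_add_distrib]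

theorem altDelta_zsmul (n : ℕ) (c : ℤ) (u : B1) : altDelta n (c • u) = c • altDelta n u := by
  simp only [altDelta, map_zsmul, Finset.smul_sum, smul_comm c]

theorem eul_altDelta (n : ℕ) (u : B1) :
    eul (altDelta n u) = thetaH * delta 0 u + altDelta n (eul u) := by
  simp only [altDelta, Finset.sum_range_succ', map_add, map_sum, map_zsmul, eul_delta_zero,
    eul_delta_succ, pow_zero, one_smul]
  abel

theorem altDelta_X (n : ℕ) (u : B1) :
    altDelta n (X 0 u) = X 1 (delta 0 u) - X 0 (delta 0 u) + X 0 (altDelta n u) := by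
  simp only [altDelta, Finset.sum_range_succ', map_add, map_sum, map_zsmul, delta_zero_X,
    delta_succ_X, pow_zero, one_smul]
  abel

/-- The alternating signs make the contributions of `Y_2` telescope. -/
theorem altDelta_succ_Y (n : ℕ) (u : B1) :
    altDelta (n + 1) (Y 1 (delta 0 u)) = -Y 1 (delta 0 (altDelta n u)) := by
  rw [altDelta, Finset.sum_range_succ', Finset.sum_range_succ', altDelta, Finset.sum_range_succ']
  simp only [zero_add, delta_zero_Y, delta_one_Y, delta_add_two_Y, pow_zero, one_smul,
    neg_smul, delta_succ_delta_zero, map_add, map_sum, map_zsmul, pow_succ, mul_neg, mul_one,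
    neg_neg, Finset.sum_neg_distrib, map_neg, neg_add]
  abel

/-- If `Φ` solves the Euler recursion `𝓔Φ(r,s) = X_0 Φ(r,s-1) + (-1)^s Y_1 δ_0 Φ(r-1,s)`, then the
defect `Ψ = DΦ` solves the same recursion up to sign; its weight-zero part vanishes, hence so does
`Ψ`. -/
theorem defect_eq_zero {Φ : ℤ → ℤ → B1}
    (hrec : ∀ r s, eul (Φ r s) =
      X 0 (Φ r (s - 1)) + (s.negOnePow : ℤ) • Y 1 (delta 0 (Φ (r - 1) s)))
    (hneg : ∀ r s, r < 0 ∨ s < 0 → Φ r s = 0) (hkap : ∀ r s, kap (Φ r s) = Φ r s)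
    (hpi : ∀ r s, r ≠ 0 ∨ s ≠ 0 → pi0 (Φ r s) = 0) (h00 : thetaOp (pi0 (Φ 0 0)) = 0)
    (n : ℕ) (s : ℤ) :
    nabla (Φ n (s - 1)) + (s.negOnePow : ℤ) • altDelta n (Φ (n - 1) s) - thetaOp (Φ n s) = 0 := by
  set Ψ : ℕ → ℤ → B1 := fun n s => nabla (Φ n (s - 1)) +
    (s.negOnePow : ℤ) • altDelta n (Φ (n - 1) s) - thetaOp (Φ n s) with hΨ
  change Ψ n s = 0
  have hsign : ∀ s : ℤ, ((s - 1).negOnePow : ℤ) = -(s.negOnePow : ℤ) := fun s => by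
    rw [Int.negOnePow_sub, Int.negOnePow_one]; simp
  have hsq : ∀ s : ℤ, (s.negOnePow : ℤ) * (s.negOnePow : ℤ) = 1 := fun s => by
    rw [← Units.val_mul, ← sq, Int.units_sq, Units.val_one]
  have hz : ∀ n s, s < 0 → Ψ n s = 0 := by
    intro n s hs
    simp only [hΨ]
    rw [hneg n (s - 1) (by omega), hneg _ s (by omega), hneg n s (by omega), altDelta_zero]
    simp
  -- the weight-zero part of the defect vanishes
  have hp : ∀ n s, pi0 (Ψ n s) = 0 := by
    intro n s
    have h1 : pi0 (altDelta n (Φ (n - 1) s)) = 0 := by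
      simp only [altDelta, map_sum, map_zsmul, pi0_delta]
      by_cases h : (n : ℤ) - 1 ≠ 0 ∨ s ≠ 0
      · rw [hpi _ _ h]; simp
      -- for `(r, s) = (1, 0)` the two summands `δ_0` and `-δ_1` cancel in weight zero
      · obtain rfl : n = 1 := by omega
        simp [Finset.sum_range_succ]
    have h2 : pi0 (thetaOp (Φ n s)) = 0 := by
      rw [pi0_thetaOp]
      by_cases h : (n : ℤ) ≠ 0 ∨ s ≠ 0
      · rw [hpi _ _ h, map_zero]
      · obtain ⟨rfl, rfl⟩ : n = 0 ∧ s = 0 := by omega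
        exact h00
    simp only [hΨ]
    rw [map_sub, map_add, map_zsmul, h1, h2, pi0_nabla, smul_zero, add_zero, sub_zero]
  have key : ∀ n s, eul (Ψ n s) = 0 → Ψ n s = 0 := fun n s h =>
    eq_zero_of_eul_eq (v := 0) (fun m => ⟨0, zero_mem _, by rw [map_zero]⟩)
      (by rw [h, zero_mul]) (hp n s)
  -- induction on `s`, starting from `s = -1` where everything vanishes
  have hstep : ∀ n, (∀ s, eul (Ψ n s) = -X 0 (Ψ n (s - 1))) → ∀ s, Ψ n s = 0 := by
    intro n h s
    have hk : ∀ k : ℕ, Ψ n ((k : ℤ) - 1) = 0 := by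
      intro k
      induction k with
      | zero => exact hz n _ (by simp)
      | succ k ih =>
        refine key _ _ ?_
        rw [h, show ((k + 1 : ℕ) : ℤ) - 1 - 1 = (k : ℤ) - 1 by push_cast; ring, ih, map_zero,
          neg_zero]
    rcases lt_or_ge s 0 with hs | hs
    · exact hz n s hs
    · have := hk (s + 1).toNat
      rwa [Int.toNat_of_nonneg (by omega), add_sub_cancel_right] at this
  induction n generalizing s with
  | zero =>
    refine hstep 0 (fun s => ?_) s
    have e0 : ∀ s, Φ (((0 : ℕ) : ℤ) - 1) s = 0 := fun s => hneg _ _ (by simp)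
    simp only [hΨ]
    rw [e0, e0, altDelta_zero, smul_zero, smul_zero, add_zero, add_zero, map_sub, eul_nabla,
      eul_thetaOp, hrec, hrec, e0, e0, map_zero, map_zero, smul_zero, smul_zero, add_zero, add_zero,
      nabla_X, thetaOp_X, hkap, map_sub]
    abel
  | succ n ih =>
    refine hstep (n + 1) (fun s => ?_) s
    have hE : eul (Ψ (n + 1) s) =
        -X 0 (Ψ (n + 1) (s - 1)) - (s.negOnePow : ℤ) • Y 1 (delta 0 (Ψ n s)) := by
      have e1 : ((n + 1 : ℕ) : ℤ) - 1 = n := by push_cast; ring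
      simp only [hΨ, e1]
      set N : ℤ := ((n + 1 : ℕ) : ℤ)
      have hN : N - 1 = n := e1
      have hr1 := hrec N (s - 1)
      have hr2 := hrec n s
      have hr3 := hrec N s
      rw [hsign, hN] at hr1
      rw [hN] at hr3
      rw [map_sub, map_add, map_zsmul, eul_nabla, eul_altDelta, eul_thetaOp, hr1, hr2, hr3]
      simp only [map_add, map_sub, map_neg, map_zsmul, altDelta_add, altDelta_zsmul, altDelta_X,
        altDelta_succ_Y, nabla_X, nabla_Y, thetaOp_X, thetaOp_Y, kap_delta, hkap, hsign,
        nabla_delta, ← delta_thetaOp, smul_add, smul_sub, smul_neg, neg_smul, smul_smul, hsq,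
        one_smul]
      abel
    rw [hE, ih, map_zero, map_zero, smul_zero, sub_zero]

end B1

/-! ### Exterior words in the `e_l` -/

/-- The sign of the permutation sorting an injective tuple is the parity of its inversions. -/
theorem sign_sort_eq_prod {α : Type*} [LinearOrder α] {n : ℕ} {f : Fin n → α}
    (hf : Function.Injective f) : Equiv.Perm.sign (Tuple.sort f) =
      ∏ i, ∏ j ∈ Finset.Ioi i, if f i < f j then 1 else -1 := by
  have hmono : StrictMono (f ∘ Tuple.sort f) :=
    (Tuple.monotone_sort f).strictMono_of_injective (hf.comp (Equiv.injective _))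
  rw [← Equiv.Perm.sign_inv, Equiv.Perm.sign_eq_prod_prod_Ioi]
  refine Finset.prod_congr rfl fun i _ => Finset.prod_congr rfl fun j _ => ?_
  have h : (Tuple.sort f)⁻¹ i < (Tuple.sort f)⁻¹ j ↔ f i < f j := by
    rw [← hmono.lt_iff_lt]
    simp
  simp only [h]

/-- Splitting off the pairs that involve `0` from a product over pairs `i < j`. -/
theorem prod_prod_Ioi_succ {M : Type*} [CommMonoid M] {n : ℕ} (g : Fin (n + 1) → Fin (n + 1) → M) :
    ∏ i, ∏ j ∈ Finset.Ioi i, g i j =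
      (∏ j : Fin n, g 0 j.succ) * ∏ i : Fin n, ∏ j ∈ Finset.Ioi i, g i.succ j.succ := by
  rw [Fin.prod_univ_succ, Fin.prod_Ioi_zero]
  simp only [Fin.prod_Ioi_succ]

/-- Prepending `a` to a sequence adds as many inversions as there are entries smaller than `a`. -/
theorem sign_sort_cons {a : ℕ+} {L : List ℕ+} (h : (a :: L).Nodup) :
    (Equiv.Perm.sign (Tuple.sort (a :: L).get) : ℤ) =
      (-1) ^ (L.toFinset.filter (· < a)).card * (Equiv.Perm.sign (Tuple.sort L.get) : ℤ) := by
  obtain ⟨ha, hL⟩ := List.nodup_cons.1 h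
  rw [sign_sort_eq_prod (List.nodup_iff_injective_get.1 h),
    sign_sort_eq_prod (List.nodup_iff_injective_get.1 hL)]
  refine (congrArg (fun u : ℤˣ => (u : ℤ)) (prod_prod_Ioi_succ (n := L.length) fun i j =>
    if (a :: L).get i < (a :: L).get j then (1 : ℤˣ) else -1)).trans ?_
  rw [Units.val_mul]
  congr 1
  · change ((∏ j : Fin L.length, (if a < L.get j then 1 else -1) : ℤˣ) : ℤ) = _
    have h1 : ∏ j : Fin L.length, (if a < L.get j then (1 : ℤˣ) else -1) =
        ∏ x ∈ L.toFinset, (if a < x then (1 : ℤˣ) else -1) := by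
      rw [List.prod_toFinset _ hL, ← List.prod_ofFn]
      congr 1
      conv_rhs => rw [← List.ofFn_get L, List.map_ofFn]
      rfl
    rw [h1, Finset.prod_ite, Finset.prod_const_one, one_mul, Finset.prod_const, Units.val_pow_eq_pow_val,
      Units.val_neg, Units.val_one]
    congr 2
    refine Finset.filter_congr fun x hx => ?_
    have : x ≠ a := fun h => ha (h ▸ List.mem_toFinset.1 hx)
    rw [not_lt, le_iff_lt_or_eq, or_iff_left this]

namespace B0

open BHdR (eList)

/-- `e_l ∧ e_L = e_{l, L}` for finite sequences `L`. -/
theorem eps_eList (a : ℕ+) (L : List ℕ+) : eps a (eList L) = eList (a :: L) := by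
  unfold BHdR.eList
  by_cases hL : L.Nodup
  · rw [if_pos hL, map_zsmul, eps_e]
    by_cases ha : a ∈ L
    · rw [if_pos (List.mem_toFinset.2 ha), if_neg (fun h => (List.nodup_cons.1 h).1 ha), smul_zero]
    · have h : (a :: L).Nodup := List.nodup_cons.2 ⟨ha, hL⟩
      rw [if_neg (fun h => ha (List.mem_toFinset.1 h)), if_pos h, sign_sort_cons h, mul_comm,
        mul_smul, List.toFinset_cons]
      congr 1
      rcases Nat.even_or_odd (L.toFinset.filter (· < a)).card with hm | hm <;>
        simp [hm.neg_one_pow]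
  · rw [if_neg hL, if_neg (fun h => hL (List.nodup_cons.1 h).2), map_zero]

theorem eList_nil : eList [] = e ∅ := by
  unfold BHdR.eList
  rw [if_pos List.nodup_nil]
  have : Tuple.sort ([] : List ℕ+).get = 1 := Subsingleton.elim (α := Equiv.Perm (Fin 0)) _ _
  rw [this]
  simp

theorem eList_sort (I : Finset ℕ+) : eList I.sort = e I := by
  unfold BHdR.eList
  have hm : Monotone I.sort.get := I.sortedLT_sort.sortedLE.monotone_get
  rw [if_pos (I.sort_nodup _), Tuple.sort_eq_refl_iff_monotone.2 hm, Finset.sort_toFinset]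
  simp

theorem eList_comm (L : List ℕ+) (x : B0) : eList L * x = x * eList L := by
  unfold BHdR.eList
  split_ifs
  · rw [smul_mul_assoc, mul_smul_comm, e, ofAbar_comm]
  · rw [zero_mul, mul_zero]

/-! ### Scalars free of the `e_I` -/

/-- The subalgebra of `Ā` generated by the `θ_l` and `h_{k,l}`. -/
def eFree : Subalgebra ℚ Abar :=
  Algebra.adjoin ℚ ({a | ∃ l, a = Abar.gen (.theta l)} ∪ {a | ∃ k l, a = Abar.gen (.h k l)})

theorem theta_mem_eFree (l : ℕ+) : Abar.gen (.theta l) ∈ eFree :=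
  Algebra.subset_adjoin (Or.inl ⟨l, rfl⟩)
theorem h_mem_eFree (k l : ℕ+) : Abar.gen (.h k l) ∈ eFree :=
  Algebra.subset_adjoin (Or.inr ⟨k, l, rfl⟩)

/-- A derivation that kills the `θ_l` and `h_{k,l}` kills all scalars free of the `e_I`. -/
theorem IsDer.eFree_eq_zero {E : B0 →ₗ[ThetaPoly] B0} (hE : IsDer E)
    (ht : ∀ l, E (theta l) = 0) (hh : ∀ k l, E (h k l) = 0) {a : Abar} (ha : a ∈ eFree) :
    E (ofAbar a) = 0 := by
  induction ha using Algebra.adjoin_induction with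
  | mem a ha =>
    rcases ha with ⟨l, rfl⟩ | ⟨k, l, rfl⟩
    · exact ht l
    · exact hh k l
  | algebraMap c => rw [ofAbar_rat, map_smul, hE.map_one, smul_zero]
  | add a b _ _ ha hb => rw [map_add, map_add, ha, hb, add_zero]
  | mul a b _ _ ha hb => rw [map_mul, hE, ha, hb, zero_mul, mul_zero, add_zero]

theorem eps_eFree (l : ℕ+) {a : Abar} (ha : a ∈ eFree) : eps l (ofAbar a) = 0 :=
  (isDer_eps l).eFree_eq_zero (fun i => by rw [theta, eps_gen, epsGen, map_zero])
    (fun k i => eps_h l k i) ha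

theorem kap_eFree {a : Abar} (ha : a ∈ eFree) : kap (ofAbar a) = 0 :=
  isDer_kap.eFree_eq_zero (fun i => by rw [theta, kap_gen, kapGen, map_zero])
    (fun k i => kap_h k i) ha

theorem eps_eFree_mul (l : ℕ+) {a : Abar} (ha : a ∈ eFree) (x : B0) :
    eps l (ofAbar a * x) = ofAbar a * eps l x := by
  rw [isDer_eps, eps_eFree l ha, zero_mul, zero_add]

theorem kap_eFree_mul {a : Abar} (ha : a ∈ eFree) (x : B0) :
    kap (ofAbar a * x) = ofAbar a * kap x := by
  rw [isDer_kap, kap_eFree ha, zero_mul, zero_add]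

/-! ### Divided powers -/

/-- The divided power `∏_l (θ_l h_{k,l})^{j_l} / j_l!`. -/
def divPow (k : ℕ+) (j : ℕ+ →₀ ℕ) : Abar :=
  j.prod fun l n => ((n.factorial : ℚ)⁻¹) • (Abar.gen (.theta l) * Abar.gen (.h k l)) ^ n

/-- The coefficient `h_{k,i} ∏_l (θ_l h_{k,l})^{j'_l} / j'_l!` with `j' = j - δ_i`, which equals
`j_i θ_i⁻¹ ∏_l (θ_l h_{k,l})^{j_l} / j_l!` after inverting `θ_i`. -/
def divCoeff (k : ℕ+) (j : ℕ+ →₀ ℕ) (i : ℕ+) : Abar :=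
  Abar.gen (.h k i) * divPow k (j - Finsupp.single i 1)

theorem divPow_mem (k : ℕ+) (j : ℕ+ →₀ ℕ) : divPow k j ∈ eFree :=
  Subalgebra.prod_mem _ fun l _ =>
    Subalgebra.smul_mem _ (pow_mem (mul_mem (theta_mem_eFree l) (h_mem_eFree k l)) _) _

theorem divCoeff_mem (k : ℕ+) (j : ℕ+ →₀ ℕ) (i : ℕ+) : divCoeff k j i ∈ eFree :=
  mul_mem (h_mem_eFree k i) (divPow_mem k _)

theorem sub_single_add {j : ℕ+ →₀ ℕ} {i : ℕ+} (hi : j i ≠ 0) :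
    j - Finsupp.single i 1 + Finsupp.single i 1 = j :=
  tsub_add_cancel_of_le (Finsupp.single_le_iff.2 (Nat.one_le_iff_ne_zero.2 hi))

/-- `θ_i h_{k,i} (θh)^{[j]} = (j_i + 1) (θh)^{[j + δ_i]}`. -/
theorem theta_h_mul_divPow (k : ℕ+) (j : ℕ+ →₀ ℕ) (i : ℕ+) :
    Abar.gen (.theta i) * Abar.gen (.h k i) * divPow k j =
      ((j i + 1 : ℕ) : ℚ) • divPow k (j + Finsupp.single i 1) := by
  have hz : ∀ l : ℕ+, (((0 : ℕ).factorial : ℚ)⁻¹) •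
      (Abar.gen (.theta l) * Abar.gen (.h k l)) ^ 0 = 1 := fun l => by simp
  have hs : ∀ j : ℕ+ →₀ ℕ, divPow k j = ((j i).factorial : ℚ)⁻¹ •
      (Abar.gen (.theta i) * Abar.gen (.h k i)) ^ (j i) * divPow k (j.erase i) := by
    intro j
    by_cases hi : i ∈ j.support
    · exact (Finsupp.mul_prod_erase j i _ hi).symm
    · rw [Finsupp.notMem_support_iff.1 hi, hz, one_mul, Finsupp.erase_of_notMem_support hi]
  rw [hs j, hs (j + Finsupp.single i 1), Finsupp.erase_add, Finsupp.erase_single, add_zero,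
    Finsupp.add_apply, Finsupp.single_eq_same, smul_mul_assoc, smul_mul_assoc, mul_smul_comm,
    smul_smul, ← mul_assoc, ← pow_succ']
  congr 1
  rw [Nat.factorial_succ]
  push_cast
  field_simp

/-- `θ_i` times the coefficient `divCoeff` is `j_i` times the divided power, so that `divCoeff` is the
result of cancelling `θ_i⁻¹` in the explicit formula. -/
theorem theta_mul_divCoeff (k : ℕ+) {j : ℕ+ →₀ ℕ} {i : ℕ+} (hi : j i ≠ 0) :
    Abar.gen (.theta i) * divCoeff k j i = (j i : ℚ) • divPow k j := by
  have h := theta_h_mul_divPow k (j - Finsupp.single i 1) i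
  rw [sub_single_add hi, mul_assoc] at h
  rw [divCoeff, h]
  congr 2
  rw [Finsupp.tsub_apply, Finsupp.single_eq_same]
  omega

theorem shift_ofAbar (s : ℕ) (a : Abar) : shift s (ofAbar a) = ofAbar (shiftAbar s a) := by
  change shiftHom s (ofAbar a) = _
  rw [shiftHom, lift_ofAbar]
  rfl

theorem shiftAbar_gen (s : ℕ) (g : Gen) : shiftAbar s (Abar.gen g) = shiftGen s g :=
  Abar.lift_gen _ _ g

theorem shiftAbar_h (k l : ℕ+) : shiftAbar 0 (Abar.gen (.h k l)) = Abar.gen (.h (k + 1) l) := by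
  rw [shiftAbar_gen, shiftGen, if_neg (Nat.not_lt_zero _), if_neg k.ne_zero]

theorem shiftAbar_divPow (k : ℕ+) (j : ℕ+ →₀ ℕ) : shiftAbar 0 (divPow k j) = divPow (k + 1) j := by
  unfold divPow
  rw [map_finsuppProd]
  refine Finsupp.prod_congr fun l _ => ?_
  rw [map_smul, map_pow, map_mul, shiftAbar_h, shiftAbar_gen, shiftGen]

theorem shiftAbar_divCoeff (k : ℕ+) (j : ℕ+ →₀ ℕ) (i : ℕ+) :
    shiftAbar 0 (divCoeff k j i) = divCoeff (k + 1) j i := by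
  rw [divCoeff, map_mul, shiftAbar_h, shiftAbar_divPow, divCoeff]

theorem IsHom.pow_ofAbar {w : ℕ} {a : Abar} (ha : IsHom w (ofAbar a)) (n : ℕ) :
    IsHom (n * w) (ofAbar (a ^ n)) := by
  induction n with
  | zero => rw [zero_mul, pow_zero, map_one]; exact IsHom.one
  | succ n ih => rw [Nat.succ_mul, pow_succ, map_mul]; exact ih.mul ha

theorem isHom_prod_ofAbar {ι : Type*} (s : Finset ι) {w : ι → ℕ} {a : ι → Abar}
    (ha : ∀ i ∈ s, IsHom (w i) (ofAbar (a i))) :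
    IsHom (∑ i ∈ s, w i) (ofAbar (∏ i ∈ s, a i)) := by
  classical
  induction s using Finset.induction_on with
  | empty => rw [Finset.sum_empty, Finset.prod_empty, map_one]; exact IsHom.one
  | insert i s hi ih =>
    rw [Finset.sum_insert hi, Finset.prod_insert hi, map_mul]
    exact (ha i (Finset.mem_insert_self _ _)).mul
      (ih fun k hk => ha k (Finset.mem_insert_of_mem hk))

theorem ofAbar_rat_smul (c : ℚ) (a : Abar) :
    ofAbar (c • a) = (MvPolynomial.C c : ThetaPoly) • ofAbar a := by
  rw [Algebra.smul_def, map_mul, ofAbar_rat, smul_mul_assoc, one_mul]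

theorem isHom_divPow (k : ℕ+) (j : ℕ+ →₀ ℕ) :
    IsHom (j.sum fun _ n => n) (ofAbar (divPow k j)) := by
  refine isHom_prod_ofAbar _ fun l _ => ?_
  rw [ofAbar_rat_smul]
  refine IsHom.smul ?_ _
  have h1 : IsHom 1 (ofAbar (Abar.gen (.theta l) * Abar.gen (.h k l))) := by
    rw [map_mul]
    exact (isHom_theta l).mul (isHom_h k l)
  simpa using h1.pow_ofAbar (j l)

theorem degree_sub_single {j : ℕ+ →₀ ℕ} {i : ℕ+} (hi : j i ≠ 0) :
    1 + ((j - Finsupp.single i 1).sum fun _ n => n) = j.sum fun _ n => n := by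
  conv_rhs => rw [← sub_single_add hi]
  rw [Finsupp.sum_add_index' (fun _ => rfl) (fun _ _ _ => rfl), Finsupp.sum_single_index rfl,
    add_comm]

theorem isHom_divCoeff (k : ℕ+) {j : ℕ+ →₀ ℕ} {i : ℕ+} (hi : j i ≠ 0) :
    IsHom (j.sum fun _ n => n) (ofAbar (divCoeff k j i)) := by
  rw [divCoeff, map_mul, ← degree_sub_single hi]
  exact (isHom_h k i).mul (isHom_divPow k _)

theorem pi0_eps (l : ℕ+) (x : B0) : pi0 (eps l x) = eps l (pi0 x) := by
  refine (isDer_eps l).comm_hom pi0_mul pi0_one (fun a => ?_) (fun k i => ?_) x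
  · cases a with
    | theta i => change pi0 _ = eps l (pi0 (theta i)); rw [pi0_theta, theta, eps_gen,
        epsGen, map_zero, map_zero]
    | e I =>
      change pi0 (eps l (e I)) = eps l (pi0 (e I))
      rw [pi0_e, eps_e]
      split_ifs
      · exact map_zero _
      · rcases neg_one_pow_eq_or B0 (I.filter (· < l)).card with h | h <;> rw [h] <;>
          simp [pi0_e]
    | h k i =>
      change pi0 (eps l (h k i)) = eps l (pi0 (h k i))
      rw [eps_h, pi0_h, map_zero, map_zero]
  · rw [eps_zeta, pi0_zeta, map_zero, map_zero]

theorem IsHom.eps {w : ℕ} {x : B0} (hx : IsHom w x) (l : ℕ+) : IsHom w (eps l x) where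
  eul_eq := by rw [eul_eps, hx.eul_eq, map_nsmul]
  mem := (isDer_eps l).idealI_pow_mem (eps_gens l 0) _ hx.mem
  pi0_eq := by rw [pi0_eps, hx.pi0_eq]; split_ifs <;> simp

/-! ### The building blocks of the explicit formula -/

/-- The operator `x ↦ ζ_{k,l} (e_l ∧ x)`. -/
def zetaOp (p : ℕ × ℕ+) : B0 →ₗ[ThetaPoly] B0 :=
  LinearMap.mulLeft ThetaPoly (zeta p.1 p.2) ∘ₗ eps p.2

theorem zetaOp_apply (p : ℕ × ℕ+) (x : B0) : zetaOp p x = zeta p.1 p.2 * eps p.2 x := rfl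

theorem zetaOp_comm (p q : ℕ × ℕ+) (x : B0) : zetaOp p (zetaOp q x) = zetaOp q (zetaOp p x) := by
  simp only [zetaOp_apply, isDer_eps _ _ _, eps_zeta, zero_mul, zero_add]
  rw [eps_anticomm, ← mul_assoc, zeta_anticomm, ← mul_assoc]
  simp

theorem zetaOp_self (p : ℕ × ℕ+) (x : B0) : zetaOp p (zetaOp p x) = 0 := by
  simp only [zetaOp_apply, isDer_eps _ _ _, eps_zeta, zero_mul, zero_add]
  rw [eps_eps_self, mul_zero, mul_zero]

/-- The composition of the operators `ζ_{k,l} (e_l ∧ ·)` along a list of pairs `(k, l)`. -/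
def zetaOps : List (ℕ × ℕ+) → B0 →ₗ[ThetaPoly] B0
  | [] => LinearMap.id
  | p :: ps => zetaOp p ∘ₗ zetaOps ps

theorem zetaOps_cons (p : ℕ × ℕ+) (ps : List (ℕ × ℕ+)) (x : B0) :
    zetaOps (p :: ps) x = zetaOp p (zetaOps ps x) := rfl

theorem zetaOps_perm {ps qs : List (ℕ × ℕ+)} (h : ps.Perm qs) (x : B0) :
    zetaOps ps x = zetaOps qs x := by
  induction h with
  | nil => rfl
  | cons p _ ih => rw [zetaOps_cons, zetaOps_cons, ih]
  | swap p q ps => rw [zetaOps_cons, zetaOps_cons, zetaOp_comm]; rfl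
  | trans _ _ h1 h2 => rw [h1, h2]

/-- The operator `x ↦ ∑_i h_{k,i} (θh)^{[j - δ_i]} (e_i ∧ x)`. -/
def hOp (k : ℕ+) (j : ℕ+ →₀ ℕ) : B0 →ₗ[ThetaPoly] B0 :=
  ∑ i ∈ j.support, LinearMap.mulLeft ThetaPoly (ofAbar (divCoeff k j i)) ∘ₗ eps i

theorem hOp_apply (k : ℕ+) (j : ℕ+ →₀ ℕ) (x : B0) :
    hOp k j x = ∑ i ∈ j.support, ofAbar (divCoeff k j i) * eps i x := by
  rw [hOp, LinearMap.sum_apply]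
  rfl

theorem hOp_zero (k : ℕ+) (x : B0) : hOp k 0 x = 0 := by
  rw [hOp_apply, Finsupp.support_zero, Finset.sum_empty]

theorem zetaOp_hOp (p : ℕ × ℕ+) (k : ℕ+) (j : ℕ+ →₀ ℕ) (x : B0) :
    zetaOp p (hOp k j x) = -hOp k j (zetaOp p x) := by
  rw [hOp_apply, hOp_apply, map_sum, ← Finset.sum_neg_distrib]
  refine Finset.sum_congr rfl fun i _ => ?_
  rw [zetaOp_apply, zetaOp_apply, eps_eFree_mul _ (divCoeff_mem k j i), isDer_eps, eps_zeta,
    zero_mul, zero_add, ofAbar_left_comm, eps_anticomm, mul_neg, mul_neg]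

theorem zetaOps_hOp (ps : List (ℕ × ℕ+)) (k : ℕ+) (j : ℕ+ →₀ ℕ) (x : B0) :
    zetaOps ps (hOp k j x) = (-1 : ℤ) ^ ps.length • hOp k j (zetaOps ps x) := by
  induction ps with
  | nil => simp [zetaOps]
  | cons p ps ih =>
    rw [zetaOps_cons, ih, map_zsmul, zetaOp_hOp, zetaOps_cons, List.length_cons, pow_succ, mul_smul,
      neg_one_smul]

/-- The composition of the operators `hOp` for the rows `J_0, …, J_{r-1}` with row indices
`m + 1, …, m + r`, applied to `e_∅`. -/
def hWord : ℕ → ℕ → (ℕ → ℕ+ →₀ ℕ) → B0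
  | _, 0, _ => e ∅
  | m, r + 1, J => hOp m.succPNat (J 0) (hWord (m + 1) r fun k => J (k + 1))

theorem shift_zetaOp (p : ℕ × ℕ+) (x : B0) :
    shift 0 (zetaOp p x) = zetaOp (p.1 + 1, p.2) (shift 0 x) := by
  rw [zetaOp_apply, zetaOp_apply, shift_mul, shift_zeta, if_neg (Nat.not_lt_zero _), shift_eps]

theorem shift_zetaOps (ps : List (ℕ × ℕ+)) (x : B0) :
    shift 0 (zetaOps ps x) = zetaOps (ps.map fun p => (p.1 + 1, p.2)) (shift 0 x) := by
  induction ps with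
  | nil => rfl
  | cons p ps ih => rw [zetaOps_cons, shift_zetaOp, ih]; rfl

theorem shift_hOp (k : ℕ+) (j : ℕ+ →₀ ℕ) (x : B0) :
    shift 0 (hOp k j x) = hOp (k + 1) j (shift 0 x) := by
  rw [hOp_apply, hOp_apply, map_sum]
  refine Finset.sum_congr rfl fun i _ => ?_
  rw [shift_mul, shift_ofAbar, shiftAbar_divCoeff, shift_eps]

theorem shift_hWord (m r : ℕ) (J : ℕ → ℕ+ →₀ ℕ) : shift 0 (hWord m r J) = hWord (m + 1) r J := by
  induction r generalizing m J with
  | zero => exact shift_e _ _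
  | succ r ih =>
    rw [hWord, hWord, shift_hOp, ih]
    rfl

theorem kap_zetaOp (p : ℕ × ℕ+) (x : B0) : kap (zetaOp p x) = zetaOp p (kap x) := by
  rw [zetaOp_apply, zetaOp_apply, isDer_kap, kap_zeta, zero_mul, zero_add, kap_eps]

theorem kap_zetaOps (ps : List (ℕ × ℕ+)) (x : B0) : kap (zetaOps ps x) = zetaOps ps (kap x) := by
  induction ps with
  | nil => rfl
  | cons p ps ih => rw [zetaOps_cons, kap_zetaOp, ih]; rfl

theorem kap_hWord (m r : ℕ) (J : ℕ → ℕ+ →₀ ℕ) : kap (hWord m r J) = hWord m r J := by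
  induction r generalizing m J with
  | zero => exact kap_e _
  | succ r ih =>
    rw [hWord, hOp_apply, map_sum]
    refine Finset.sum_congr rfl fun i _ => ?_
    rw [kap_eFree_mul (divCoeff_mem _ _ _), kap_eps, ih]

theorem IsHom.zetaOps {w : ℕ} {x : B0} (hx : IsHom w x) (ps : List (ℕ × ℕ+)) :
    IsHom (ps.length + w) (zetaOps ps x) := by
  induction ps with
  | nil => rw [List.length_nil, zero_add]; exact hx
  | cons p ps ih =>
    rw [zetaOps_cons, List.length_cons, add_comm ps.length, add_assoc]
    exact (isHom_zeta _ _).mul (ih.eps _)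

theorem IsHom.hOp {w : ℕ} {x : B0} (hx : IsHom w x) (k : ℕ+) (j : ℕ+ →₀ ℕ) :
    IsHom ((j.sum fun _ n => n) + w) (hOp k j x) := by
  rw [hOp_apply]
  exact IsHom.sum _ fun i hi =>
    (isHom_divCoeff k (Finsupp.mem_support_iff.1 hi)).mul (hx.eps i)

theorem isHom_hWord (m r : ℕ) (J : ℕ → ℕ+ →₀ ℕ) :
    IsHom (∑ k ∈ Finset.range r, (J k).sum fun _ n => n) (hWord m r J) := by
  induction r generalizing m J with
  | zero => exact isHom_e _
  | succ r ih =>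
    rw [Finset.sum_range_succ', add_comm]
    exact (ih (m + 1) fun k => J (k + 1)).hOp _ _

/-! ### Terms with large indices are small -/

theorem eps_idealJ (l : ℕ+) {n : ℕ} {x : B0} (hx : x ∈ idealJ n) : eps l x ∈ idealJ n :=
  (isDer_eps l).idealJ_mem (eps_gens l n) hx

theorem zetaOp_idealJ (p : ℕ × ℕ+) {n : ℕ} {x : B0} (hx : x ∈ idealJ n) :
    zetaOp p x ∈ idealJ n := by
  rw [zetaOp_apply]
  exact Ideal.mul_mem_left _ _ (eps_idealJ _ hx)

theorem zetaOps_idealJ (ps : List (ℕ × ℕ+)) {n : ℕ} {x : B0} (hx : x ∈ idealJ n) :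
    zetaOps ps x ∈ idealJ n := by
  induction ps with
  | nil => exact hx
  | cons p ps ih => exact zetaOp_idealJ p ih

theorem zetaOps_mem_idealJ {ps : List (ℕ × ℕ+)} {n : ℕ} {p : ℕ × ℕ+} (hp : p ∈ ps)
    (hn : n ≤ p.2) (x : B0) : zetaOps ps x ∈ idealJ n := by
  induction ps with
  | nil => simp at hp
  | cons q ps ih =>
    rcases List.mem_cons.1 hp with rfl | hp
    · exact Ideal.mul_mem_right _ _ (zeta_mem (le_add_left hn))
    · exact zetaOp_idealJ q (ih hp)

theorem hOp_idealJ (k : ℕ+) (j : ℕ+ →₀ ℕ) {n : ℕ} {x : B0} (hx : x ∈ idealJ n) :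
    hOp k j x ∈ idealJ n := by
  rw [hOp_apply]
  exact sum_mem fun i _ => Ideal.mul_mem_left _ _ (eps_idealJ _ hx)

theorem divPow_mem_idealJ (k : ℕ+) {j : ℕ+ →₀ ℕ} {n : ℕ} {l : ℕ+} (hl : j l ≠ 0) (hn : n ≤ l) :
    ofAbar (divPow k j) ∈ idealJ n := by
  rw [divPow, ← Finsupp.mul_prod_erase j l _ (Finsupp.mem_support_iff.2 hl), map_mul,
    ofAbar_rat_smul, theta_smul_eq, ← Nat.sub_add_cancel (Nat.one_le_iff_ne_zero.2 hl), pow_succ,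
    map_mul, map_mul]
  exact Ideal.mul_mem_right _ _ (Ideal.mul_mem_left _ _ (Ideal.mul_mem_left _ _
    (Ideal.mul_mem_right _ _ (theta_mem hn))))

theorem divCoeff_mem_idealJ (k : ℕ+) {j : ℕ+ →₀ ℕ} {n : ℕ} {l : ℕ+} (hl : j l ≠ 0) (hn : n ≤ l)
    (i : ℕ+) : ofAbar (divCoeff k j i) ∈ idealJ n := by
  rw [divCoeff, map_mul]
  by_cases h : i = l
  · subst h
    exact Ideal.mul_mem_right _ _ (h_mem (le_add_left hn))
  · refine Ideal.mul_mem_left _ _ (divPow_mem_idealJ k (l := l) ?_ hn)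
    rwa [Finsupp.tsub_apply, Finsupp.single_eq_of_ne (Ne.symm h), Nat.sub_zero]

theorem hWord_mem_idealJ {m r : ℕ} {J : ℕ → ℕ+ →₀ ℕ} {k n : ℕ} {l : ℕ+} (hk : k < r)
    (hl : J k l ≠ 0) (hn : n ≤ l) : hWord m r J ∈ idealJ n := by
  induction r generalizing m J k with
  | zero => omega
  | succ r ih =>
    rw [hWord]
    rcases k with _ | k
    · rw [hOp_apply]
      exact sum_mem fun i _ => Ideal.mul_mem_right _ _ (divCoeff_mem_idealJ _ hl hn i)
    · exact hOp_idealJ _ _ (ih (J := fun k => J (k + 1)) (Nat.lt_of_succ_lt_succ hk) hl)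

/-! ### Expansion of the building blocks -/

theorem zetaOps_eFree_mul (ps : List (ℕ × ℕ+)) {a : Abar} (ha : a ∈ eFree) (x : B0) :
    zetaOps ps (ofAbar a * x) = ofAbar a * zetaOps ps x := by
  induction ps with
  | nil => rfl
  | cons p ps ih =>
    rw [zetaOps_cons, ih, zetaOp_apply, eps_eFree_mul _ ha, ofAbar_left_comm]
    rfl

/-- The operators along a list of pairs collect the indices in front of the exterior word in the `e`
and the `ζ` behind it; no sign arises because each operator contains one `ζ` and one `e`. -/
theorem zetaOps_eList (ps : List (ℕ × ℕ+)) (M : List ℕ+) : zetaOps ps (eList M) =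
    eList (ps.map Prod.snd ++ M) * (ps.map fun p => zeta p.1 p.2).prod := by
  have hz : ∀ l, ∀ ps : List (ℕ × ℕ+), eps l (ps.map fun p => zeta p.1 p.2).prod = 0 := by
    intro l ps
    induction ps with
    | nil => exact (isDer_eps l).map_one
    | cons p ps ih =>
      rw [List.map_cons, List.prod_cons, isDer_eps, ih, eps_zeta, zero_mul, mul_zero, add_zero]
  induction ps with
  | nil => simp [zetaOps]
  | cons p ps ih =>
    rw [zetaOps_cons, ih, zetaOp_apply, isDer_eps, hz, mul_zero, add_zero, eps_eList, ← mul_assoc,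
      ← eList_comm, mul_assoc]
    simp only [List.map_cons, List.prod_cons, List.cons_append]

/-- Expansion of the composition of the row operators as a sum over one index from the support of each
row. -/
theorem hWord_eq_sum (m r : ℕ) (J : ℕ → ℕ+ →₀ ℕ) : hWord m r J =
    ∑ i ∈ Fintype.piFinset fun k : Fin r => (J k).support,
      ofAbar (∏ k : Fin r, divCoeff (m + k).succPNat (J k) (i k)) * eList (List.ofFn i) := by
  induction r generalizing m J with
  | zero =>
    rw [hWord, ← eList_nil]
    simp
  | succ r ih =>
    rw [hWord, ih, hOp_apply]
    simp only [map_sum, Finset.mul_sum]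
    rw [← Finset.sum_product']
    refine Finset.sum_nbij' (fun p => Fin.cons p.1 p.2) (fun i => (i 0, Fin.tail i)) ?_ ?_ ?_ ?_ ?_
    · intro p hp
      rw [Finset.mem_product, Fintype.mem_piFinset] at hp
      rw [Fintype.mem_piFinset, Fin.forall_fin_succ]
      exact ⟨hp.1, fun k => by simpa using hp.2 k⟩
    · intro i hi
      rw [Fintype.mem_piFinset, Fin.forall_fin_succ] at hi
      rw [Finset.mem_product, Fintype.mem_piFinset]
      exact ⟨hi.1, fun k => hi.2 k⟩
    · intro p _
      simp
    · intro i _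
      simp
    · intro p _
      have hm : (∏ k : Fin r, divCoeff (m + 1 + k).succPNat (J (k + 1)) (p.2 k)) ∈ eFree :=
        Subalgebra.prod_mem _ fun k _ => divCoeff_mem _ _ _
      rw [eps_eFree_mul _ hm, eps_eList, ← mul_assoc, ← map_mul, Fin.prod_univ_succ, List.ofFn_cons]
      simp only [Fin.cons_zero, Fin.cons_succ, Fin.val_zero, Fin.val_succ, add_zero, add_assoc,
        add_comm 1]

end B0

/-! ### The index sets -/

/-- Finitely supported families with support in a fixed finite set and bounded total are finite in
number. -/
theorem finite_finsupp {α : Type*} (S : Set α) (hS : S.Finite) (n : ℕ) :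
    {j : α →₀ ℕ | (∀ a, j a ≠ 0 → a ∈ S) ∧ (j.sum fun _ m => m) ≤ n}.Finite := by
  classical
  refine (Set.finite_Icc (0 : α →₀ ℕ) (∑ a ∈ hS.toFinset, Finsupp.single a n)).subset ?_
  rintro j ⟨h1, h2⟩
  refine ⟨fun _ => Nat.zero_le _, fun a => ?_⟩
  by_cases ha : j a = 0
  · rw [ha]; exact Nat.zero_le _
  · rw [Finsupp.finsetSum_apply]
    refine le_trans ?_ (Finset.single_le_sum (f := fun b => Finsupp.single b n a)
      (fun _ _ => Nat.zero_le _) (hS.mem_toFinset.2 (h1 a ha)))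
    rw [Finsupp.single_eq_same]
    exact le_trans (Finset.single_le_sum (f := j) (fun _ _ => Nat.zero_le _)
      (Finsupp.mem_support_iff.2 ha)) h2

/-- The total of a finitely supported family. -/
abbrev total {α : Type*} (j : α →₀ ℕ) : ℕ := j.sum fun _ n => n

theorem total_eq_zero {α : Type*} {j : α →₀ ℕ} (h : total j = 0) : j = 0 := by
  ext a
  by_contra ha
  exact ha (Finset.sum_eq_zero_iff.1 h a (Finsupp.mem_support_iff.2 ha))

namespace BHdR.T

variable {r s : ℕ}

/-- The `k`-th row `(j_{k+1,l})_l` of `j`; rows are numbered from `0`. -/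
def row (x : T r s) (k : ℕ) : ℕ+ →₀ ℕ := x.j.curry k.succPNat

theorem row_apply (x : T r s) (k : ℕ) (l : ℕ+) : x.row k l = x.j (k.succPNat, l) := rfl

theorem row_eq_zero (x : T r s) {k : ℕ} (hk : r ≤ k) : x.row k = 0 := by
  ext l
  exact x.j_eq_zero _ _ (Nat.lt_succ_of_le hk)

theorem ext_row {x y : T r s} (h1 : ∀ k, x.row k = y.row k) (h2 : x.block = y.block) : x = y := by
  have hj : x.j = y.j := by
    ext ⟨k, l⟩
    have := DFunLike.congr_fun (h1 k.natPred) l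
    rwa [row_apply, row_apply, PNat.succPNat_natPred] at this
  cases x
  cases y
  cases hj
  cases h2
  rfl

/-- Products over the entries of `j` can be taken row by row. -/
@[to_additive]
theorem prod_eq_prod_row {M : Type*} [CommMonoid M] (x : T r s) (g : ℕ+ × ℕ+ → ℕ → M)
    (hg : ∀ p, g p 0 = 1) :
    x.j.prod g = ∏ k ∈ Finset.range r, (x.row k).prod fun l n => g (k.succPNat, l) n := by
  classical
  have h1 : ∀ k ∈ Finset.range r, ((x.row k).prod fun l n => g (k.succPNat, l) n) =
      ∏ l ∈ x.j.support.image Prod.snd, g (k.succPNat, l) (x.j (k.succPNat, l)) := fun k _ =>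
    Finsupp.prod_of_support_subset _ (fun l hl => Finset.mem_image.2
      ⟨(k.succPNat, l), Finsupp.mem_support_iff.2 (Finsupp.mem_support_iff (f := x.row k).1 hl), rfl⟩) _
      (fun l _ => hg _)
  have hinj : Set.InjOn (fun p : ℕ × ℕ+ => (p.1.succPNat, p.2))
      (Finset.range r ×ˢ x.j.support.image Prod.snd : Finset (ℕ × ℕ+)) := by
    rintro ⟨k, l⟩ _ ⟨k', l'⟩ _ h
    obtain ⟨h1, h2⟩ := Prod.mk.inj h
    exact Prod.ext (Nat.succPNat_injective h1) h2
  rw [Finset.prod_congr rfl h1, ← Finset.prod_product' (f := fun k l =>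
    g (Nat.succPNat k, l) (x.j (Nat.succPNat k, l))),
    ← Finset.prod_image (f := fun p => g p (x.j p)) hinj]
  refine Finsupp.prod_of_support_subset _ (fun p hp => Finset.mem_image.2
    ⟨(p.1.natPred, p.2), Finset.mem_product.2 ⟨Finset.mem_range.2 ?_, Finset.mem_image.2
      ⟨p, hp, rfl⟩⟩, ?_⟩) _ (fun p _ => hg p)
  · by_contra h
    refine Finsupp.mem_support_iff.1 hp (x.j_eq_zero p.1 p.2 ?_)
    have := PNat.natPred_add_one p.1
    omega
  · dsimp only
    rw [PNat.succPNat_natPred]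

/-- The element of `T(r,s)` with given rows and blocks. -/
def ofRows (J : ℕ → ℕ+ →₀ ℕ) (b : ℕ → Finset ℕ+) (hb : ∀ k, r < k → b k = ∅)
    (hs : ∑ k ∈ Finset.range (r + 1), (b k).card = s) : T r s where
  j := Finsupp.onFinset
    ((Finset.range r).biUnion fun k => (J k).support.image fun l => (k.succPNat, l))
    (fun p => if p.1.natPred < r then J p.1.natPred p.2 else 0) (by
      rintro ⟨k, l⟩ h
      rw [ite_ne_right_iff] at h
      refine Finset.mem_biUnion.2 ⟨k.natPred, Finset.mem_range.2 h.1, Finset.mem_image.2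
        ⟨l, Finsupp.mem_support_iff.2 h.2, ?_⟩⟩
      rw [PNat.succPNat_natPred])
  block := b
  j_eq_zero k l h := by
    have := PNat.natPred_add_one k
    exact if_neg (by dsimp only; omega)
  block_eq_empty := hb
  sum_card := hs

theorem row_ofRows {J : ℕ → ℕ+ →₀ ℕ} {b : ℕ → Finset ℕ+} (hb : ∀ k, r < k → b k = ∅)
    (hs : ∑ k ∈ Finset.range (r + 1), (b k).card = s) {k : ℕ} (hk : k < r) :
    (ofRows J b hb hs).row k = J k := by
  ext l
  change (if (Nat.succPNat k).natPred < r then J (Nat.succPNat k).natPred l else 0) = J k l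
  rw [Nat.natPred_succPNat, if_pos hk]

/-- Removal of the index `l` from the block `0`. -/
def erase (x : T r (s + 1)) (l : ℕ+) (hl : l ∈ x.block 0) : T r s where
  j := x.j
  block := Function.update x.block 0 ((x.block 0).erase l)
  j_eq_zero := x.j_eq_zero
  block_eq_empty k hk := by
    rw [Function.update_of_ne (by omega), x.block_eq_empty k hk]
  sum_card := by
    have h := x.sum_card
    rw [Finset.sum_range_succ'] at h ⊢
    have hc := Finset.card_erase_add_one hl
    have h2 : ∀ k ∈ Finset.range r,
        (Function.update x.block 0 ((x.block 0).erase l) (k + 1)).card = (x.block (k + 1)).card :=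
      fun k _ => by rw [Function.update_of_ne (Nat.succ_ne_zero _)]
    rw [Function.update_self, Finset.sum_congr rfl h2]
    omega

theorem block_erase_zero (x : T r (s + 1)) (l : ℕ+) (hl : l ∈ x.block 0) :
    (x.erase l hl).block 0 = (x.block 0).erase l := by
  simp [erase]

theorem block_erase_succ (x : T r (s + 1)) (l : ℕ+) (hl : l ∈ x.block 0) (k : ℕ) :
    (x.erase l hl).block (k + 1) = x.block (k + 1) :=
  Function.update_of_ne (Nat.succ_ne_zero k) ((x.block 0).erase l) x.block

/-- Insertion of the index `l` into the block `0`. -/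
def insert (y : T r s) (l : ℕ+) (hl : l ∉ y.block 0) : T r (s + 1) where
  j := y.j
  block := Function.update y.block 0 (Insert.insert l (y.block 0))
  j_eq_zero := y.j_eq_zero
  block_eq_empty k hk := by
    rw [Function.update_of_ne (by omega), y.block_eq_empty k hk]
  sum_card := by
    have h := y.sum_card
    rw [Finset.sum_range_succ'] at h ⊢
    have hc := Finset.card_insert_of_notMem hl
    have h2 : ∀ k ∈ Finset.range r,
        (Function.update y.block 0 (Insert.insert l (y.block 0)) (k + 1)).card =
          (y.block (k + 1)).card :=
      fun k _ => by rw [Function.update_of_ne (Nat.succ_ne_zero _)]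
    rw [Function.update_self, Finset.sum_congr rfl h2]
    omega

theorem mem_block_insert (y : T r s) (l : ℕ+) (hl : l ∉ y.block 0) : l ∈ (y.insert l hl).block 0 := by
  rw [insert]
  simp

theorem erase_insert (y : T r s) (l : ℕ+) (hl : l ∉ y.block 0) :
    (y.insert l hl).erase l (y.mem_block_insert l hl) = y := by
  refine ext_row (fun _ => rfl) ?_
  simp only [erase, insert, Function.update_self, Finset.erase_insert hl, Function.update_idem,
    Function.update_eq_self]

/-- Passage from `x` with an element of its block `0` to that element and the rest of `x`. -/
def eraseMap (p : Σ x : T r (s + 1), {l // l ∈ x.block 0}) : ℕ+ × T r s :=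
  (p.2.1, p.1.erase p.2.1 p.2.2)

theorem eraseMap_injective : Function.Injective (eraseMap (r := r) (s := s)) := by
  rintro ⟨x, l, hl⟩ ⟨y, l', hl'⟩ h
  obtain ⟨h1, h2⟩ := Prod.mk.inj h
  dsimp only at h1 h2
  subst h1
  have hxy : x = y := by
    refine ext_row (fun k => congrArg (fun z : T r s => row z k) h2) (funext fun k => ?_)
    have hb := congrFun (congrArg T.block h2) k
    simp only [erase] at hb
    rcases k with _ | k
    · rw [Function.update_self, Function.update_self] at hb
      rw [← Finset.insert_erase hl, hb, Finset.insert_erase hl']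
    · rwa [Function.update_of_ne (Nat.succ_ne_zero _), Function.update_of_ne (Nat.succ_ne_zero _)] at hb
  subst hxy
  rfl

/-- The element of `T(r+1,s)` with empty block `0`, first row `j`, and further rows and blocks those
of `y`. -/
def cons (p : (ℕ+ →₀ ℕ) × T r s) : T (r + 1) s :=
  ofRows (fun k => Nat.casesOn k p.1 p.2.row) (fun k => Nat.casesOn k ∅ p.2.block)
    (by
      rintro (_ | k) hk
      · omega
      · exact p.2.block_eq_empty k (by omega))
    (by
      rw [Finset.sum_range_succ']
      exact p.2.sum_card)

theorem row_cons_zero (p : (ℕ+ →₀ ℕ) × T r s) : (cons p).row 0 = p.1 :=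
  row_ofRows _ _ (Nat.succ_pos _)

theorem row_cons_succ (p : (ℕ+ →₀ ℕ) × T r s) (k : ℕ) : (cons p).row (k + 1) = p.2.row k := by
  by_cases hk : k < r
  · exact row_ofRows _ _ (Nat.succ_lt_succ hk)
  · rw [row_eq_zero _ (by omega), row_eq_zero _ (by omega)]

theorem block_cons_zero (p : (ℕ+ →₀ ℕ) × T r s) : (cons p).block 0 = ∅ := rfl
theorem cons_injective : Function.Injective (cons (r := r) (s := s)) := by
  rintro ⟨j, y⟩ ⟨j', y'⟩ h
  have h1 : j = j' := by
    have := congrArg (fun z => row z 0) h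
    rwa [row_cons_zero, row_cons_zero] at this
  have h2 : y = y' := ext_row (fun k => by
    have := congrArg (fun z => row z (k + 1)) h
    rwa [row_cons_succ, row_cons_succ] at this) (funext fun k =>
      congrFun (congrArg T.block h) (k + 1))
  rw [h1, h2]

theorem exists_cons {x : T (r + 1) s} (hx : x.block 0 = ∅) : ∃ p, cons p = x := by
  refine ⟨(x.row 0, ofRows (fun k => x.row (k + 1)) (fun k => x.block (k + 1))
    (fun k hk => x.block_eq_empty _ (Nat.succ_lt_succ hk)) ?_), ?_⟩
  · have h := x.sum_card
    rwa [Finset.sum_range_succ', hx, Finset.card_empty, add_zero] at h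
  · refine ext_row (fun k => ?_) (funext fun k => ?_)
    · rcases k with _ | k
      · exact row_cons_zero _
      · rw [row_cons_succ]
        by_cases hk : k < r
        · exact row_ofRows _ _ hk
        · rw [row_eq_zero _ (by omega), row_eq_zero _ (by omega)]
    · rcases k with _ | k
      · exact hx.symm
      · rfl

/-- The weight of the summand with index `x`, for `h` and `ζ` of weight one. -/
def weight (x : T r s) : ℕ := s + ∑ k ∈ Finset.range r, total (x.row k)

theorem length_pairs (x : T r s) : x.pairs.length = s := by
  rw [pairs, List.length_flatMap]
  refine Eq.trans ?_ x.sum_card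
  simp only [List.length_map, Finset.length_sort]
  rfl

theorem mem_pairs {x : T r s} {p : ℕ × ℕ+} (h : p.2 ∈ x.block p.1) : p ∈ x.pairs := by
  have hk : p.1 < r + 1 := by
    by_contra hk
    rw [x.block_eq_empty _ (by omega)] at h
    simp at h
  exact List.mem_flatMap.2 ⟨p.1, List.mem_range.2 hk, List.mem_map.2 ⟨p.2, by simpa using h, rfl⟩⟩

/-- All but finitely many `x` have large weight or contain a large index. -/
theorem finite_of_bounded (n : ℕ) : {x : T r s | x.weight ≤ n ∧
    (∀ k l, x.row k l ≠ 0 → (l : ℕ) ≤ n) ∧ ∀ k, ∀ l ∈ x.block k, (l : ℕ) ≤ n}.Finite := by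
  have hN : {l : ℕ+ | (l : ℕ) ≤ n}.Finite :=
    (Set.finite_Iio (⟨n + 1, n.succ_pos⟩ : ℕ+)).subset fun l hl => Nat.lt_succ_of_le hl
  have h1 : (Set.pi Set.univ fun _ : Fin r =>
      {j : ℕ+ →₀ ℕ | (∀ a, j a ≠ 0 → a ∈ {l : ℕ+ | (l : ℕ) ≤ n}) ∧ total j ≤ n}).Finite :=
    Set.Finite.pi fun _ => finite_finsupp _ hN n
  have h2 : (Set.pi Set.univ fun _ : Fin (r + 1) =>
      {b : Finset ℕ+ | b ⊆ hN.toFinset}).Finite := by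
    refine Set.Finite.pi fun _ => ?_
    refine (hN.toFinset.powerset.finite_toSet).subset fun b hb => ?_
    exact Finset.mem_coe.2 (Finset.mem_powerset.2 hb)
  refine Set.Finite.of_finite_image (f := fun x => ((fun k : Fin r => x.row k),
    fun k : Fin (r + 1) => x.block k)) ((h1.prod h2).subset ?_) ?_
  · rintro _ ⟨x, ⟨hx1, hx2, hx3⟩, rfl⟩
    refine ⟨fun k _ => ⟨fun a ha => hx2 k a ha, ?_⟩, fun k _ l hl => hN.mem_toFinset.2 (hx3 k l hl)⟩
    refine le_trans ?_ hx1
    exact le_add_left (Finset.single_le_sum (f := fun k => total (x.row k))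
      (fun _ _ => Nat.zero_le _) (Finset.mem_range.2 k.2))
  · intro x _ y _ h
    obtain ⟨h1, h2⟩ := Prod.mk.inj h
    refine ext_row (fun k => ?_) (funext fun k => ?_)
    · by_cases hk : k < r
      · exact congrFun h1 ⟨k, hk⟩
      · rw [row_eq_zero _ (by omega), row_eq_zero _ (by omega)]
    · by_cases hk : k < r + 1
      · exact congrFun h2 ⟨k, hk⟩
      · rw [x.block_eq_empty _ (by omega), y.block_eq_empty _ (by omega)]

/-! ### The numerical coefficients -/

/-- The coefficient `a(j,s)` as a function of the totals `d_k = ∑_l j_{k+1,l}` of the rows and the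
sizes `b_k = s_k` of the blocks. -/
def coeffOf (r : ℕ) (d b : ℕ → ℕ) : ℚ :=
  ∏ p ∈ Finset.range (r + 1), ((b p).factorial : ℚ) / ∏ q ∈ Finset.range (b p + 1),
    ((max 1 (q + (∑ k ∈ Finset.Ico p r, d k + ∑ k ∈ Finset.Ico (p + 1) (r + 1), b k)) : ℕ) : ℚ)

theorem coeff_eq (x : T r s) :
    x.coeff = coeffOf r (fun k => total (x.row k)) (fun k => (x.block k).card) := by
  rw [coeff, coeffOf, Finset.prod_div_distrib]
  congr 1
  refine Finset.prod_nbij' (fun p => p - 1) (fun p => p + 1) ?_ ?_ ?_ ?_ ?_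
  · intro p hp
    rw [Finset.mem_Icc] at hp
    exact Finset.mem_range.2 (by omega)
  · intro p hp
    rw [Finset.mem_range] at hp
    exact Finset.mem_Icc.2 (by omega)
  · intro p hp
    rw [Finset.mem_Icc] at hp
    exact Nat.sub_add_cancel hp.1
  · intro p _
    rfl
  · intro p hp
    obtain ⟨m, rfl⟩ := Nat.exists_eq_add_of_le' (Finset.mem_Icc.1 hp).1
    have h1 : (x.j.sum fun kl n => if m + 1 ≤ (kl.1 : ℕ) then n else 0) =
        ∑ k ∈ Finset.Ico m r, total (x.row k) := by
      rw [x.sum_eq_sum_row (fun kl n => if m + 1 ≤ (kl.1 : ℕ) then n else 0) (fun _ => ite_self _)]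
      have h2 : ∀ k ∈ Finset.range r, ((x.row k).sum fun l n =>
          if m + 1 ≤ ((k.succPNat, l).1 : ℕ) then n else 0) =
            if m ≤ k then total (x.row k) else 0 := by
        intro k _
        have h3 : m + 1 ≤ (k.succPNat : ℕ) ↔ m ≤ k := Nat.succ_le_succ_iff
        simp only [h3]
        split_ifs
        · rfl
        · exact Finset.sum_const_zero
      rw [Finset.sum_congr rfl h2, ← Finset.sum_filter]
      refine Finset.sum_congr (Finset.ext fun k => ?_) fun _ _ => rfl
      rw [Finset.mem_filter, Finset.mem_range, Finset.mem_Ico, and_comm]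
    have h2 : Finset.Icc (m + 1) r = Finset.Ico (m + 1) (r + 1) := by
      ext k
      rw [Finset.mem_Icc, Finset.mem_Ico, Nat.lt_succ_iff]
    rw [h1, h2, Nat.add_sub_cancel]
    simp only [add_assoc]

/-- Decreasing `b_0` by one affects only the factor `p = 0`, whose last denominator is the weight. -/
theorem coeffOf_erase (r : ℕ) (d : ℕ → ℕ) {b b' : ℕ → ℕ} (h0 : b 0 = b' 0 + 1)
    (hs : ∀ k, b (k + 1) = b' (k + 1)) :
    ((∑ k ∈ Finset.range (r + 1), b k + ∑ k ∈ Finset.range r, d k : ℕ) : ℚ) * coeffOf r d b =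
      (b 0 : ℚ) * coeffOf r d b' := by
  have hb : ∀ m, ∑ k ∈ Finset.Ico (m + 1) (r + 1), b k = ∑ k ∈ Finset.Ico (m + 1) (r + 1), b' k :=
    fun m => Finset.sum_congr rfl fun k hk => by
      obtain ⟨k, rfl⟩ := Nat.exists_eq_add_of_le' (le_trans (Nat.succ_le_succ m.zero_le)
        (Finset.mem_Ico.1 hk).1)
      exact hs k
  have hN : ∑ k ∈ Finset.range (r + 1), b k + ∑ k ∈ Finset.range r, d k =
      b' 0 + 1 + (∑ k ∈ Finset.Ico 0 r, d k + ∑ k ∈ Finset.Ico (0 + 1) (r + 1), b' k) := by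
    rw [← hb, Finset.range_eq_Ico, ← Finset.sum_Ico_consecutive b (Nat.zero_le 1) (Nat.le_add_left 1 r),
      ← Finset.range_eq_Ico, Finset.sum_range_one, h0, Finset.range_eq_Ico]
    ring
  rw [hN, coeffOf, coeffOf, Finset.prod_range_succ', Finset.prod_range_succ' _ r]
  simp only [hb, hs]
  rw [h0, Finset.prod_range_succ _ (b' 0 + 1), Nat.factorial_succ,
    max_eq_right (by omega : 1 ≤ b' 0 + 1 +
      (∑ k ∈ Finset.Ico 0 r, d k + ∑ k ∈ Finset.Ico (0 + 1) (r + 1), b' k))]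
  have h1 : ((b' 0 + 1 + (∑ k ∈ Finset.Ico 0 r, d k +
      ∑ k ∈ Finset.Ico (0 + 1) (r + 1), b' k) : ℕ) : ℚ) ≠ 0 := Nat.cast_ne_zero.2 (by omega)
  generalize ((b' 0 + 1 + (∑ k ∈ Finset.Ico 0 r, d k +
      ∑ k ∈ Finset.Ico (0 + 1) (r + 1), b' k) : ℕ) : ℚ) = N at h1
  have h2 : ∀ P a Q : ℚ, N * (P * (a / N * Q)) = a * (P * Q) := fun P a Q => by field_simp
  rw [mul_comm _ N, Nat.cast_mul, mul_div_mul_comm, h2]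

/-- If `b_0 = 0`, the factor `p = 0` is the inverse of the weight and the others are the factors for the
shifted sequences. -/
theorem coeffOf_cons (r : ℕ) {d b d' b' : ℕ → ℕ} (h0 : b 0 = 0) (hs : ∀ k, b (k + 1) = b' k)
    (hd : ∀ k, d (k + 1) = d' k)
    (hN : ∑ k ∈ Finset.range (r + 2), b k + ∑ k ∈ Finset.range (r + 1), d k ≠ 0) :
    ((∑ k ∈ Finset.range (r + 2), b k + ∑ k ∈ Finset.range (r + 1), d k : ℕ) : ℚ) *
      coeffOf (r + 1) d b = coeffOf r d' b' := by
  have hb1 : ∀ m n, ∑ k ∈ Finset.Ico (m + 1) (n + 1), b k = ∑ k ∈ Finset.Ico m n, b' k :=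
    fun m n => by
      rw [← Finset.sum_Ico_add']
      exact Finset.sum_congr rfl fun k _ => hs k
  have hd1 : ∀ m n, ∑ k ∈ Finset.Ico (m + 1) (n + 1), d k = ∑ k ∈ Finset.Ico m n, d' k :=
    fun m n => by
      rw [← Finset.sum_Ico_add']
      exact Finset.sum_congr rfl fun k _ => hd k
  have hN1 : ∑ k ∈ Finset.range (r + 2), b k + ∑ k ∈ Finset.range (r + 1), d k =
      ∑ k ∈ Finset.Ico 0 (r + 1), d k + ∑ k ∈ Finset.Ico (0 + 1) (r + 2), b k := by
    rw [Finset.sum_range_succ' b, h0, add_zero, hb1, Finset.range_eq_Ico, add_comm]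
    simp only [hs]
  rw [hN1] at hN ⊢
  rw [coeffOf, Finset.prod_range_succ', h0, zero_add, Finset.prod_range_one, zero_add,
    max_eq_right (Nat.one_le_iff_ne_zero.2 hN), Nat.factorial_zero, Nat.cast_one,
    mul_left_comm, mul_one_div_cancel (Nat.cast_ne_zero.2 hN), mul_one, coeffOf]
  refine Finset.prod_congr rfl fun p _ => ?_
  rw [hs, hd1, hb1]

/-! ### Lists of pairs -/

theorem pairs_eq (x : T r s) : x.pairs = ((x.block 0).sort.map fun i => (0, i)) ++
    (List.range r).flatMap fun k => (x.block (k + 1)).sort.map fun i => (k + 1, i) := by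
  rw [pairs, List.range_succ_eq_map, List.flatMap_cons, List.flatMap_map]

theorem pairs_perm (x : T r (s + 1)) (l : ℕ+) (hl : l ∈ x.block 0) :
    ((0, l) :: (x.erase l hl).pairs).Perm x.pairs := by
  rw [pairs_eq, pairs_eq, ← List.cons_append]
  simp only [block_erase_zero, block_erase_succ]
  refine List.Perm.append_right _ ?_
  refine List.Perm.map (fun i => (0, i)) (l₁ := l :: ((x.block 0).erase l).sort) ?_
  refine (List.perm_ext_iff_of_nodup ?_ (Finset.sort_nodup _ _)).2 fun a => ?_
  · exact List.nodup_cons.2 ⟨by simp, Finset.sort_nodup _ _⟩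
  · by_cases h : a = l
    · simp [h, hl]
    · simp [h]

theorem pairs_cons (p : (ℕ+ →₀ ℕ) × T r s) :
    (cons p).pairs = p.2.pairs.map fun q => (q.1 + 1, q.2) := by
  rw [pairs_eq, block_cons_zero, Finset.sort_empty, List.map_nil, List.nil_append, pairs,
    List.map_flatMap]
  simp only [List.map_map]
  rfl

end BHdR.T

/-! ### The summands of the explicit formula -/

namespace BHdR.T

open B0 (zetaOps zetaOp hWord hOp IsHom kap filt)

variable {r s : ℕ}

/-- The summand with index `x` as an element of `B₀`: the denominators `θ_i` are cancelled. -/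
def term (x : T r s) : B0 :=
  (MvPolynomial.C x.coeff : ThetaPoly) • zetaOps x.pairs (hWord 0 r x.row)

theorem weight_eq (x : T r s) : x.weight =
    ∑ k ∈ Finset.range (r + 1), (x.block k).card + ∑ k ∈ Finset.range r, total (x.row k) :=
  congrArg (· + ∑ k ∈ Finset.range r, total (x.row k)) x.sum_card.symm

theorem isHom_term (x : T r s) : IsHom x.weight x.term := by
  have h := ((B0.isHom_hWord 0 r x.row).zetaOps x.pairs).smul (MvPolynomial.C x.coeff)
  rw [length_pairs] at h
  exact h

theorem kap_term (x : T r s) : kap x.term = x.term := by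
  rw [term, map_smul, B0.kap_zetaOps, B0.kap_hWord]

/-- The operator `ζ_{0,l} (e_l ∧ ·)` kills a summand that already contains `ζ_{0,l}`. -/
theorem zetaOp_term {x : T r s} {l : ℕ+} (hl : l ∈ x.block 0) : zetaOp (0, l) x.term = 0 := by
  have hp : ((0, l) :: x.pairs.erase (0, l)).Perm x.pairs :=
    (List.perm_cons_erase (mem_pairs (p := (0, l)) hl)).symm
  rw [term, map_smul, ← B0.zetaOps_perm hp, B0.zetaOps_cons, B0.zetaOp_self, smul_zero]

theorem term_mem_filt {x : T r s} {n : ℕ} (hx : ¬ (x.weight ≤ n ∧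
    (∀ k l, x.row k l ≠ 0 → (l : ℕ) ≤ n) ∧ ∀ k, ∀ l ∈ x.block k, (l : ℕ) ≤ n)) :
    x.term ∈ filt n := by
  by_cases h1 : x.weight ≤ n
  · refine Submodule.mem_sup_right ?_
    rw [term, B0.theta_smul_eq]
    refine Ideal.mul_mem_left _ _ ?_
    by_cases h2 : ∀ k l, x.row k l ≠ 0 → (l : ℕ) ≤ n
    · have h3 : ¬ ∀ k, ∀ l ∈ x.block k, (l : ℕ) ≤ n := fun h3 => hx ⟨h1, h2, h3⟩
      push Not at h3
      obtain ⟨k, l, hl, hn⟩ := h3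
      exact B0.zetaOps_mem_idealJ (mem_pairs (p := (k, l)) hl) hn.le _
    · push Not at h2
      obtain ⟨k, l, hl, hn⟩ := h2
      refine B0.zetaOps_idealJ _ (B0.hWord_mem_idealJ (k := k) ?_ hl hn.le)
      by_contra hk
      rw [x.row_eq_zero (by omega)] at hl
      exact hl rfl
  · exact Submodule.mem_sup_left (Ideal.pow_le_pow_right (by omega) x.isHom_term.mem)

theorem finite_term (r s n : ℕ) : {x : T r s | x.term ∉ filt n}.Finite :=
  (finite_of_bounded n).subset fun _ hx => not_not.1 fun h => hx (term_mem_filt h)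

/-- The coefficients satisfy `N a(x) = ∑_{l ∈ block 0} a(x \ l)`, where `N` is the weight of `x`. -/
theorem weight_smul_term_of_succ (x : T r (s + 1)) (hx : (x.block 0).Nonempty) :
    x.weight • x.term = ∑ l : {l // l ∈ x.block 0}, zetaOp (0, l.1) (x.erase l.1 l.2).term := by
  have h1 : ∀ l : {l // l ∈ x.block 0}, zetaOp (0, l.1) (x.erase l.1 l.2).term =
      (MvPolynomial.C (x.erase l.1 l.2).coeff : ThetaPoly) •
        zetaOps x.pairs (hWord 0 r x.row) := by
    intro l
    rw [term, map_smul, ← B0.zetaOps_cons, B0.zetaOps_perm (x.pairs_perm l.1 l.2)]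
    rfl
  have h2 : ∀ l : {l // l ∈ x.block 0}, (x.weight : ℚ) * x.coeff =
      ((x.block 0).card : ℚ) * (x.erase l.1 l.2).coeff := by
    intro l
    rw [coeff_eq, coeff_eq, weight_eq]
    refine coeffOf_erase r _ ?_ fun k => ?_
    · rw [block_erase_zero]
      exact (Finset.card_erase_add_one l.2).symm
    · rw [block_erase_succ]
  have hc : ((x.block 0).card : ℚ) ≠ 0 := Nat.cast_ne_zero.2 (Finset.card_ne_zero.2 hx)
  rw [Finset.sum_congr rfl fun l _ => h1 l, ← Finset.sum_smul, ← map_sum, term,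
    ← Nat.cast_smul_eq_nsmul ThetaPoly, smul_smul]
  congr 1
  rw [← map_natCast (MvPolynomial.C (σ := ℕ+) (R := ℚ)), ← map_mul]
  congr 1
  have h3 : ∀ l : {l // l ∈ x.block 0}, (x.erase l.1 l.2).coeff =
      (x.weight : ℚ) * x.coeff / (x.block 0).card := fun l => by
    rw [h2 l, mul_div_cancel_left₀ _ hc]
  rw [Finset.sum_congr rfl fun l _ => h3 l, Finset.sum_const, Finset.card_univ, Fintype.card_coe,
    nsmul_eq_mul, mul_div_cancel₀ _ hc]

/-- For an index with empty block `0`, multiplication by the weight removes the first row. -/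
theorem weight_smul_term_cons (p : (ℕ+ →₀ ℕ) × T r s) :
    (cons p).weight • (cons p).term = (-1 : ℤ) ^ s • hOp 1 p.1 (B0.shift 0 p.2.term) := by
  by_cases hN : (cons p).weight = 0
  · have h0 : p.1 = 0 := by
      rw [weight, Finset.sum_range_succ', row_cons_zero] at hN
      exact total_eq_zero (by omega)
    rw [hN, zero_smul, h0, B0.hOp_zero, smul_zero]
  · have hc : ((cons p).weight : ℚ) * (cons p).coeff = p.2.coeff := by
      rw [weight_eq] at hN ⊢
      rw [coeff_eq, coeff_eq]
      exact coeffOf_cons r rfl (fun k => rfl) (fun k => by rw [row_cons_succ]) hN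
    have hw : hWord 0 (r + 1) (cons p).row = hOp 1 p.1 (hWord 1 r p.2.row) := by
      rw [hWord, row_cons_zero]
      simp only [row_cons_succ]
      rfl
    have hp : p.2.pairs.length = s := length_pairs _
    rw [term, ← Nat.cast_smul_eq_nsmul ThetaPoly, smul_smul,
      ← map_natCast (MvPolynomial.C (σ := ℕ+) (R := ℚ)), ← map_mul, hc, hw, pairs_cons,
      B0.zetaOps_hOp, List.length_map, hp, term, map_smul, B0.shift_zetaOps, B0.shift_hWord,
      map_smul, smul_comm]

theorem weight_eq_zero_of_block {x : T 0 s} (hx : x.block 0 = ∅) : x.weight = 0 := by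
  have h := x.sum_card
  rw [zero_add, Finset.sum_range_one, hx, Finset.card_empty] at h
  exact h.symm

theorem block_eq_empty_of_zero (x : T r 0) : x.block 0 = ∅ := by
  have h := Finset.sum_eq_zero_iff.1 x.sum_card 0 (Finset.mem_range.2 (Nat.succ_pos r))
  exact Finset.card_eq_zero.1 h

/-- A summand of weight zero has no `ζ` and vanishing rows, hence is zero unless there are no rows. -/
theorem pi0_term (x : T r s) (h : r ≠ 0 ∨ s ≠ 0) : B0.pi0 x.term = 0 := by
  by_cases hN : x.weight = 0
  · rw [weight] at hN
    rcases r with _ | r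
    · omega
    · have h0 : x.row 0 = 0 := by
        rw [Finset.sum_range_succ'] at hN
        exact total_eq_zero (by omega)
      rw [term, hWord, h0, B0.hOp_zero, map_zero, smul_zero, map_zero]
  · rw [x.isHom_term.pi0_eq, if_neg hN]

theorem thetaOp_term (x : T 0 0) : B0.thetaOp x.term = 0 := by
  have hp : x.pairs = [] := List.length_eq_zero_iff.1 x.length_pairs
  rw [term, hp, map_smul]
  change _ • B0.thetaOp (B0.e ∅) = 0
  rw [B0.thetaOp_e, Finset.sum_empty, smul_zero]

end BHdR.T

namespace B1

open BHdR (T)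

theorem proj_of_eq_zero {n : ℕ} {x : B0} (hx : x ∈ B0.filt n) : proj n (of x) = 0 :=
  Ideal.Quotient.eq_zero_iff_mem.2 hx

/-! ### The exponential as a sum of divided powers -/

/-- A family is summable as soon as, for each `n`, all but finitely many of its members come from
`ℐ^n + 𝒥_n`. -/
theorem summable_of_subset {ι : Type*} {f : ι → B0} {S : ℕ → Set ι} (hS : ∀ n, (S n).Finite)
    (h : ∀ n, ∀ i ∉ S n, f i ∈ B0.filt n) : Summable fun i => of (f i) :=
  summable_of_finite fun n => (hS n).subset fun i hi => by
    by_contra hn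
    exact hi (proj_of_eq_zero (h n i hn))

/-- The indices `j` of the divided powers which need not lie in `ℐ^n + 𝒥_n`. -/
def smallIndex (n : ℕ) : Set (ℕ+ →₀ ℕ) :=
  {j | (∀ l, j l ≠ 0 → l ∈ {l : ℕ+ | (l : ℕ) ≤ n}) ∧ total j ≤ n}

theorem finite_le (n : ℕ) : {l : ℕ+ | (l : ℕ) ≤ n}.Finite :=
  (Set.finite_Iio (⟨n + 1, n.succ_pos⟩ : ℕ+)).subset fun _ hl => Nat.lt_succ_of_le hl

theorem finite_smallIndex (n : ℕ) : (smallIndex n).Finite := finite_finsupp _ (finite_le n) n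

theorem divPow_mem_filt (k : ℕ+) {j : ℕ+ →₀ ℕ} {n : ℕ} (hj : j ∉ smallIndex n) :
    B0.ofAbar (B0.divPow k j) ∈ B0.filt n := by
  by_cases h1 : total j ≤ n
  · have h2 : ¬ ∀ l, j l ≠ 0 → (l : ℕ) ≤ n := fun h2 => hj ⟨h2, h1⟩
    push Not at h2
    obtain ⟨l, hl, hn⟩ := h2
    exact Submodule.mem_sup_right (B0.divPow_mem_idealJ k hl hn.le)
  · exact Submodule.mem_sup_left (Ideal.pow_le_pow_right (not_le.1 h1).le (B0.isHom_divPow k j).mem)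

theorem hOp_mem_filt (k : ℕ+) {j : ℕ+ →₀ ℕ} {n : ℕ} (hj : j ∉ smallIndex n) (x : B0) :
    B0.hOp k j x ∈ B0.filt n := by
  rw [B0.hOp_apply]
  refine sum_mem fun i hi => Ideal.mul_mem_right _ _ ?_
  by_cases h1 : total j ≤ n
  · have h2 : ¬ ∀ l, j l ≠ 0 → (l : ℕ) ≤ n := fun h2 => hj ⟨h2, h1⟩
    push Not at h2
    obtain ⟨l, hl, hn⟩ := h2
    exact Submodule.mem_sup_right (B0.divCoeff_mem_idealJ k hl hn.le i)
  · exact Submodule.mem_sup_left (Ideal.pow_le_pow_right (not_le.1 h1).le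
      (B0.isHom_divCoeff k (Finsupp.mem_support_iff.1 hi)).mem)

theorem hOp_filt (k : ℕ+) (j : ℕ+ →₀ ℕ) {n : ℕ} {x : B0} (hx : x ∈ B0.filt n) :
    B0.hOp k j x ∈ B0.filt n := by
  rw [B0.hOp_apply]
  exact sum_mem fun i _ => Ideal.mul_mem_left _ _ (B0.eps_filt i hx)

/-- Reindexing of a sum over pairs `(i, j')` by `j = j' + δ_i`. -/
theorem hasSum_sub_single {F : ℕ+ × (ℕ+ →₀ ℕ) → B1} {y : B1} (hF : HasSum F y) :
    HasSum (fun j : ℕ+ →₀ ℕ => ∑ i ∈ j.support, F (i, j - Finsupp.single i 1)) y := by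
  let e : (Σ j : ℕ+ →₀ ℕ, {i // i ∈ j.support}) ≃ ℕ+ × (ℕ+ →₀ ℕ) :=
    { toFun := fun p => (p.2.1, p.1 - Finsupp.single p.2.1 1)
      invFun := fun q => ⟨q.2 + Finsupp.single q.1 1, q.1, by simp⟩
      left_inv := by
        rintro ⟨j, i, hi⟩
        have h := B0.sub_single_add (Finsupp.mem_support_iff.1 hi)
        refine Sigma.ext h ?_
        dsimp only
        congr! 
      right_inv := by
        rintro ⟨i, j⟩
        exact Prod.ext rfl (add_tsub_cancel_right _ _) }
  refine HasSum.sigma (e.hasSum_iff.2 hF) fun j => ?_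
  rw [← Finset.sum_coe_sort]
  exact hasSum_fintype _

/-- A summable family indexed by a product is summed by first summing over the second index. -/
theorem hasSum_prod {β γ : Type*} {F : β × γ → B1} {g : β → B1} {y : B1} (hF : Summable F)
    (h1 : ∀ b, HasSum (fun c => F (b, c)) (g b)) (h2 : HasSum g y) : HasSum F y := by
  rw [← (hF.hasSum.prod_fiberwise h1).unique h2]
  exact hF.hasSum

/-- The divided powers satisfy the Euler equation `|j| (θh)^{[j]} = ∑_i θ_i h_i (θh)^{[j - δ_i]}`
which characterizes the exponential. -/
theorem total_smul_divPow (k : ℕ+) (j : ℕ+ →₀ ℕ) :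
    total j • B0.ofAbar (B0.divPow k j) = ∑ i ∈ j.support, B0.theta i * B0.h k i *
      B0.ofAbar (B0.divPow k (j - Finsupp.single i 1)) := by
  rw [total, Finsupp.sum, Finset.sum_smul]
  refine Finset.sum_congr rfl fun i hi => ?_
  have h := congrArg B0.ofAbar (B0.theta_mul_divCoeff k (Finsupp.mem_support_iff.1 hi))
  rw [B0.divCoeff, map_mul, map_mul, ← mul_assoc, Nat.cast_smul_eq_nsmul, map_nsmul] at h
  exact h.symm

/-- `exp(∑_l θ_l h_{1,l})` is the sum of the divided powers: both solve `𝓔 w = (∑_l θ_l h_{1,l}) w`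
with weight-zero part `1`. -/
theorem hasSum_exp : HasSum (fun j => of (B0.ofAbar (B0.divPow 1 j))) expThetaH := by
  obtain ⟨w, hw⟩ : Summable (fun j => of (B0.ofAbar (B0.divPow 1 j))) :=
    summable_of_subset finite_smallIndex fun n j hj => divPow_mem_filt 1 hj
  -- expand `∑_l θ_l h_{1,l}` as well and collect the pairs `(i, j')` with `j' + δ_i = j`
  have hF : HasSum (fun p : ℕ+ × (ℕ+ →₀ ℕ) => of (B0.theta p.1 * B0.h 1 p.1) *
      of (B0.ofAbar (B0.divPow 1 p.2))) (thetaH * w) := by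
    refine hasSum_prod (g := fun i => of (B0.theta i * B0.h 1 i) * w) ?_ (fun i => ?_)
      (hasSum_thetaH.mul_right w)
    rotate_left
    · exact hw.mul_left (of (B0.theta i * B0.h 1 i))
    simp only [← map_mul of]
    refine summable_of_subset (fun n => (finite_le n).prod (finite_smallIndex n)) fun n p hp => ?_
    rw [Set.mem_prod, not_and_or] at hp
    rcases hp with hp | hp
    · refine Ideal.mul_mem_right _ _ (Ideal.mul_mem_right _ _ (Submodule.mem_sup_right ?_))
      exact B0.theta_mem (not_le.1 hp).le
    · exact Ideal.mul_mem_left _ _ (divPow_mem_filt 1 hp)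
  have h1 : eul w = thetaH * w := by
    refine (hw.map eul continuous_eul).unique (hasSum_of_eq (fun j => ?_) (hasSum_sub_single hF))
    change eul (of _) = _
    rw [eul_of, (B0.isHom_divPow 1 j).eul_eq, total_smul_divPow, map_sum]
    simp only [map_mul]
  have h2 : pi0 w = 1 := by
    refine (hw.map pi0 continuous_pi0).unique (hasSum_of_eq (g := fun j => if j = 0 then 1 else 0)
      (fun j => ?_) (hasSum_ite_eq 0 1))
    change pi0 (of _) = _
    rw [pi0_of, (B0.isHom_divPow 1 j).pi0_eq]
    split_ifs with h3 h4 h4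
    · rw [h4, B0.divPow, Finsupp.prod_zero_index, map_one, map_one]
    · exact absurd (total_eq_zero h3) h4
    · exact absurd (by rw [h4, Finsupp.sum_zero_index]) h3
    · exact map_zero _
  have h3 : w - expThetaH = 0 := by
    refine eq_zero_of_eul_eq (v := thetaH) (thetaSum_mem _) ?_ ?_
    · rw [map_sub, h1, eul_exp, mul_sub]
    · rw [map_sub, h2, pi0_exp, sub_self]
  rw [← sub_eq_zero.1 h3]
  exact hw

/-- `Y_1 exp(∑_l θ_l h_{1,l})` as a sum of the operators entering the explicit formula. -/
theorem hasSum_Y_exp (u : B1) : HasSum (fun j : ℕ+ →₀ ℕ => ∑ i ∈ j.support,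
    of (B0.ofAbar (B0.divCoeff 1 j i)) * eps i u) (Y 1 (expThetaH * u)) := by
  have hF : HasSum (fun p : ℕ+ × (ℕ+ →₀ ℕ) => of (B0.h 1 p.1) *
      (of (B0.ofAbar (B0.divPow 1 p.2)) * eps p.1 u)) (Y 1 (expThetaH * u)) := by
    refine hasSum_prod (g := fun i => of (B0.h 1 i) * (expThetaH * eps i u)) ?_ (fun i => ?_)
      (hasSum_of_eq (fun i => ?_) (hasSum_Y 1 (expThetaH * u)))
    · refine summable_of_finite fun n =>
        ((finite_le n).prod (finite_smallIndex n)).subset fun p hp => ?_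
      by_contra hn
      refine hp ?_
      rw [Set.mem_prod, not_and_or] at hn
      rw [map_mul, map_mul]
      rcases hn with hn | hn
      · rw [proj_of_eq_zero (Submodule.mem_sup_right (B0.h_mem (le_add_left (not_le.1 hn).le))),
          zero_mul]
      · rw [proj_of_eq_zero (divPow_mem_filt 1 hn), zero_mul, mul_zero]
    · exact (hasSum_exp.mul_right (eps i u)).mul_left (of (B0.h 1 i))
    · rw [eps_exp_mul]
  refine hasSum_of_eq (fun j => Finset.sum_congr rfl fun i _ => ?_) (hasSum_sub_single hF)
  rw [B0.divCoeff, map_mul, map_mul, mul_assoc]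
  rfl

/-! ### The explicit solution -/

theorem summable_term (r s : ℕ) : Summable fun x : T r s => of x.term :=
  summable_of_finite fun n => (T.finite_term r s n).subset fun _ hx h => hx (proj_of_eq_zero h)

/-- The value at `(r,s)` of the explicit solution, for `r, s ≥ 0`. -/
def solNat (r s : ℕ) : B1 := ∑' x : T r s, of x.term

theorem hasSum_solNat (r s : ℕ) : HasSum (fun x : T r s => of x.term) (solNat r s) :=
  (summable_term r s).hasSum

/-- `X_0` applied to the sum for `(r,s)`: pairs of an index `l` and an element of `T(r,s)` correspond to
an element of `T(r,s+1)` with a marked element of its block `0`, up to pairs with vanishing term. -/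
theorem hasSum_X_solNat (r s : ℕ) : HasSum (fun x : T r (s + 1) =>
    of (∑ l : {l // l ∈ x.block 0}, B0.zetaOp (0, l.1) (x.erase l.1 l.2).term))
    (X 0 (solNat r s)) := by
  have hF : HasSum (fun p : ℕ+ × T r s => of (B0.zetaOp (0, p.1) p.2.term))
      (X 0 (solNat r s)) := by
    refine hasSum_prod ?_ (fun l => ?_) (hasSum_X 0 (solNat r s))
    · refine summable_of_subset (fun n => (finite_le n).prod (T.finite_term r s n)) fun n p hp => ?_
      rw [Set.mem_prod, not_and_or] at hp
      rw [B0.zetaOp_apply]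
      rcases hp with hp | hp
      · exact Submodule.mem_sup_right (Ideal.mul_mem_right _ _
          (B0.zeta_mem (le_add_left (not_le.1 hp).le)))
      · exact Ideal.mul_mem_left _ _ (B0.eps_filt _ (not_not.1 hp))
    · refine hasSum_of_eq (fun y => ?_)
        (((hasSum_solNat r s).map (eps l) (continuous_eps l)).mul_left (of (B0.zeta 0 l)))
      change _ = of _ * eps l (of _)
      rw [eps_of, ← map_mul]
      rfl
  refine HasSum.sigma ((T.eraseMap_injective.hasSum_iff ?_).2 hF) fun x => ?_
  · rintro ⟨l, y⟩ hy
    have hl : l ∈ y.block 0 := by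
      by_contra hl
      exact hy ⟨⟨y.insert l hl, l, y.mem_block_insert l hl⟩, Prod.ext rfl (y.erase_insert l hl)⟩
    exact (congrArg of (T.zetaOp_term hl)).trans (map_zero of)
  · rw [map_sum]
    exact hasSum_fintype _

theorem hasSum_Y_solNat (r s : ℕ) : HasSum
    (fun p : (ℕ+ →₀ ℕ) × T r s => of (B0.hOp 1 p.1 (B0.shift 0 p.2.term)))
    (Y 1 (delta 0 (solNat r s))) := by
  rw [delta_zero]
  refine hasSum_prod ?_ (fun j => ?_) (hasSum_Y_exp (shift 0 (solNat r s)))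
  · refine summable_of_subset
      -- the shift lowers the filtration by at most one
      (fun n => (finite_smallIndex n).prod (T.finite_term r s (n + 1))) fun n p hp => ?_
    rw [Set.mem_prod, not_and_or] at hp
    rcases hp with hp | hp
    · exact hOp_mem_filt 1 hp _
    · exact hOp_filt 1 _ (B0.shift_filt 0 (not_not.1 hp))
  · have h : ∀ i, HasSum (fun y : T r s => of (B0.ofAbar (B0.divCoeff 1 j i)) *
        eps i (shift 0 (of y.term)))
        (of (B0.ofAbar (B0.divCoeff 1 j i)) * eps i (shift 0 (solNat r s))) := fun i =>
      (((hasSum_solNat r s).map (shift 0) (continuous_shift 0)).map (eps i)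
        (continuous_eps i)).mul_left _
    refine hasSum_of_eq (fun y => ?_) (hasSum_sum (s := j.support) fun i _ => h i)
    rw [B0.hOp_apply, map_sum]
    simp only [map_mul, shift_of, eps_of]

/-- The part of the Euler recursion which comes from the indices with empty block `0`. -/
theorem hasSum_of_block_empty (r s : ℕ) : HasSum
    (fun x : T (r + 1) s => if x.block 0 = ∅ then of (x.weight • x.term) else 0)
    ((-1 : ℤ) ^ s • Y 1 (delta 0 (solNat r s))) := by
  refine (T.cons_injective.hasSum_iff fun x hx => if_neg fun h => hx (T.exists_cons h)).1 ?_
  refine hasSum_of_eq (fun p => ?_) ((hasSum_Y_solNat r s).const_smul ((-1 : ℤ) ^ s))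
  rw [Function.comp_apply, if_pos (T.block_cons_zero p), T.weight_smul_term_cons, map_zsmul]

theorem hasSum_eul_solNat (r s : ℕ) :
    HasSum (fun x : T r s => of (x.weight • x.term)) (eul (solNat r s)) := by
  refine hasSum_of_eq (fun x => ?_) ((hasSum_solNat r s).map eul continuous_eul)
  change _ = eul (of _)
  rw [eul_of, x.isHom_term.eul_eq]

theorem hasSum_of_block_nonempty (r s : ℕ) : HasSum
    (fun x : T r (s + 1) => if x.block 0 = ∅ then 0 else of (x.weight • x.term))
    (X 0 (solNat r s)) := by
  refine hasSum_of_eq (fun x => ?_) (hasSum_X_solNat r s)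
  split_ifs with h
  · have : IsEmpty {l // l ∈ x.block 0} := ⟨fun l => by simpa [h] using l.2⟩
    rw [Finset.univ_eq_empty, Finset.sum_empty, map_zero]
  · rw [T.weight_smul_term_of_succ x (Finset.nonempty_iff_ne_empty.2 h)]

theorem eul_solNat_zero_zero : eul (solNat 0 0) = 0 := by
  refine (hasSum_eul_solNat 0 0).unique (hasSum_of_eq (fun x => ?_) hasSum_zero)
  rw [T.weight_eq_zero_of_block x.block_eq_empty_of_zero, zero_smul, map_zero]

theorem eul_solNat_zero_succ (s : ℕ) : eul (solNat 0 (s + 1)) = X 0 (solNat 0 s) := by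
  refine (hasSum_eul_solNat 0 (s + 1)).unique
    (hasSum_of_eq (fun x => ?_) (hasSum_of_block_nonempty 0 s))
  split_ifs with h
  · rw [T.weight_eq_zero_of_block h, zero_smul, map_zero]
  · rfl

theorem eul_solNat_succ_zero (r : ℕ) :
    eul (solNat (r + 1) 0) = (-1 : ℤ) ^ 0 • Y 1 (delta 0 (solNat r 0)) := by
  refine (hasSum_eul_solNat (r + 1) 0).unique
    (hasSum_of_eq (fun x => ?_) (hasSum_of_block_empty r 0))
  rw [if_pos x.block_eq_empty_of_zero]

theorem eul_solNat_succ_succ (r s : ℕ) : eul (solNat (r + 1) (s + 1)) =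
    X 0 (solNat (r + 1) s) + (-1 : ℤ) ^ (s + 1) • Y 1 (delta 0 (solNat r (s + 1))) := by
  refine (hasSum_eul_solNat (r + 1) (s + 1)).unique (hasSum_of_eq (fun x => ?_)
    ((hasSum_of_block_nonempty (r + 1) s).add (hasSum_of_block_empty r (s + 1))))
  split_ifs
  · rw [zero_add]
  · rw [add_zero]

theorem kap_solNat (r s : ℕ) : kap (solNat r s) = solNat r s := by
  refine ((hasSum_solNat r s).map kap continuous_kap).unique
    (hasSum_of_eq (fun x => ?_) (hasSum_solNat r s))
  change kap (of _) = _
  rw [kap_of, x.kap_term]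

theorem pi0_solNat {r s : ℕ} (h : r ≠ 0 ∨ s ≠ 0) : pi0 (solNat r s) = 0 := by
  refine ((hasSum_solNat r s).map pi0 continuous_pi0).unique
    (hasSum_of_eq (fun x => ?_) hasSum_zero)
  change pi0 (of _) = _
  rw [pi0_of, x.pi0_term h, map_zero]

theorem thetaOp_pi0_solNat : thetaOp (pi0 (solNat 0 0)) = 0 := by
  rw [← pi0_thetaOp]
  have h : thetaOp (solNat 0 0) = 0 := by
    refine ((hasSum_solNat 0 0).map thetaOp continuous_thetaOp).unique
      (hasSum_of_eq (fun x => ?_) hasSum_zero)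
    change thetaOp (of _) = _
    rw [thetaOp_of, x.thetaOp_term, map_zero]
  rw [h, map_zero]

/-- The explicit solution on `ℤ × ℤ`, extended by zero from `r, s ≥ 0`. -/
def sol (r s : ℤ) : B1 := if 0 ≤ r ∧ 0 ≤ s then solNat r.toNat s.toNat else 0

theorem sol_natCast (r s : ℕ) : sol r s = solNat r s := if_pos ⟨r.cast_nonneg, s.cast_nonneg⟩

theorem sol_of_neg {r s : ℤ} (h : r < 0 ∨ s < 0) : sol r s = 0 :=
  if_neg fun h' => by omega

/-- Case distinction between the first quadrant and its complement, where the solution is zero. -/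
theorem sol_cases {P : ℤ → ℤ → Prop} (h1 : ∀ r s : ℕ, P r s)
    (h2 : ∀ r s : ℤ, r < 0 ∨ s < 0 → P r s) (r s : ℤ) : P r s := by
  by_cases h : r < 0 ∨ s < 0
  · exact h2 r s h
  · have := h1 r.toNat s.toNat
    rwa [Int.toNat_of_nonneg (by omega), Int.toNat_of_nonneg (by omega)] at this

/-- The Euler recursion that characterizes the solution. -/
theorem eul_sol (r s : ℤ) : eul (sol r s) =
    X 0 (sol r (s - 1)) + (s.negOnePow : ℤ) • Y 1 (delta 0 (sol (r - 1) s)) := by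
  refine sol_cases (P := fun r s => eul (sol r s) =
    X 0 (sol r (s - 1)) + (s.negOnePow : ℤ) • Y 1 (delta 0 (sol (r - 1) s))) ?_ ?_ r s
  · intro r s
    have hs : ((s : ℤ).negOnePow : ℤ) = (-1) ^ s := Int.coe_negOnePow_natCast s
    have hr0 : ∀ s : ℤ, sol (((0 : ℕ) : ℤ) - 1) s = 0 := fun s => sol_of_neg (by omega)
    have hs0 : ∀ r : ℤ, sol r (((0 : ℕ) : ℤ) - 1) = 0 := fun r => sol_of_neg (by omega)
    have hr1 : ∀ r s : ℕ, sol (((r + 1 : ℕ) : ℤ) - 1) s = solNat r s := fun r s => by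
      rw [← sol_natCast]; congr 1; omega
    have hs1 : ∀ r s : ℕ, sol r (((s + 1 : ℕ) : ℤ) - 1) = solNat r s := fun r s => by
      rw [← sol_natCast]; congr 1; omega
    rw [hs, sol_natCast]
    rcases r with _ | r <;> rcases s with _ | s
    · rw [hr0, hs0, eul_solNat_zero_zero]; simp
    · rw [hr0, hs1, eul_solNat_zero_succ]; simp
    · rw [hr1, hs0, eul_solNat_succ_zero, map_zero, zero_add]
    · rw [hr1, hs1, eul_solNat_succ_succ]
  · intro r s h
    rw [sol_of_neg h, sol_of_neg (r := r) (s := s - 1) (by omega),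
      sol_of_neg (r := r - 1) (s := s) (by omega)]
    simp

/-- The explicit solution satisfies the differential equation. -/
theorem defect_sol (n : ℕ) (s : ℤ) : nabla (sol n (s - 1)) +
    (s.negOnePow : ℤ) • altDelta n (sol (n - 1) s) - thetaOp (sol n s) = 0 := by
  refine defect_eq_zero eul_sol (fun r s => sol_of_neg) (fun r s => ?_) (fun r s => ?_) ?_ n s
  · refine sol_cases (P := fun r s => kap (sol r s) = sol r s) (fun r s => ?_) (fun r s h => ?_) r s
    · rw [sol_natCast, kap_solNat]
    · rw [sol_of_neg h, map_zero]
  · refine sol_cases (P := fun r s => r ≠ 0 ∨ s ≠ 0 → pi0 (sol r s) = 0) (fun r s h => ?_)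
      (fun r s h _ => ?_) r s
    · rw [sol_natCast, pi0_solNat (by omega)]
    · rw [sol_of_neg h, map_zero]
  · have := sol_natCast 0 0
    rw [Nat.cast_zero] at this
    rw [this, thetaOp_pi0_solNat]

end B1

/-! ### The explicit formula in the Higgs–de Rham ring -/

namespace BHdR

open B0 (zetaOps eList_sort eList_nil divPow divCoeff ofAbar)

theorem of_zsmul (c : ℤ) (u : B1) : of (c • u) = c • of u := map_zsmul of.toAddMonoidHom c u
theorem of_sum {ι : Type*} (S : Finset ι) (f : ι → B1) : of (∑ i ∈ S, f i) = ∑ i ∈ S, of (f i) :=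
  map_sum of.toAddMonoidHom f S

theorem of_eq_mk (u : B1) : of u = LocalizedModule.mk u 1 := rfl

variable {r s : ℕ}

/-- The monomial `θ^j h^{[j]}` is the product of the divided powers of the rows. -/
theorem T.thetaPow_smul_hDiv (x : T r s) :
    x.thetaPow • x.hDiv = ofAbar (∏ k : Fin r, divPow k.1.succPNat (x.row k)) := by
  rw [B0.theta_smul_eq, hDiv, ← map_mul]
  congr 1
  rw [thetaPow, map_finsuppProd, ← Finsupp.prod_mul,
    x.prod_eq_prod_row _ (fun p => by simp), ← Finset.prod_range fun k => divPow k.succPNat (x.row k)]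
  refine Finset.prod_congr rfl fun k _ => Finsupp.prod_congr fun l _ => ?_
  rw [map_pow, algebraMap_theta_X, mul_smul_comm, mul_pow]

/-- The summands of the explicit formula come from `B₀`: the denominators `θ_i` cancel against `θ^j`. -/
theorem phiCoeff_mul_hDiv (x : T r s) (i : Fin r → ℕ+) (hi : ∀ k : Fin r, x.row k (i k) ≠ 0) :
    phiCoeff x i * of (B1.of x.hDiv) = of (B1.of ((MvPolynomial.C x.coeff : ThetaPoly) •
      (ofAbar (∏ k : Fin r, divCoeff k.1.succPNat (x.row k) (i k)) *
        eList (x.pairs.map Prod.snd ++ List.ofFn i)))) := by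
  rw [phiCoeff, of_eq_mk, of_eq_mk, of_eq_mk, LocalizedModule.mk_smul_mk, LocalizedModule.mk_mul_mk,
    LocalizedModule.mk_eq]
  refine ⟨1, ?_⟩
  have hm : ((thetaProd i : thetaMonoid) : ThetaPoly) = ∏ k, MvPolynomial.X (i k) := rfl
  rw [one_smul, one_smul, one_smul, mul_one, mul_one, Submonoid.smul_def, hm, ← map_smul,
    ← map_smul, ← map_mul]
  congr 1
  have h1 : (∏ k, MvPolynomial.X (i k) : ThetaPoly) •
      ofAbar (∏ k : Fin r, divCoeff k.1.succPNat (x.row k) (i k)) =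
      (MvPolynomial.C (∏ k : Fin r, (x.j (k.1.succPNat, i k) : ℚ)) : ThetaPoly) •
        x.thetaPow • x.hDiv := by
    rw [T.thetaPow_smul_hDiv, B0.theta_smul_eq, ← map_mul, ← B0.ofAbar_rat_smul, map_prod,
      ← Finset.prod_mul_distrib, ← Finset.prod_smul]
    congr 1
    refine Finset.prod_congr rfl fun k _ => ?_
    rw [algebraMap_theta_X, B0.theta_mul_divCoeff _ (hi k)]
    rfl
  rw [smul_comm, ← smul_mul_assoc, h1, smul_mul_assoc, smul_mul_assoc, ← B0.eList_comm,
    mul_smul_comm, smul_smul, smul_smul, map_mul, mul_assoc]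

/-- The summands of the explicit formula are the images of the elements `T.term` of `B₀`. -/
theorem phiTerm_eq (x : T r s) : phiTerm r s x = of (B1.of x.term) := by
  have h1 : ∑ᶠ i : Fin r → ℕ+, phiCoeff x i =
      ∑ i ∈ Fintype.piFinset fun k : Fin r => (x.row k).support, phiCoeff x i := by
    refine finsum_eq_sum_of_support_subset _ fun i hi => ?_
    rw [Finset.mem_coe, Fintype.mem_piFinset]
    intro k
    rw [Finsupp.mem_support_iff]
    intro hk
    refine hi ?_
    have h0 : ∏ k : Fin r, (x.j (k.1.succPNat, i k) : ℚ) = 0 :=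
      Finset.prod_eq_zero (Finset.mem_univ k) (by rw [← T.row_apply, hk, Nat.cast_zero])
    rw [phiCoeff, h0, mul_zero, map_zero, zero_mul, Localization.mk_zero, zero_smul]
  rw [phiTerm, h1, Finset.sum_mul, Finset.sum_mul, T.term, B0.hWord_eq_sum, map_sum,
    Finset.smul_sum, map_sum, of_sum]
  refine Finset.sum_congr rfl fun i hi => ?_
  rw [Fintype.mem_piFinset] at hi
  rw [phiCoeff_mul_hDiv x i fun k => Finsupp.mem_support_iff.1 (hi k), ← map_mul, ← map_mul,
    B0.zetaOps_eFree_mul _ (Subalgebra.prod_mem _ fun k _ => B0.divCoeff_mem _ _ _),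
    B0.zetaOps_eList, smul_mul_assoc, mul_assoc]
  simp only [zero_add]
  rfl

/-! ### The initial value -/

/-- The element of `T(0,s)` given by a set of `s` elements. -/
def T.ofFinset (I : {I : Finset ℕ+ // I.card = s}) : T 0 s :=
  T.ofRows (fun _ => 0) (fun k => Nat.casesOn k I.1 fun _ => ∅)
    (fun k hk => by obtain ⟨k, rfl⟩ := Nat.exists_eq_succ_of_ne_zero hk.ne'; rfl)
    (by rw [zero_add, Finset.sum_range_one]; exact I.2)

theorem T.ofFinset_bijective : Function.Bijective (T.ofFinset (s := s)) := by
  refine ⟨fun I J h => Subtype.ext (congrFun (congrArg T.block h) 0), fun x => ?_⟩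
  have hx := x.sum_card
  rw [zero_add, Finset.sum_range_one] at hx
  refine ⟨⟨x.block 0, hx⟩, T.ext_row (fun k => ?_) (funext fun k => ?_)⟩
  · rw [T.row_eq_zero _ k.zero_le, T.row_eq_zero _ k.zero_le]
  · rcases k with _ | k
    · rfl
    · exact (x.block_eq_empty _ k.succ_pos).symm

theorem T.term_ofFinset (I : {I : Finset ℕ+ // I.card = s}) :
    (T.ofFinset I).term = B0.e I * (I.1.sort.map (B0.zeta 0)).prod := by
  have hc : (T.ofFinset I).coeff = 1 := by
    rw [T.coeff_eq, T.coeffOf, zero_add, Finset.prod_range_one, Finset.prod_range_succ']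
    have h : ∀ q ∈ Finset.range ((T.ofFinset I).block 0).card, ((max 1 (q + 1 +
        (∑ k ∈ Finset.Ico 0 0, total ((T.ofFinset I).row k) + ∑ k ∈ Finset.Ico (0 + 1) 1,
          ((T.ofFinset I).block k).card)) : ℕ) : ℚ) = ((q + 1 : ℕ) : ℚ) := by
      intro q _
      simp
    rw [Finset.prod_congr rfl h, ← Nat.cast_prod, Finset.prod_range_add_one_eq_factorial]
    simp [Nat.factorial_ne_zero]
  have hp : (T.ofFinset I).pairs = I.1.sort.map fun i => (0, i) := by
    rw [T.pairs_eq, List.range_zero, List.flatMap_nil, List.append_nil]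
    rfl
  rw [T.term, hc, map_one, one_smul, hp]
  change zetaOps _ (B0.e ∅) = _
  rw [← eList_nil, B0.zetaOps_eList, List.append_nil, List.map_map, List.map_map]
  change eList (I.1.sort.map id) * (I.1.sort.map (B0.zeta 0)).prod = _
  rw [List.map_id, eList_sort]

/-! ### The solution -/

theorem nabla_of (u : B1) : nabla (of u) = of (B1.nabla u) :=
  IsLocalizedModule.map_apply thetaMonoid (LocalizedModule.mkLinearMap thetaMonoid B1)
    (LocalizedModule.mkLinearMap thetaMonoid B1) B1.nabla u
theorem thetaOp_of (u : B1) : thetaOp (of u) = of (B1.thetaOp u) :=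
  IsLocalizedModule.map_apply thetaMonoid (LocalizedModule.mkLinearMap thetaMonoid B1)
    (LocalizedModule.mkLinearMap thetaMonoid B1) B1.thetaOp u
theorem shift_of (m : ℕ) (u : B1) : shift m (of u) = of (B1.shift m u) :=
  IsLocalizedModule.map_apply thetaMonoid (LocalizedModule.mkLinearMap thetaMonoid B1)
    (LocalizedModule.mkLinearMap thetaMonoid B1) (B1.shift m) u

theorem delta_of (k : ℕ) (u : B1) : delta k (of u) = of (B1.delta k u) := by
  rcases k with _ | k
  · rw [delta, shift_of, ← map_mul]
    rfl
  · exact shift_of _ _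

theorem of_altDelta (n : ℕ) (u : B1) : of (B1.altDelta n u) =
    ∑ k ∈ Finset.range (n + 1), (-1 : ℤ) ^ k • delta k (of u) := by
  rw [B1.altDelta, of_sum]
  refine Finset.sum_congr rfl fun k _ => ?_
  rw [of_zsmul, delta_of]

/-- The explicit solution. -/
def sol (x : ℤ × ℤ) : BHdR := of (B1.sol x.1 x.2)

theorem sol_of_neg {r s : ℤ} (h : r < 0 ∨ s < 0) : sol (r, s) = 0 :=
  (congrArg of (B1.sol_of_neg h)).trans (map_zero of)

theorem D_sol : D sol = 0 := by
  funext ⟨r, s⟩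
  by_cases hr : r < 0
  · have h0 : (r + 1).toNat = 0 := by omega
    have hz : s.negOnePow • (0 : BHdR) = 0 := zsmul_zero ((s.negOnePow : ℤˣ) : ℤ)
    rw [D, sol_of_neg (Or.inl hr), sol_of_neg (Or.inl hr), h0, Finset.range_zero, Finset.sum_empty,
      map_zero, map_zero, hz, add_zero, sub_zero]
    rfl
  · obtain ⟨n, rfl⟩ := Int.eq_ofNat_of_zero_le (not_lt.1 hr)
    have h := congrArg of (B1.defect_sol n s)
    rw [map_sub, map_add, of_zsmul, map_zero, ← nabla_of, ← thetaOp_of, of_altDelta] at h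
    exact h

theorem hasSum_ofFinset (s : ℕ) : HasSum
    (fun I : {I : Finset ℕ+ // I.card = s} => B1.of (T.ofFinset I).term) (B1.solNat 0 s) := by
  refine B1.hasSum_of_eq (g := (fun x : T 0 s => B1.of x.term) ∘ T.ofFinset) (fun _ => rfl) ?_
  refine (T.ofFinset_bijective.1.hasSum_iff fun x hx => ?_).2 (B1.hasSum_solNat 0 s)
  exact absurd (T.ofFinset_bijective.2 x) hx

theorem isSolution_sol : IsSolution sol := by
  refine ⟨D_sol, fun s => ?_, fun r s h => sol_of_neg h⟩
  refine ⟨fun I => B1.of (T.ofFinset I).term, B1.solNat 0 s, fun I => ?_, hasSum_ofFinset s, ?_⟩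
  · exact congrArg (fun x => of (B1.of x)) (T.term_ofFinset I)
  · exact congrArg of (B1.sol_natCast 0 s).symm

end BHdR

end HdR

end

theorem mainTheorem1 :
    ∃ φ : ℤ × ℤ → HdR.BHdR, HdR.BHdR.IsSolution φ ∧
      ∀ r s : ℕ, HdR.BHdR.SumsTo (HdR.BHdR.phiTerm r s) (φ (r, s)) :=
  ⟨HdR.BHdR.sol, HdR.BHdR.isSolution_sol, fun r s =>
    ⟨fun x => HdR.B1.of x.term, HdR.B1.solNat r s, fun x => (HdR.BHdR.phiTerm_eq x).symm,
      HdR.B1.hasSum_solNat r s, congrArg HdR.BHdR.of (HdR.B1.sol_natCast r s).symm⟩⟩
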